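/- Let $M^3$ be a smooth 3-manifold with boundary $\Sigma$ (possibly empty, not necessarily connected) which is the union of a compact set and finitely many disjoint ends, each diffeomorphic to $\mathbb R^3$ minus a closed ball, with infinity in each end corresponding to infinity in $\mathbb R^3$; let $S_r$ be the union of the coordinate spheres $\{|x|=r\}$ of the ends. Let $g$ be a smooth Riemannian metric and $k$ a smooth symmetric 2-tensor on $M$, and define the energy density $\mu$ and momentum density $J$ by $$16\pi\mu = R+(\operatorname{tr}_g k)^2-\|k\|_g^2,\qquad 8\pi J=\operatorname{div}_g\big(k-(\operatorname{tr}_g k)g\big),$$ where $R$ is the scalar curvature of $g$. Let $f$ and $\varphi>0$ be smooth functions on $M\setminus\Sigma$ (no behaviour of $f$, $\varphi$ at $\Sigma$ is prescribed; $f$ may blow up there), and put, on $M\setminus\Sigma$, $$\bar g=g+\varphi^2df^2,\qquad h=\frac{\varphi\operatorname{Hess}_g f+df\otimes d\varphi+d\varphi\otimes df}{(1+\varphi^2|df|_g^2)^{1/2}},\qquad v=\frac{\varphi\nabla_g f}{(1+\varphi^2|df|_g^2)^{1/2}}.$$ Suppose that 1. $\mu\ge|J|_g$ on $M\setminus\Sigma$;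 2. the generalized Jang equation $\operatorname{tr}_{\bar g}(h-k)=0$ holds on $M\setminus\Sigma$; 3. $\displaystyle\lim_{r\to\infty}\int_{S_r}\varphi\,(h-k)(v,\bar\nu)\,\overline{dA}=0$, where $\bar\nu$ and $\overline{dA}$ are the unit normal of $S_r$ pointing to infinity and the area element with respect to $\bar g$; 4. for some family $U_\varepsilon$ ($\varepsilon>0$) of open neighbourhoods of $\Sigma$ which shrink to $\Sigma$ as $\varepsilon\to0$ (every neighbourhood of $\Sigma$ contains $U_\varepsilon$ for all small $\varepsilon$) and whose boundaries $\Sigma_\varepsilon=\partial U_\varepsilon$ are smooth embedded surfaces in $M\setminus\Sigma$ with $U_\varepsilon$ locally on one side, $$\lim_{\varepsilon\to0}\int_{\Sigma_\varepsilon}\frac{\varphi\,(h-k)\big(v,\nu-\langle\nu,v\rangle_g v\big)}{(1-|v|_g^2)^{1/2}}\,dA=0,$$ where $\nu$ is the unit normal of $\Sigma_\varepsilon$ pointing out of $U_\varepsilon$ and $dA$ the area element, both with respect to $g$. Then, with $\bar R$ the scalar curvature and $\overline{dV}$ the volume measure of $\bar g$, $$\int_M\bar R\,\varphi\,\overline{dV}\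 \ge\ 0,$$ in each of the following senses. If $M_{\varepsilon,r}$ is the part of $M\setminus U_\varepsilon$ inside $S_r$, then for all small $\varepsilon$ and large $r$ the function $\bar R\varphi$ is integrable on $M_{\varepsilon,r}$, and $\int_{M_{\varepsilon,r}}\bar R\varphi\,\overline{dV}$ converges, as $\varepsilon\to0$ and $r\to\infty$ (jointly), to a limit in $[0,\infty]$. Moreover $\int_M(\bar R\varphi)^-\,\overline{dV}\le\int_M(\bar R\varphi)^+\,\overline{dV}$ in $[0,\infty]$; in particular, the Lebesgue integral $\int_M\bar R\varphi\,\overline{dV}$ is nonnegative whenever it exists. -/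

import Mathlib

open Set Filter Topology MeasureTheory Manifold
open scoped ContDiff

noncomputable section

namespace JangEH

/-- Coordinate space. -/
abbrev E3 : Type := EuclideanSpace ℝ (Fin 3)

/-- The `i`-th coordinate vector of coordinate space. -/
def basisVec (i : Fin 3) : E3 := EuclideanSpace.single i 1

/-- A field of `3 × 3` matrices on coordinate space: the components of a 2-tensor in a chart. -/
abbrev MatField : Type := E3 → Matrix (Fin 3) (Fin 3) ℝ

/-! ### Tensor calculus in one coordinate chart -/

/-- The partial derivative `∂ᵢ F` at `y`. -/
def pd (i : Fin 3) (F : E3 → ℝ) (y : E3) : ℝ := fderiv ℝ F y (basisVec i)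

/-- `Γᵐᵢⱼ = ½ Gᵐˡ (∂ᵢ Gⱼₗ + ∂ⱼ Gᵢₗ - ∂ₗ Gᵢⱼ)`. -/
def christoffel (G : MatField) (m i j : Fin 3) (y : E3) : ℝ :=
  (1 / 2) * ∑ l, (G y)⁻¹ m l *
    (pd i (fun z => G z j l) y + pd j (fun z => G z i l) y - pd l (fun z => G z i j) y)

/-- `Rᵢⱼ = ∂ₘ Γᵐᵢⱼ - ∂ⱼ Γᵐᵢₘ + Γᵐₘₗ Γˡᵢⱼ - Γᵐⱼₗ Γˡᵢₘ`. -/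
def ricci (G : MatField) (i j : Fin 3) (y : E3) : ℝ :=
  ∑ m, (pd m (christoffel G m i j) y - pd j (christoffel G m i m) y) +
    ∑ m, ∑ l, (christoffel G m m l y * christoffel G l i j y -
      christoffel G m j l y * christoffel G l i m y)

/-- The scalar curvature `Gⁱʲ Rᵢⱼ`. -/
def scalarC (G : MatField) (y : E3) : ℝ := ∑ i, ∑ j, (G y)⁻¹ i j * ricci G i j y

/-- The trace `Gⁱʲ Kᵢⱼ`. -/
def traceC (G K : MatField) (y : E3) : ℝ := ∑ i, ∑ j, (G y)⁻¹ i j * K y i j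

/-- The squared norm `Gⁱᵃ Gʲᵇ Kᵢⱼ Kₐᵦ`. -/
def normSqC (G K : MatField) (y : E3) : ℝ :=
  ∑ i, ∑ j, ∑ a, ∑ b, (G y)⁻¹ i a * (G y)⁻¹ j b * K y i j * K y a b

/-- The covariant derivative `∇ₗ Sᵢⱼ = ∂ₗ Sᵢⱼ - Γᵐₗᵢ Sₘⱼ - Γᵐₗⱼ Sᵢₘ`. -/
def covDerivC (G S : MatField) (l i j : Fin 3) (y : E3) : ℝ :=
  pd l (fun z => S z i j) y -
    ∑ m, (christoffel G m l i y * S y m j + christoffel G m l j y * S y i m)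

/-- The divergence `(div S)ⱼ = Gⁱˡ ∇ₗ Sᵢⱼ`. -/
def divC (G S : MatField) (j : Fin 3) (y : E3) : ℝ :=
  ∑ i, ∑ l, (G y)⁻¹ i l * covDerivC G S l i j y

/-- The Hessian `∂ᵢ ∂ⱼ F - Γᵐᵢⱼ ∂ₘ F`. -/
def hessC (G : MatField) (F : E3 → ℝ) (i j : Fin 3) (y : E3) : ℝ :=
  pd i (pd j F) y - ∑ m, christoffel G m i j y * pd m F y

/-! ### Tensors on a 3-manifold with boundary -/

variable {M : Type*} [TopologicalSpace M] [ChartedSpace (EuclideanHalfSpace 3) M]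

variable (M) in
/-- Values of a 2-tensor on the tangent spaces of `M`. -/
abbrev Tensor2 : Type _ :=
  (p : M) → TangentSpace (𝓡∂ 3) p → TangentSpace (𝓡∂ 3) p → ℝ

variable (M) in
/-- Cauchy data on a 3-manifold (with boundary): a smooth Riemannian metric `g` and a smooth
symmetric 2-tensor `k`. -/
structure CauchyData [IsManifold (𝓡∂ 3) ∞ M] where
  g : Bundle.ContMDiffRiemannianMetric (𝓡∂ 3) ∞ E3 (fun p : M => TangentSpace (𝓡∂ 3) p)
  k : (p : M) → TangentSpace (𝓡∂ 3) p →L[ℝ] TangentSpace (𝓡∂ 3) p →L[ℝ] ℝ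
  k_symm : ∀ (p : M) (a b : TangentSpace (𝓡∂ 3) p), k p a b = k p b a
  k_smooth : ContMDiff (𝓡∂ 3) ((𝓡∂ 3).prod 𝓘(ℝ, E3 →L[ℝ] E3 →L[ℝ] ℝ)) ∞
    (fun p : M => Bundle.TotalSpace.mk' (E3 →L[ℝ] E3 →L[ℝ] ℝ)
      (E := fun p : M => TangentSpace (𝓡∂ 3) p →L[ℝ] TangentSpace (𝓡∂ 3) p →L[ℝ] ℝ) p (k p))

/-- The metric of Cauchy data as a 2-tensor. -/
def CauchyData.gT [IsManifold (𝓡∂ 3) ∞ M] (D : CauchyData M) : Tensor2 M :=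
  fun p a b => D.g.inner p a b

/-- The second tensor of Cauchy data as a 2-tensor. -/
def CauchyData.kT [IsManifold (𝓡∂ 3) ∞ M] (D : CauchyData M) : Tensor2 M :=
  fun p a b => D.k p a b

/-- The coordinate vector `∂ᵢ` of the chart `e` at the point with coordinates `y`. -/
def coordVec (e : PartialEquiv M E3) (y : E3) (i : Fin 3) : TangentSpace (𝓡∂ 3) (e.symm y) :=
  mfderiv 𝓘(ℝ, E3) (𝓡∂ 3) e.symm y (basisVec i)

/-- The components of a 2-tensor in the chart `e`, as functions of the coordinates. -/
def components (T : Tensor2 M) (e : PartialEquiv M E3) : MatField :=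
  fun y => Matrix.of fun i j => T (e.symm y) (coordVec e y i) (coordVec e y j)

/-- The components of a 2-tensor in the preferred chart at `p`. -/
abbrev compAt (T : Tensor2 M) (p : M) : MatField := components T (extChartAt (𝓡∂ 3) p)

/-- The coordinates of `p` in the preferred chart at `p`. -/
abbrev ptAt (p : M) : E3 := extChartAt (𝓡∂ 3) p p

/-- The coordinate vectors of the preferred chart at `p`, as tangent vectors at `p`. -/
def frame (p : M) (i : Fin 3) : TangentSpace (𝓡∂ 3) p :=
  (coordVec (extChartAt (𝓡∂ 3) p) (ptAt p) i : E3)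

/-- The `i`-th component of a tangent vector at `p` in the preferred chart at `p`. -/
def coord (p : M) (a : TangentSpace (𝓡∂ 3) p) (i : Fin 3) : ℝ :=
  let w : E3 := mfderiv (𝓡∂ 3) 𝓘(ℝ, E3) (extChartAt (𝓡∂ 3) p) p a
  w i

/-- The differential of a function, `d f_p (a)`. -/
def diff (f : M → ℝ) (p : M) (a : TangentSpace (𝓡∂ 3) p) : ℝ :=
  (mfderiv (𝓡∂ 3) 𝓘(ℝ, ℝ) f p a : ℝ)

/-- The scalar curvature of the metric `T` at an interior point `p`. -/
def scalarCurvature (T : Tensor2 M) (p : M) : ℝ := scalarC (compAt T p) (ptAt p)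

/-- The trace `tr_T S` at `p`. -/
def trace (T S : Tensor2 M) (p : M) : ℝ := traceC (compAt T p) (compAt S p) (ptAt p)

/-- The Hessian of `f` with respect to the metric `T`. -/
def hess (T : Tensor2 M) (f : M → ℝ) : Tensor2 M := fun p a b =>
  ∑ i, ∑ j, hessC (compAt T p) (f ∘ (extChartAt (𝓡∂ 3) p).symm) i j (ptAt p) *
    coord p a i * coord p b j

/-- The gradient of `f` with respect to the metric `T`. -/
def grad (T : Tensor2 M) (f : M → ℝ) (p : M) : TangentSpace (𝓡∂ 3) p :=
  ∑ i, (∑ j, (compAt T p (ptAt p))⁻¹ i j * diff f p (frame p j)) • frame p i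

/-- The squared norm `|df|²` with respect to the metric `T`. -/
def diffNormSq (T : Tensor2 M) (f : M → ℝ) (p : M) : ℝ := diff f p (grad T f p)

/-! ### Energy and momentum density -/

section Cauchy

variable [IsManifold (𝓡∂ 3) ∞ M] (D : CauchyData M)

/-- The energy density: `16 π μ = R + (tr k)² - ‖k‖²`. -/
def energyDensity (p : M) : ℝ :=
  (scalarCurvature D.gT p + trace D.gT D.kT p ^ 2 -
    normSqC (compAt D.gT p) (compAt D.kT p) (ptAt p)) / (16 * Real.pi)

/-- The components of the momentum density in the preferred chart at `p`:
`8 π J = div (k - (tr k) g)`. -/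
def momentumDensity (p : M) (j : Fin 3) : ℝ :=
  divC (compAt D.gT p)
    (fun y => compAt D.kT p y - traceC (compAt D.gT p) (compAt D.kT p) y • compAt D.gT p y)
    j (ptAt p) / (8 * Real.pi)

/-- The norm `|J|` with respect to `g`. -/
def momentumNorm (p : M) : ℝ :=
  Real.sqrt (∑ i, ∑ j, (compAt D.gT p (ptAt p))⁻¹ i j *
    momentumDensity D p i * momentumDensity D p j)

/-! ### The metric `ḡ`, the tensor `h` and the vector field `v` -/

variable (f φ : M → ℝ)

/-- `ḡ = g + φ² df²`. -/
def gBar : Tensor2 M := fun p a b => D.gT p a b + φ p ^ 2 * (diff f p a * diff f p b)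

/-- `(1 + φ² |df|²)^{1/2}`, the norm being taken with respect to `g`. -/
def lapse (p : M) : ℝ := Real.sqrt (1 + φ p ^ 2 * diffNormSq D.gT f p)

/-- `h = (φ Hess f + df ⊗ dφ + dφ ⊗ df) / (1 + φ² |df|²)^{1/2}`. -/
def hTensor : Tensor2 M := fun p a b =>
  (φ p * hess D.gT f p a b + (diff f p a * diff φ p b + diff φ p a * diff f p b)) /
    lapse D f φ p

/-- The tensor `h - k`. -/
def hMinusK : Tensor2 M := fun p a b => hTensor D f φ p a b - D.kT p a b

/-- `v = φ ∇f / (1 + φ² |df|²)^{1/2}`. -/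
def vField (p : M) : TangentSpace (𝓡∂ 3) p := (φ p / lapse D f φ p) • grad D.gT f p

end Cauchy

/-! ### Volume, hypersurfaces, area and unit normals -/

/-- Smooth coordinate charts of the interior of `M`. -/
structure IsCoordChart (e : OpenPartialHomeomorph M E3) : Prop where
  source_subset : e.source ⊆ (𝓡∂ 3).interior M
  smooth : ContMDiffOn (𝓡∂ 3) 𝓘(ℝ, E3) ∞ e e.source
  smooth_symm : ContMDiffOn 𝓘(ℝ, E3) (𝓡∂ 3) ∞ e.symm e.target

/-- Coordinate charts in which the set `U` is given by `x₂ < 0` (the coordinates being `x₀`, `x₁`,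
`x₂`), so that the frontier of `U` is the surface `x₂ = 0`. -/
structure IsSliceChart (U : Set M) (e : OpenPartialHomeomorph M E3) : Prop where
  isCoordChart : IsCoordChart e
  mem_iff : ∀ p ∈ e.source, p ∈ U ↔ e p 2 < 0

/-- `U` is open and its frontier is a smooth embedded surface in the interior of `M`, with `U`
locally on one side of it. -/
structure IsSmoothDomain (U : Set M) : Prop where
  isOpen : IsOpen U
  exists_slice : ∀ p ∈ frontier U, ∃ e : OpenPartialHomeomorph M E3,
    IsSliceChart U e ∧ p ∈ e.source

/-- The inclusion of the coordinate plane `x₂ = 0`. -/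
def planeIncl (y : EuclideanSpace ℝ (Fin 2)) : E3 := !₂[y 0, y 1, 0]

/-- The unit normal, with respect to the metric `T`, of the surface `x₂ = 0` in the chart `e`,
pointing towards `x₂ > 0`: its components are `Gⁱ² / (G²²)^{1/2}`. -/
def sliceNormal (T : Tensor2 M) (e : OpenPartialHomeomorph M E3) (p : M) :
    TangentSpace (𝓡∂ 3) p :=
  (∑ i, ((components T e.toPartialEquiv (e p))⁻¹ i 2 /
    Real.sqrt ((components T e.toPartialEquiv (e p))⁻¹ 2 2)) •
      (coordVec e.toPartialEquiv (e p) i : E3) : E3)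

open Classical in
/-- The unit normal, with respect to the metric `T`, of the frontier of `U`, pointing out of `U`. -/
def unitNormal (T : Tensor2 M) (U : Set M) (p : M) : TangentSpace (𝓡∂ 3) p :=
  if h : ∃ e : OpenPartialHomeomorph M E3, IsSliceChart U e ∧ p ∈ e.source
  then sliceNormal T h.choose p else 0

variable [MeasurableSpace M]

/-- The measure `(det G)^{1/2} dx⁰ dx¹ dx²` of a chart. -/
def chartVolume (T : Tensor2 M) (e : OpenPartialHomeomorph M E3) : Measure M :=
  ((volume.restrict e.target).withDensity fun y =>
    ENNReal.ofReal (Real.sqrt (components T e.toPartialEquiv y).det)).map e.symm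

/-- The Riemannian volume measure of the metric `T` on the interior of `M`: the measure which is
`chartVolume T e` on the domain of each chart `e` (these agree on overlaps, and their least upper
bound is the measure obtained by gluing them). -/
def volumeMeasure (T : Tensor2 M) : Measure M :=
  ⨆ (e : OpenPartialHomeomorph M E3) (_ : IsCoordChart e), chartVolume T e

/-- The measure `(det (Gₐᵦ)_{a, b ≤ 1})^{1/2} dx⁰ dx¹` on the surface `x₂ = 0` of a chart. -/
def sliceArea (T : Tensor2 M) (e : OpenPartialHomeomorph M E3) : Measure M :=
  ((volume.restrict (planeIncl ⁻¹' e.target)).withDensity fun y =>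
    ENNReal.ofReal (Real.sqrt ((components T e.toPartialEquiv (planeIncl y)).submatrix
      (Fin.castSucc : Fin 2 → Fin 3) (Fin.castSucc : Fin 2 → Fin 3)).det)).map
    (fun y => e.symm (planeIncl y))

/-- The area measure, for the metric induced by `T`, on the frontier of a smooth domain `U`,
glued from the slice charts as above. -/
def areaMeasure (T : Tensor2 M) (U : Set M) : Measure M :=
  ⨆ (e : OpenPartialHomeomorph M E3) (_ : IsSliceChart U e), sliceArea T e

end JangEH

namespace JangEH

variable {M : Type*} [TopologicalSpace M] [ChartedSpace (EuclideanHalfSpace 3) M]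

/-! ### Ends and boundary fluxes -/

variable (M) in
/-- `M` is a compact set together with `N` disjoint ends, each of which is diffeomorphic to the
complement of a closed ball in `ℝ³`, with infinity in the end corresponding to infinity in `ℝ³`. -/
structure Ends (N : ℕ) where
  chart : Fin N → OpenPartialHomeomorph M E3
  isCoordChart : ∀ i, IsCoordChart (chart i)
  radius : Fin N → ℝ
  radius_pos : ∀ i, 0 < radius i
  target_eq : ∀ i, (chart i).target = (Metric.closedBall 0 (radius i))ᶜ
  disjoint : Pairwise fun i j => Disjoint (chart i).source (chart j).source
  isClosed_outer : ∀ i r, radius i < r →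
    IsClosed {p | p ∈ (chart i).source ∧ r ≤ ‖chart i p‖}
  isCompact_core : ∀ r : ℝ, IsCompact (⋃ i, {p | p ∈ (chart i).source ∧ r < ‖chart i p‖})ᶜ

/-- The part of `M` inside the coordinate spheres of radius `r` in the ends. For large `r` its
frontier is `S_r`, the union of these spheres. -/
def Ends.inside {N : ℕ} (E : Ends M N) (r : ℝ) : Set M :=
  (⋃ i, {p | p ∈ (E.chart i).source ∧ r ≤ ‖E.chart i p‖})ᶜ

/-- `U ε`, `ε > 0`, are open neighbourhoods of the boundary `Σ` of `M` with smooth frontiers `Σ_ε`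
lying in the interior of `M`, and they shrink to `Σ` as `ε → 0`. -/
structure IsCollarFamily (U : ℝ → Set M) : Prop where
  isSmoothDomain : ∀ ε > 0, IsSmoothDomain (U ε)
  boundary_subset : ∀ ε > 0, (𝓡∂ 3).boundary M ⊆ U ε
  shrinks : ∀ W : Set M, IsOpen W → (𝓡∂ 3).boundary M ⊆ W → ∀ᶠ ε in 𝓝[>] (0 : ℝ), U ε ⊆ W

variable [IsManifold (𝓡∂ 3) ∞ M] [MeasurableSpace M] (D : CauchyData M) (f φ : M → ℝ)

/-- `∫_{S_r} φ (h - k)(v, ν̄) dĀ`, where `ν̄` and `dĀ` are the unit normal pointing to infinity and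
the area element with respect to `ḡ`. -/
def fluxAtInfinity {N : ℕ} (E : Ends M N) (r : ℝ) : ℝ :=
  ∫ p, φ p * hMinusK D f φ p (vField D f φ p) (unitNormal (gBar D f φ) (E.inside r) p)
    ∂(areaMeasure (gBar D f φ) (E.inside r))

/-- `∫_{∂V} φ (h - k)(v, ν - ⟨ν, v⟩ v) / (1 - |v|²)^{1/2} dA`, where `ν` is the unit normal pointing
out of `V`, and `ν`, `dA`, `⟨ , ⟩`, `| |` are taken with respect to `g`. -/
def fluxAtBoundary (V : Set M) : ℝ :=
  ∫ p, φ p * hMinusK D f φ p (vField D f φ p)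
      (unitNormal D.gT V p -
        D.gT p (unitNormal D.gT V p) (vField D f φ p) • vField D f φ p) /
      Real.sqrt (1 - D.gT p (vField D f φ p) (vField D f φ p))
    ∂(areaMeasure D.gT V)

end JangEH

end

/-! Put q = (h - k)(v, ·) and α = φ q. For a solution of the generalized Jang equation the
generalized Schoen–Yau identity reads φ R̄ + 2 div_ḡ α = φ (16π (μ - J(v)) + |h - k|²_ḡ + 2 |q|²_ḡ).
Since |v|_g < 1 and μ ≥ |J|_g, the right side is nonnegative. Integrating over the region between
Σ_ε and S_r turns the divergence into the flux of α through S_r minus that through Σ_ε; the two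
boundary hypotheses say that these fluxes tend to zero. So the integral of R̄ φ over the region is
that of a nonnegative function P up to an error tending to zero, and the integrals of P converge to
the integral of P over M, in [0, ∞]. On each region the negative part of R̄ φ exceeds the positive
part by at most that error, which gives the last two claims without integrability on M.

The identity (`schoenYauAt`) is local. Conceptually, g is the metric induced on the graph of f in
the static spacetime with metric ḡ - φ² dt², and h is its second fundamental form, so that R̄ is a
combination of the Gauss and Codazzi expressions of (g, h). Here it is checked at one point, in
coordinates which are normal for g and in which df points along the first axis. There ḡ⁻¹ = g⁻¹ - v
⊗ v is diagonal, and the claim splits into two polynomial identities: `gauss_algebra` expresses R̄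
through R and h, and `codazzi_algebra` replaces h by k with the help of the Jang equation and its
derivative. All terms are invariant under changes of coordinates (`ChangeOn`), so the identity holds
in every chart. The same invariance is needed because the curvature and the Hessian at a point are
defined in the preferred chart of that point.

The divergence theorem (`IsSmoothDomain.divergence`) comes from the half-space by a partition of
unity subordinate to slice charts. The volume and area measures, defined as suprema of chart
measures, restrict to those chart measures because the densities transform correctly
(`iSup_measure_glue`). The boundary integrands of the theorem are the flux densities of α by
`isFluxDensity_infinity` and `isFluxDensity_boundary`; the limit is taken in
`tendsto_setIntegral_of_nonneg_add`. -/

namespace JangEH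

/-! ### Partial derivatives -/

theorem pd_congr {F H : E3 → ℝ} {y : E3} (h : F =ᶠ[𝓝 y] H) (i : Fin 3) : pd i F y = pd i H y := by
  simp only [pd, h.fderiv_eq]

theorem pd_congr_on {F H : E3 → ℝ} {U : Set E3} (hU : IsOpen U) (h : ∀ z ∈ U, F z = H z) {y : E3}
    (hy : y ∈ U) (i : Fin 3) : pd i F y = pd i H y :=
  pd_congr (Filter.eventuallyEq_of_mem (hU.mem_nhds hy) h) i

theorem pd_const (c : ℝ) (i : Fin 3) (y : E3) : pd i (fun _ => c) y = 0 := by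
  simp [pd]

theorem pd_add {F H : E3 → ℝ} {y : E3} (hF : DifferentiableAt ℝ F y) (hH : DifferentiableAt ℝ H y)
    (i : Fin 3) : pd i (fun z => F z + H z) y = pd i F y + pd i H y := by
  simp [pd, fderiv_fun_add hF hH]

theorem pd_sub {F H : E3 → ℝ} {y : E3} (hF : DifferentiableAt ℝ F y) (hH : DifferentiableAt ℝ H y)
    (i : Fin 3) : pd i (fun z => F z - H z) y = pd i F y - pd i H y := by
  simp [pd, fderiv_fun_sub hF hH]

theorem pd_mul {F H : E3 → ℝ} {y : E3} (hF : DifferentiableAt ℝ F y) (hH : DifferentiableAt ℝ H y)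
    (i : Fin 3) : pd i (fun z => F z * H z) y = pd i F y * H y + F y * pd i H y := by
  simp [pd, fderiv_fun_mul hF hH]; ring

theorem pd_sum {ι : Type*} {s : Finset ι} {F : ι → E3 → ℝ} {y : E3}
    (hF : ∀ a ∈ s, DifferentiableAt ℝ (F a) y) (i : Fin 3) :
    pd i (fun z => ∑ a ∈ s, F a z) y = ∑ a ∈ s, pd i (F a) y := by
  simp [pd, fderiv_fun_sum hF]

theorem pd_pow_two {F : E3 → ℝ} {y : E3} (hF : DifferentiableAt ℝ F y) (i : Fin 3) :
    pd i (fun z => F z ^ 2) y = 2 * F y * pd i F y := by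
  simp only [pow_two, pd_mul hF hF]; ring

theorem pd_inv {F : E3 → ℝ} {y : E3} (hF : DifferentiableAt ℝ F y) (h0 : F y ≠ 0) (i : Fin 3) :
    pd i (fun z => (F z)⁻¹) y = -pd i F y / F y ^ 2 := by
  have : fderiv ℝ (fun z => (F z)⁻¹) y = _ :=
    ((hasDerivAt_inv h0).comp_hasFDerivAt y hF.hasFDerivAt).fderiv
  simp only [pd, this]
  simp; ring

theorem pd_sqrt {F : E3 → ℝ} {y : E3} (hF : DifferentiableAt ℝ F y) (h0 : 0 < F y) (i : Fin 3) :
    pd i (fun z => Real.sqrt (F z)) y = pd i F y / (2 * Real.sqrt (F y)) := by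
  simp only [pd, (hF.hasFDerivAt.sqrt h0.ne').fderiv]
  simp; ring

theorem contDiffOn_pd {F : E3 → ℝ} {U : Set E3} (hU : IsOpen U) (hF : ContDiffOn ℝ ∞ F U)
    (i : Fin 3) : ContDiffOn ℝ ∞ (pd i F) U :=
  (hF.fderiv_of_isOpen hU (by simp)).clm_apply contDiffOn_const

theorem diffAt_of_contDiffOn {E : Type*} [NormedAddCommGroup E] [NormedSpace ℝ E]
    {F : E3 → E} {U : Set E3} (hU : IsOpen U)
    (hF : ContDiffOn ℝ ∞ F U) {y : E3} (hy : y ∈ U) : DifferentiableAt ℝ F y :=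
  (hF.contDiffAt (hU.mem_nhds hy)).differentiableAt (by simp)

theorem pd_comm {F : E3 → ℝ} {U : Set E3} (hU : IsOpen U) (hF : ContDiffOn ℝ ∞ F U) {y : E3}
    (hy : y ∈ U) (i j : Fin 3) : pd i (pd j F) y = pd j (pd i F) y := by
  have hd : DifferentiableAt ℝ (fderiv ℝ F) y :=
    ((hF.fderiv_of_isOpen hU (m := ∞) (by simp)).contDiffAt (hU.mem_nhds hy)).differentiableAt
      (by simp)
  have key : ∀ a b : Fin 3, pd a (pd b F) y = fderiv ℝ (fderiv ℝ F) y (basisVec a) (basisVec b) := by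
    intro a b
    have : fderiv ℝ (fun z => fderiv ℝ F z (basisVec b)) y = _ :=
      fderiv_clm_apply hd (differentiableAt_const _)
    change fderiv ℝ (fun z => fderiv ℝ F z (basisVec b)) y (basisVec a) = _
    rw [this]
    simp
  rw [key, key]
  exact ((hF.contDiffAt (hU.mem_nhds hy)).isSymmSndFDerivAt (by simpa using WithTop.coe_le_coe.2 (le_top : (2 : ℕ∞) ≤ ⊤))) _ _

theorem eq_sum_basisVec (x : E3) : x = ∑ i, x i • basisVec i := by
  ext j; fin_cases j <;> simp [basisVec, Fin.sum_univ_three]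

theorem fderiv_apply_eq_sum {F : E3 → ℝ} {y : E3} (w : E3) :
    fderiv ℝ F y w = ∑ a, pd a F y * w a := by
  conv_lhs => rw [eq_sum_basisVec w]
  simp [map_sum, pd, mul_comm]

/-- The Jacobian matrix of a map of coordinate spaces. -/
noncomputable def jac (τ : E3 → E3) : MatField :=
  fun z => Matrix.of fun a i => pd i (fun w => τ w a) z

theorem pd_coord {τ : E3 → E3} {y : E3} (hτ : DifferentiableAt ℝ τ y) (i a : Fin 3) :
    pd i (fun w => τ w a) y = fderiv ℝ τ y (basisVec i) a := by
  have h : HasFDerivAt (fun w => τ w a)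
      ((EuclideanSpace.proj a : E3 →L[ℝ] ℝ).comp (fderiv ℝ τ y)) y :=
    (EuclideanSpace.proj a : E3 →L[ℝ] ℝ).hasFDerivAt.comp y hτ.hasFDerivAt
  simp [pd, h.fderiv]

theorem pd_comp {F : E3 → ℝ} {τ : E3 → E3} {y : E3} (hF : DifferentiableAt ℝ F (τ y))
    (hτ : DifferentiableAt ℝ τ y) (i : Fin 3) :
    pd i (fun z => F (τ z)) y = ∑ a, jac τ y a i * pd a F (τ y) := by
  have : fderiv ℝ (fun z => F (τ z)) y = _ := fderiv_comp y hF hτ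
  simp only [pd, this, ContinuousLinearMap.comp_apply, jac, Matrix.of_apply]
  rw [fderiv_apply_eq_sum]
  refine Finset.sum_congr rfl fun a _ => ?_
  rw [mul_comm]; congr 1
  exact (pd_coord hτ i a).symm

/-! ### Matrix fields -/

/-- The entrywise partial derivative of a matrix field. -/
noncomputable def mpd (l : Fin 3) (A : MatField) (y : E3) : Matrix (Fin 3) (Fin 3) ℝ :=
  Matrix.of fun i j => pd l (fun z => A z i j) y

/-- Entrywise smoothness of a matrix field. -/
def SmoothMat (A : MatField) (U : Set E3) : Prop := ∀ i j, ContDiffOn ℝ ∞ (fun z => A z i j) U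

theorem mpd_mul {A B : MatField} {U : Set E3} (hU : IsOpen U) (hA : SmoothMat A U)
    (hB : SmoothMat B U) {y : E3} (hy : y ∈ U) (l : Fin 3) :
    mpd l (fun z => A z * B z) y = mpd l A y * B y + A y * mpd l B y := by
  have dA := fun i j => diffAt_of_contDiffOn hU (hA i j) hy
  have dB := fun i j => diffAt_of_contDiffOn hU (hB i j) hy
  ext i j
  simp only [mpd, Matrix.of_apply, Matrix.mul_apply, Matrix.add_apply]
  rw [pd_sum fun a _ => (dA i a).fun_mul (dB a j), ← Finset.sum_add_distrib]
  exact Finset.sum_congr rfl fun a _ => pd_mul (dA i a) (dB a j) l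

theorem mpd_transpose (A : MatField) (y : E3) (l : Fin 3) :
    mpd l (fun z => (A z).transpose) y = (mpd l A y).transpose := rfl

theorem mpd_congr_on {A B : MatField} {U : Set E3} (hU : IsOpen U) (h : ∀ z ∈ U, A z = B z)
    {y : E3} (hy : y ∈ U) (l : Fin 3) : mpd l A y = mpd l B y := by
  ext i j
  exact pd_congr_on hU (fun z hz => by rw [h z hz]) hy l

theorem SmoothMat.congr {A B : MatField} {U : Set E3} (hA : SmoothMat A U)
    (h : ∀ z ∈ U, B z = A z) : SmoothMat B U :=
  fun i j => (hA i j).congr fun z hz => by rw [h z hz]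

theorem SmoothMat.mul {A B : MatField} {U : Set E3} (hA : SmoothMat A U) (hB : SmoothMat B U) :
    SmoothMat (fun z => A z * B z) U := fun i j => by
  simp only [Matrix.mul_apply]
  exact ContDiffOn.sum fun a _ => (hA i a).mul (hB a j)

theorem SmoothMat.transpose {A : MatField} {U : Set E3} (hA : SmoothMat A U) :
    SmoothMat (fun z => (A z).transpose) U := fun i j => hA j i

theorem SmoothMat.det {A : MatField} {U : Set E3} (hA : SmoothMat A U) :
    ContDiffOn ℝ ∞ (fun z => (A z).det) U := by
  simp only [Matrix.det_fin_three]
  have h := hA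
  unfold SmoothMat at h
  fun_prop (disch := exact h _ _)

theorem SmoothMat.inv {A : MatField} {U : Set E3} (hA : SmoothMat A U)
    (h0 : ∀ z ∈ U, (A z).det ≠ 0) : SmoothMat (fun z => (A z)⁻¹) U := by
  intro i j
  -- Cramer's rule: the entries of the inverse are cofactors, which are polynomial, divided by the
  -- determinant.
  have h1 : ∀ z, (A z)⁻¹ i j = (A z).det⁻¹ * (A z).adjugate i j := by
    intro z; simp [Matrix.inv_def]
  simp only [h1]
  refine (hA.det.inv h0).mul ?_
  simp only [Matrix.adjugate_fin_three]
  have h := hA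
  unfold SmoothMat at h
  fin_cases i <;> fin_cases j <;> simp <;> fun_prop (disch := exact h _ _)

theorem SmoothMat.mpd {A : MatField} {U : Set E3} (hU : IsOpen U) (hA : SmoothMat A U)
    (l : Fin 3) : SmoothMat (mpd l A) U := fun i j => contDiffOn_pd hU (hA i j) l

end JangEH

namespace JangEH

/-! ### Metrics in a chart and their Christoffel symbols -/

/-- A field of matrices which is a smooth Riemannian metric on `U`. -/
structure MetricOn (G : MatField) (U : Set E3) : Prop where
  smooth : SmoothMat G U
  posDef : ∀ z ∈ U, (G z).PosDef

/-- The connection matrix `(Γᵐₗⱼ)ₘⱼ` in the direction `l`. -/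
noncomputable def conn (G : MatField) (l : Fin 3) : MatField :=
  fun z => Matrix.of fun m j => christoffel G m l j z

namespace MetricOn

variable {G : MatField} {U : Set E3}

theorem symm (hG : MetricOn G U) {z : E3} (hz : z ∈ U) (i j : Fin 3) : G z i j = G z j i := by
  have := (hG.posDef z hz).isHermitian.apply i j
  simpa using this.symm

theorem transpose (hG : MetricOn G U) {z : E3} (hz : z ∈ U) : (G z).transpose = G z := by
  ext i j; exact hG.symm hz j i

theorem det_pos (hG : MetricOn G U) {z : E3} (hz : z ∈ U) : 0 < (G z).det := (hG.posDef z hz).det_pos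

theorem isUnit_det (hG : MetricOn G U) {z : E3} (hz : z ∈ U) : IsUnit (G z).det :=
  (hG.det_pos hz).ne'.isUnit

theorem inv_mul (hG : MetricOn G U) {z : E3} (hz : z ∈ U) : (G z)⁻¹ * G z = 1 :=
  Matrix.nonsing_inv_mul _ (hG.isUnit_det hz)

theorem mul_inv (hG : MetricOn G U) {z : E3} (hz : z ∈ U) : G z * (G z)⁻¹ = 1 :=
  Matrix.mul_nonsing_inv _ (hG.isUnit_det hz)

theorem inv_transpose (hG : MetricOn G U) {z : E3} (hz : z ∈ U) : (G z)⁻¹.transpose = (G z)⁻¹ := by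
  rw [Matrix.transpose_nonsing_inv, hG.transpose hz]

theorem inv_symm (hG : MetricOn G U) {z : E3} (hz : z ∈ U) (i j : Fin 3) :
    (G z)⁻¹ i j = (G z)⁻¹ j i := by
  conv_lhs => rw [← hG.inv_transpose hz]
  rfl

theorem smooth_inv (hG : MetricOn G U) : SmoothMat (fun z => (G z)⁻¹) U :=
  hG.smooth.inv fun _ hz => (hG.det_pos hz).ne'

theorem pd_symm (hG : MetricOn G U) (hU : IsOpen U) {z : E3} (hz : z ∈ U) (l i j : Fin 3) :
    pd l (fun w => G w i j) z = pd l (fun w => G w j i) z :=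
  pd_congr_on hU (fun _ hw => hG.symm hw i j) hz l

theorem christoffel_symm (hG : MetricOn G U) (hU : IsOpen U) {z : E3} (hz : z ∈ U)
    (m i j : Fin 3) : christoffel G m i j z = christoffel G m j i z := by
  unfold christoffel
  congr 1
  refine Finset.sum_congr rfl fun l _ => ?_
  rw [hG.pd_symm hU hz l i j]; ring

theorem smooth_christoffel (hG : MetricOn G U) (hU : IsOpen U) (m i j : Fin 3) :
    ContDiffOn ℝ ∞ (christoffel G m i j) U := by
  unfold christoffel
  have h1 := hG.smooth_inv
  have h2 := fun a b l => contDiffOn_pd hU (hG.smooth a b) l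
  exact contDiffOn_const.mul (ContDiffOn.sum fun l _ =>
    (h1 m l).mul (((h2 _ _ _).add (h2 _ _ _)).sub (h2 _ _ _)))

theorem smooth_conn (hG : MetricOn G U) (hU : IsOpen U) (l : Fin 3) : SmoothMat (conn G l) U :=
  fun m j => hG.smooth_christoffel hU m l j

/-- Koszul's formula with the upper index lowered: multiplication by G cancels the inverse matrix in
the definition, leaving only first derivatives of the metric. -/
theorem mul_christoffel (hG : MetricOn G U) {z : E3} (hz : z ∈ U) (n i j : Fin 3) :
    ∑ m, G z n m * christoffel G m i j z =
      (1 / 2) * (pd i (fun w => G w j n) z + pd j (fun w => G w i n) z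
        - pd n (fun w => G w i j) z) := by
  have h : ∀ v : Fin 3 → ℝ, (G z).mulVec ((G z)⁻¹.mulVec v) = v := fun v => by
    rw [Matrix.mulVec_mulVec, hG.mul_inv hz, Matrix.one_mulVec]
  have := congrFun (h fun l => (1 / 2) * (pd i (fun w => G w j l) z + pd j (fun w => G w i l) z
        - pd l (fun w => G w i j) z)) n
  rw [← this]
  simp only [Matrix.mulVec, dotProduct, christoffel]
  refine Finset.sum_congr rfl fun m _ => ?_
  congr 1
  rw [Finset.mul_sum]
  exact Finset.sum_congr rfl fun l _ => by ring

/-- The Levi-Civita connection is metric. -/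
theorem mpd_eq (hG : MetricOn G U) (hU : IsOpen U) {z : E3} (hz : z ∈ U) (l : Fin 3) :
    mpd l G z = (conn G l z).transpose * G z + G z * conn G l z := by
  ext i j
  simp only [mpd, conn, Matrix.of_apply, Matrix.add_apply, Matrix.mul_apply, Matrix.transpose_apply]
  have h1 := hG.mul_christoffel hz j l i
  have h2 := hG.mul_christoffel hz i l j
  have h3 : ∑ m, christoffel G m l i z * G z m j = ∑ m, G z j m * christoffel G m l i z :=
    Finset.sum_congr rfl fun m _ => by rw [hG.symm hz m j]; ring
  rw [h3, h1, h2, hG.pd_symm hU hz l j i]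
  ring

/-- A torsion-free metric connection is the Levi-Civita connection. -/
theorem conn_unique (hG : MetricOn G U) {z : E3} (hz : z ∈ U)
    (A : Fin 3 → Matrix (Fin 3) (Fin 3) ℝ) (hA : ∀ m i j, A i m j = A j m i)
    (h : ∀ l, mpd l G z = (A l).transpose * G z + G z * A l) (l : Fin 3) : A l = conn G l z := by
  -- Koszul's argument: metric compatibility writes each ∂G as a sum of two lowered connection
  -- terms, and in the alternating sum of three of them the symmetry of A cancels everything but
  -- twice one term.
  have key : ∀ n i j, ∑ m, G z n m * A i m j = ∑ m, G z n m * christoffel G m i j z := by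
    intro n i j
    rw [hG.mul_christoffel hz]
    have e : ∀ a b c, pd a (fun w => G w b c) z =
        ∑ m, G z c m * A a m b + ∑ m, G z b m * A a m c := by
      intro a b c
      have := congrFun (congrFun (h a) b) c
      simp only [mpd, Matrix.of_apply, Matrix.add_apply, Matrix.mul_apply,
        Matrix.transpose_apply] at this
      rw [this]
      congr 1
      exact Finset.sum_congr rfl fun m _ => by rw [hG.symm hz m c]; ring
    rw [e, e, e]
    have s : ∀ c a b, ∑ m, G z c m * A a m b = ∑ m, G z c m * A b m a := fun c a b =>
      Finset.sum_congr rfl fun m _ => by rw [hA]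
    rw [s j i n, s n j i, s i j n]; ring
  have h2 : G z * A l = G z * conn G l z := by
    ext n j
    simp only [Matrix.mul_apply]
    exact key n l j
  calc A l = (G z)⁻¹ * (G z * A l) := by rw [← Matrix.mul_assoc, hG.inv_mul hz, Matrix.one_mul]
    _ = (G z)⁻¹ * (G z * conn G l z) := by rw [h2]
    _ = conn G l z := by rw [← Matrix.mul_assoc, hG.inv_mul hz, Matrix.one_mul]

end MetricOn

/-! ### Changes of coordinates -/

/-- A smooth change of coordinates from `U` to `V`. -/
structure ChangeOn (τ : E3 → E3) (U V : Set E3) : Prop where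
  isOpen : IsOpen U
  isOpen' : IsOpen V
  smooth : ContDiffOn ℝ ∞ τ U
  mapsTo : MapsTo τ U V
  det_ne : ∀ z ∈ U, (jac τ z).det ≠ 0

namespace ChangeOn

variable {τ : E3 → E3} {U V : Set E3}

theorem smooth_coord (hτ : ChangeOn τ U V) (a : Fin 3) : ContDiffOn ℝ ∞ (fun z => τ z a) U :=
  (EuclideanSpace.proj a : E3 →L[ℝ] ℝ).contDiff.comp_contDiffOn hτ.smooth

theorem smooth_jac (hτ : ChangeOn τ U V) : SmoothMat (jac τ) U := fun a i =>
  contDiffOn_pd hτ.isOpen (hτ.smooth_coord a) i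

theorem diffAt (hτ : ChangeOn τ U V) {z : E3} (hz : z ∈ U) : DifferentiableAt ℝ τ z :=
  diffAt_of_contDiffOn hτ.isOpen hτ.smooth hz

theorem smooth_comp (hτ : ChangeOn τ U V) {F : E3 → ℝ} (hF : ContDiffOn ℝ ∞ F V) :
    ContDiffOn ℝ ∞ (fun z => F (τ z)) U := hF.comp hτ.smooth hτ.mapsTo

theorem pd_comp (hτ : ChangeOn τ U V) {F : E3 → ℝ} (hF : ContDiffOn ℝ ∞ F V) {z : E3}
    (hz : z ∈ U) (i : Fin 3) :
    pd i (fun z => F (τ z)) z = ∑ a, jac τ z a i * pd a F (τ z) :=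
  JangEH.pd_comp (diffAt_of_contDiffOn hτ.isOpen' hF (hτ.mapsTo hz)) (hτ.diffAt hz) i

theorem smoothMat_comp (hτ : ChangeOn τ U V) {A : MatField} (hA : SmoothMat A V) :
    SmoothMat (fun z => A (τ z)) U := fun i j => hτ.smooth_comp (hA i j)

theorem mpd_comp (hτ : ChangeOn τ U V) {A : MatField} (hA : SmoothMat A V) {z : E3}
    (hz : z ∈ U) (l : Fin 3) :
    mpd l (fun z => A (τ z)) z = ∑ c, jac τ z c l • mpd c A (τ z) := by
  ext i j
  simp only [mpd, Matrix.of_apply, Matrix.sum_apply, Matrix.smul_apply, smul_eq_mul]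
  exact hτ.pd_comp (hA i j) hz l

/-- Equality of mixed second derivatives of τ. It makes the pulled-back connection torsion-free and
removes the inhomogeneous terms from the curvature. -/
theorem mpd_jac_symm (hτ : ChangeOn τ U V) {z : E3} (hz : z ∈ U) (a l j : Fin 3) :
    mpd l (jac τ) z a j = mpd j (jac τ) z a l :=
  pd_comm hτ.isOpen (hτ.smooth_coord a) hz l j

theorem isUnit_det (hτ : ChangeOn τ U V) {z : E3} (hz : z ∈ U) : IsUnit (jac τ z).det :=
  (hτ.det_ne z hz).isUnit

/-- The pulled-back connection matrix in the direction `l`, with values in the target frame. -/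
noncomputable def pullConn (τ : E3 → E3) (G' : MatField) (l : Fin 3) : MatField :=
  fun z => ∑ c, jac τ z c l • conn G' c (τ z)

theorem metricOn (hτ : ChangeOn τ U V) {G G' : MatField} (hG' : MetricOn G' V)
    (h : ∀ z ∈ U, G z = (jac τ z).transpose * G' (τ z) * jac τ z) : MetricOn G U := by
  refine ⟨((hτ.smooth_jac.transpose.mul (hτ.smoothMat_comp hG'.smooth)).mul hτ.smooth_jac).congr h,
    fun z hz => ?_⟩
  rw [h z hz, ← Matrix.conjTranspose_eq_transpose_of_trivial]
  exact (hG'.posDef _ (hτ.mapsTo hz)).conjTranspose_mul_mul_same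
    (Matrix.mulVec_injective_iff_isUnit.2 ((Matrix.isUnit_iff_isUnit_det _).2 (hτ.isUnit_det hz)))

/-- The transformation law of the Christoffel symbols. -/
theorem jac_mul_conn (hτ : ChangeOn τ U V) {G G' : MatField} (hG' : MetricOn G' V)
    (h : ∀ z ∈ U, G z = (jac τ z).transpose * G' (τ z) * jac τ z) {z : E3} (hz : z ∈ U)
    (l : Fin 3) :
    jac τ z * conn G l z = mpd l (jac τ) z + pullConn τ G' l z * jac τ z := by
  have hG := hτ.metricOn hG' h
  have hV := hτ.mapsTo hz
  set J := jac τ z with hJ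
  -- A is the solution of the transformation law for the unknown connection. It is enough to see
  -- that A is torsion-free and compatible with G; uniqueness of the Levi-Civita connection then
  -- identifies it.
  set A : Fin 3 → Matrix (Fin 3) (Fin 3) ℝ :=
    fun l => J⁻¹ * (mpd l (jac τ) z + pullConn τ G' l z * J) with hA
  have hJA : ∀ l, J * A l = mpd l (jac τ) z + pullConn τ G' l z * J := fun l => by
    rw [hA, ← Matrix.mul_assoc, Matrix.mul_nonsing_inv _ (hτ.isUnit_det hz), Matrix.one_mul]
  have hsymm : ∀ m i j, A i m j = A j m i := by
    intro m i j
    have hs : ∀ a, (mpd i (jac τ) z + pullConn τ G' i z * J) a j =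
        (mpd j (jac τ) z + pullConn τ G' j z * J) a i := by
      intro a
      simp only [Matrix.add_apply, hτ.mpd_jac_symm hz a i j, pullConn, Matrix.mul_apply,
        Matrix.sum_apply, Matrix.smul_apply, smul_eq_mul, conn, Matrix.of_apply, Finset.sum_mul]
      congr 1
      rw [Finset.sum_comm]
      refine Finset.sum_congr rfl fun c _ => Finset.sum_congr rfl fun b _ => ?_
      rw [hG'.christoffel_symm hτ.isOpen' hV]; ring
    simp only [hA, Matrix.mul_apply (M := J⁻¹)]
    exact Finset.sum_congr rfl fun a _ => by rw [hs]
  have hmet : ∀ l, mpd l G z = (A l).transpose * G z + G z * A l := by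
    intro l
    have e1 : mpd l G z = _ := mpd_congr_on hτ.isOpen h hz l
    have sG := hτ.smoothMat_comp hG'.smooth
    rw [mpd_mul hτ.isOpen (hτ.smooth_jac.transpose.mul sG) hτ.smooth_jac hz,
      mpd_mul hτ.isOpen hτ.smooth_jac.transpose sG hz, hτ.mpd_comp hG'.smooth hz,
      mpd_transpose] at e1
    have e2 : ∑ c, jac τ z c l • mpd c G' (τ z) =
        (pullConn τ G' l z).transpose * G' (τ z) + G' (τ z) * pullConn τ G' l z := by
      simp only [pullConn, Matrix.transpose_sum, Finset.sum_mul, Finset.mul_sum,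
        Matrix.transpose_smul, Matrix.smul_mul, Matrix.mul_smul, ← Finset.sum_add_distrib]
      exact Finset.sum_congr rfl fun c _ => by
        rw [hG'.mpd_eq hτ.isOpen' hV, smul_add]
    rw [e1, e2, h z hz, ← hJ]
    have e3 : (A l).transpose * (J.transpose * G' (τ z) * J) =
        (J * A l).transpose * G' (τ z) * J := by
      rw [show (J * A l).transpose = (A l).transpose * J.transpose from Matrix.transpose_mul _ _]
      simp only [Matrix.mul_assoc]
    have e4 : J.transpose * G' (τ z) * J * A l = J.transpose * G' (τ z) * (J * A l) := by
      simp only [Matrix.mul_assoc]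
    rw [e3, e4, hJA, Matrix.transpose_add, Matrix.transpose_mul]
    noncomm_ring
  rw [← hG.conn_unique hz A hsymm hmet l, hJA]

end ChangeOn

end JangEH

/-! ### Covariant derivatives and curvature, and their behaviour under changes of coordinates. -/

namespace JangEH

/-- The covariant derivative `∇ₗ αⱼ` of a covector field in a chart. -/
noncomputable def covC (G : MatField) (α : E3 → Fin 3 → ℝ) (y : E3) : Matrix (Fin 3) (Fin 3) ℝ :=
  Matrix.of fun l j => pd l (fun z => α z j) y - ∑ m, christoffel G m l j y * α y m

/-- The divergence `Gˡʲ ∇ₗ αⱼ` of a covector field in a chart. -/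
noncomputable def codivC (G : MatField) (α : E3 → Fin 3 → ℝ) (y : E3) : ℝ :=
  ∑ i, ∑ j, (G y)⁻¹ i j * covC G α y i j

/-- The matrix of `∇ₗ S`. -/
noncomputable def covMat (G S : MatField) (l : Fin 3) (y : E3) : Matrix (Fin 3) (Fin 3) ℝ :=
  Matrix.of fun i j => covDerivC G S l i j y

/-- The curvature matrix of the Levi-Civita connection. -/
noncomputable def curv (G : MatField) (k l : Fin 3) (y : E3) : Matrix (Fin 3) (Fin 3) ℝ :=
  mpd k (conn G l) y - mpd l (conn G k) y + (conn G k y * conn G l y - conn G l y * conn G k y)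

theorem covMat_eq (G S : MatField) (l : Fin 3) (y : E3) :
    covMat G S l y = mpd l S y - ((conn G l y).transpose * S y + S y * conn G l y) := by
  ext i j
  simp only [covMat, covDerivC, mpd, conn, Matrix.sub_apply, Matrix.add_apply, Matrix.mul_apply,
    Matrix.of_apply, Matrix.transpose_apply, Finset.sum_add_distrib]
  congr 2
  exact Finset.sum_congr rfl fun m _ => mul_comm _ _

theorem sum_mul_eq_trace (A B : Matrix (Fin 3) (Fin 3) ℝ) :
    ∑ i, ∑ j, A i j * B i j = (A * B.transpose).trace := by
  simp [Matrix.trace, Matrix.mul_apply]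

/-- In trace form both the invariance and the nonnegativity of the norm follow from the cyclicity of
the trace. -/
theorem normSqC_eq_trace (G K : MatField) (y : E3) :
    normSqC G K y = ((G y)⁻¹ * K y * (G y)⁻¹.transpose * (K y).transpose).trace := by
  rw [← sum_mul_eq_trace]
  unfold normSqC
  refine Finset.sum_congr rfl fun i _ => Finset.sum_congr rfl fun j _ => ?_
  simp only [Matrix.mul_apply, Matrix.transpose_apply, Finset.sum_mul]
  rw [Finset.sum_comm]
  refine Finset.sum_congr rfl fun a _ => Finset.sum_congr rfl fun b _ => ?_
  ring

theorem mul_inv_mul_transpose {J G' : Matrix (Fin 3) (Fin 3) ℝ} (hJ : IsUnit J.det) :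
    J * (J.transpose * G' * J)⁻¹ * J.transpose = G'⁻¹ := by
  have hJ' : IsUnit J.transpose.det := by rwa [Matrix.det_transpose]
  rw [Matrix.mul_inv_rev, Matrix.mul_inv_rev]
  calc J * (J⁻¹ * (G'⁻¹ * J.transpose⁻¹)) * J.transpose
      = (J * J⁻¹) * G'⁻¹ * (J.transpose⁻¹ * J.transpose) := by noncomm_ring
    _ = G'⁻¹ := by
      rw [Matrix.mul_nonsing_inv _ hJ, Matrix.nonsing_inv_mul _ hJ', one_mul, mul_one]

/-- By cyclicity of the trace the outer factors of the pulled-back tensor move around and close up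
to J (Jᵀ G' J)⁻¹ Jᵀ = G'⁻¹. This is the source of every scalar invariance below. -/
theorem contract_pull {J G' : Matrix (Fin 3) (Fin 3) ℝ} (hJ : IsUnit J.det)
    (S : Matrix (Fin 3) (Fin 3) ℝ) :
    ∑ i, ∑ j, (J.transpose * G' * J)⁻¹ i j * (J.transpose * S * J) i j =
      ∑ i, ∑ j, G'⁻¹ i j * S i j := by
  rw [sum_mul_eq_trace, sum_mul_eq_trace, ← mul_inv_mul_transpose (G' := G') hJ]
  simp only [Matrix.transpose_mul, Matrix.transpose_transpose]
  rw [Matrix.mul_assoc J, Matrix.mul_assoc J, Matrix.trace_mul_comm J]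
  simp only [Matrix.mul_assoc]

/-- As a trace of the curvature matrices, Ricci inherits its transformation law from matrix
products. -/
theorem MetricOn.ricci_eq {G : MatField} {U : Set E3} (hG : MetricOn G U) (hU : IsOpen U) {y : E3}
    (hy : y ∈ U) (i j : Fin 3) : ricci G i j y = ∑ m, curv G m j y m i := by
  have e : ∀ l m a b, pd l (christoffel G m a b) y = pd l (christoffel G m b a) y :=
    fun l m a b => pd_congr_on hU (fun z hz => hG.christoffel_symm hU hz m a b) hy l
  simp only [ricci, curv, Matrix.add_apply, Matrix.sub_apply, Matrix.mul_apply, mpd,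
    Matrix.of_apply, conn]
  rw [← Finset.sum_add_distrib]
  refine Finset.sum_congr rfl fun m _ => ?_
  rw [e m m i j, e j m i m, ← Finset.sum_sub_distrib]
  congr 1
  exact Finset.sum_congr rfl fun l _ => by
    rw [hG.christoffel_symm hU hy l i j, hG.christoffel_symm hU hy l i m]

namespace ChangeOn

variable {τ : E3 → E3} {U V : Set E3} {G G' : MatField}

theorem jac_mul_conn_apply (hτ : ChangeOn τ U V) (hG' : MetricOn G' V)
    (h : ∀ z ∈ U, G z = (jac τ z).transpose * G' (τ z) * jac τ z) {z : E3} (hz : z ∈ U)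
    (l a j : Fin 3) :
    ∑ m, jac τ z a m * christoffel G m l j z = pd l (fun w => jac τ w a j) z +
      ∑ c, ∑ b, jac τ z c l * jac τ z b j * christoffel G' a c b (τ z) := by
  have := congrFun (congrFun (hτ.jac_mul_conn hG' h hz l) a) j
  simp only [Matrix.mul_apply, Matrix.add_apply, conn, Matrix.of_apply, mpd, pullConn,
    Matrix.sum_apply, Matrix.smul_apply, smul_eq_mul, Finset.sum_mul] at this
  rw [this]
  congr 1
  exact Finset.sum_congr rfl fun c _ => Finset.sum_congr rfl fun b _ => by ring

/-- The second derivatives `dJ` of the change of coordinates cancel between the two sums; this is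
why covariant derivatives of covectors are tensors. -/
theorem covariant_algebra (J : Fin 3 → Fin 3 → ℝ) (dJ α : Fin 3 → ℝ) (dα : Fin 3 → Fin 3 → ℝ)
    (Γ : Fin 3 → Fin 3 → Fin 3 → ℝ) (l j : Fin 3) :
    ∑ a, (dJ a * α a + J a j * ∑ c, J c l * dα c a) -
        ∑ a, (dJ a + ∑ c, ∑ b, J c l * J b j * Γ a c b) * α a =
      ∑ b, (∑ c, J c l * (dα c b - ∑ a, Γ a c b * α a)) * J b j := by
  simp only [Fin.sum_univ_three]
  ring

/-- Covariant differentiation of covector fields commutes with changes of coordinates. -/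
theorem covC_eq (hτ : ChangeOn τ U V) (hG' : MetricOn G' V)
    (h : ∀ z ∈ U, G z = (jac τ z).transpose * G' (τ z) * jac τ z)
    {α α' : E3 → Fin 3 → ℝ} (hα' : ∀ a, ContDiffOn ℝ ∞ (fun z => α' z a) V)
    (hα : ∀ z ∈ U, ∀ j, α z j = ∑ a, jac τ z a j * α' (τ z) a) {z : E3} (hz : z ∈ U) :
    covC G α z = (jac τ z).transpose * covC G' α' (τ z) * jac τ z := by
  ext l j
  have dJ := fun a j => diffAt_of_contDiffOn hτ.isOpen (hτ.smooth_jac a j) hz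
  have dα := fun a => diffAt_of_contDiffOn hτ.isOpen (hτ.smooth_comp (hα' a)) hz
  simp only [covC, Matrix.of_apply, Matrix.mul_apply, Matrix.transpose_apply]
  rw [pd_congr_on hτ.isOpen (fun w hw => hα w hw j) hz,
    pd_sum fun a _ => (dJ a j).fun_mul (dα a)]
  have e1 : ∀ a, pd l (fun w => jac τ w a j * α' (τ w) a) z =
      pd l (fun w => jac τ w a j) z * α' (τ z) a +
        jac τ z a j * ∑ c, jac τ z c l * pd c (fun w => α' w a) (τ z) := fun a => by
    rw [pd_mul (dJ a j) (dα a), hτ.pd_comp (hα' a) hz]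
  have e2 : ∑ m, christoffel G m l j z * α z m =
      ∑ a, (∑ m, jac τ z a m * christoffel G m l j z) * α' (τ z) a := by
    simp only [hα z hz, Finset.mul_sum, Finset.sum_mul]
    rw [Finset.sum_comm]
    exact Finset.sum_congr rfl fun c _ => Finset.sum_congr rfl fun b _ => by ring
  rw [e2]
  simp only [e1, hτ.jac_mul_conn_apply hG' h hz]
  exact covariant_algebra (jac τ z) _ _ (fun c a => pd c (fun w => α' w a) (τ z))
    (fun a c b => christoffel G' a c b (τ z)) l j

theorem codivC_eq (hτ : ChangeOn τ U V) (hG' : MetricOn G' V)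
    (h : ∀ z ∈ U, G z = (jac τ z).transpose * G' (τ z) * jac τ z)
    {α α' : E3 → Fin 3 → ℝ} (hα' : ∀ a, ContDiffOn ℝ ∞ (fun z => α' z a) V)
    (hα : ∀ z ∈ U, ∀ j, α z j = ∑ a, jac τ z a j * α' (τ z) a) {z : E3} (hz : z ∈ U) :
    codivC G α z = codivC G' α' (τ z) := by
  unfold codivC
  rw [hτ.covC_eq hG' h hα' hα hz, h z hz, contract_pull (hτ.isUnit_det hz)]

/-- The Hessian is the covariant derivative of the covector field dF, and dF pulls back by the chain
rule. -/
theorem hessC_eq (hτ : ChangeOn τ U V) (hG' : MetricOn G' V)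
    (h : ∀ z ∈ U, G z = (jac τ z).transpose * G' (τ z) * jac τ z)
    {F : E3 → ℝ} (hF : ContDiffOn ℝ ∞ F V) {z : E3} (hz : z ∈ U) :
    (Matrix.of fun i j => hessC G (fun w => F (τ w)) i j z) =
      (jac τ z).transpose * (Matrix.of fun i j => hessC G' F i j (τ z)) * jac τ z :=
  hτ.covC_eq hG' h (fun a => contDiffOn_pd hτ.isOpen' hF a)
    (fun _ hw j => hτ.pd_comp hF hw j) hz

/-- Covariant differentiation of 2-tensors commutes with changes of coordinates. -/
theorem covMat_pull (hτ : ChangeOn τ U V) (hG' : MetricOn G' V)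
    (h : ∀ z ∈ U, G z = (jac τ z).transpose * G' (τ z) * jac τ z)
    {S S' : MatField} (hS' : SmoothMat S' V)
    (hS : ∀ z ∈ U, S z = (jac τ z).transpose * S' (τ z) * jac τ z) {z : E3} (hz : z ∈ U)
    (l : Fin 3) :
    covMat G S l z =
      (jac τ z).transpose * (∑ c, jac τ z c l • covMat G' S' c (τ z)) * jac τ z := by
  have e1 : mpd l S z = _ := mpd_congr_on hτ.isOpen hS hz l
  have sS := hτ.smoothMat_comp hS'
  rw [mpd_mul hτ.isOpen (hτ.smooth_jac.transpose.mul sS) hτ.smooth_jac hz,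
    mpd_mul hτ.isOpen hτ.smooth_jac.transpose sS hz, hτ.mpd_comp hS' hz, mpd_transpose] at e1
  have e2 : ∑ c, jac τ z c l • covMat G' S' c (τ z) = ∑ c, jac τ z c l • mpd c S' (τ z) -
      ((pullConn τ G' l z).transpose * S' (τ z) + S' (τ z) * pullConn τ G' l z) := by
    simp only [covMat_eq, pullConn, Matrix.transpose_sum, Finset.sum_mul, Finset.mul_sum,
      Matrix.transpose_smul, Matrix.smul_mul, Matrix.mul_smul, ← Finset.sum_add_distrib,
      ← Finset.sum_sub_distrib, smul_sub, smul_add]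
  have e3 : (conn G l z).transpose * S z =
      (jac τ z * conn G l z).transpose * S' (τ z) * jac τ z := by
    rw [hS z hz, Matrix.transpose_mul]; simp only [Matrix.mul_assoc]
  have e4 : S z * conn G l z =
      (jac τ z).transpose * S' (τ z) * (jac τ z * conn G l z) := by
    rw [hS z hz]; simp only [Matrix.mul_assoc]
  rw [covMat_eq, e2, e3, e4, e1, hτ.jac_mul_conn hG' h hz, Matrix.transpose_add,
    Matrix.transpose_mul]
  noncomm_ring

theorem divC_eq (hτ : ChangeOn τ U V) (hG' : MetricOn G' V)
    (h : ∀ z ∈ U, G z = (jac τ z).transpose * G' (τ z) * jac τ z)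
    {S S' : MatField} (hS' : SmoothMat S' V)
    (hS : ∀ z ∈ U, S z = (jac τ z).transpose * S' (τ z) * jac τ z) {z : E3} (hz : z ∈ U)
    (j : Fin 3) :
    divC G S j z = ∑ b, jac τ z b j * divC G' S' b (τ z) := by
  have key := contract_pull (G' := G' (τ z)) (hτ.isUnit_det hz)
  rw [← h z hz] at key
  have e1 : divC G S j z = ∑ i, ∑ l, (G z)⁻¹ i l * covMat G S l z i j := rfl
  have e2 : ∀ b, divC G' S' b (τ z) = ∑ i, ∑ l, (G' (τ z))⁻¹ i l * covMat G' S' l (τ z) i b :=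
    fun _ => rfl
  have e3 : ∀ b, divC G' S' b (τ z) = _ := fun b =>
    (e2 b).trans (key (Matrix.of fun i l => covMat G' S' l (τ z) i b)).symm
  rw [e1]
  simp only [e3, hτ.covMat_pull hG' h hS' hS hz, Finset.mul_sum]
  rw [Finset.sum_comm' (t' := Finset.univ) (s' := fun _ => Finset.univ) (by simp)]
  conv_rhs => rw [Finset.sum_comm]
  rw [Finset.sum_comm]
  refine Finset.sum_congr rfl fun i _ => ?_
  conv_rhs => rw [Finset.sum_comm]
  refine Finset.sum_congr rfl fun l _ => ?_
  simp only [mul_left_comm _ ((G z)⁻¹ i l), ← Finset.mul_sum]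
  congr 1
  simp only [Matrix.mul_apply, Matrix.add_apply, Matrix.smul_apply, smul_eq_mul, Matrix.of_apply,
    Matrix.transpose_apply, Fin.sum_univ_three]
  ring

/-- With J the Jacobian and Γ'ₗ the pulled-back connection, differentiate J Γₗ = ∂ₗJ + Γ'ₗ J in the
direction k and antisymmetrize in k and l. The second derivatives of J drop out; inserting the same
law for the first derivatives of J leaves exactly the two curvatures. -/
theorem curv_pull (hτ : ChangeOn τ U V) (hG' : MetricOn G' V)
    (h : ∀ z ∈ U, G z = (jac τ z).transpose * G' (τ z) * jac τ z) {z : E3} (hz : z ∈ U)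
    (k l : Fin 3) :
    jac τ z * curv G k l z =
      (∑ d, ∑ c, (jac τ z d k * jac τ z c l) • curv G' d c (τ z)) * jac τ z := by
  have hG := hτ.metricOn hG' h
  have hU := hτ.isOpen
  have sJ := hτ.smooth_jac
  have sP : ∀ l, SmoothMat (pullConn τ G' l) U := by
    intro l i j
    simp only [pullConn, Matrix.sum_apply, Matrix.smul_apply, smul_eq_mul]
    exact ContDiffOn.sum fun c _ =>
      (sJ c l).mul (hτ.smooth_comp (hG'.smooth_christoffel hτ.isOpen' i c j))
  have e1 : ∀ k l, mpd k (jac τ) z * conn G l z + jac τ z * mpd k (conn G l) z =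
      mpd k (mpd l (jac τ)) z + (mpd k (pullConn τ G' l) z * jac τ z +
        pullConn τ G' l z * mpd k (jac τ) z) := by
    intro k l
    rw [← mpd_mul hU sJ (hG.smooth_conn hU l) hz, ← mpd_mul hU (sP l) sJ hz,
      mpd_congr_on hU (fun w hw => hτ.jac_mul_conn hG' h hw l) hz]
    ext i j
    have d1 := diffAt_of_contDiffOn hU (sJ.mpd hU l i j) hz
    have d2 := diffAt_of_contDiffOn hU (((sP l).mul sJ) i j) hz
    exact pd_add d1 d2 k
  have e2 : mpd k (mpd l (jac τ)) z = mpd l (mpd k (jac τ)) z := by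
    ext i j
    exact pd_comm hU (sJ i j) hz k l
  have e3 : ∀ k l, mpd k (pullConn τ G' l) z = ∑ c, mpd k (jac τ) z c l • conn G' c (τ z) +
      ∑ d, ∑ c, (jac τ z d k * jac τ z c l) • mpd d (conn G' c) (τ z) := by
    intro k l
    ext i j
    simp only [mpd, pullConn, Matrix.sum_apply, Matrix.smul_apply, smul_eq_mul, Matrix.of_apply,
      Matrix.add_apply, conn]
    have d1 := fun c => diffAt_of_contDiffOn hU (sJ c l) hz
    have d2 := fun c => diffAt_of_contDiffOn hU
      (hτ.smooth_comp (hG'.smooth_christoffel hτ.isOpen' i c j)) hz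
    rw [pd_sum fun c _ => (d1 c).fun_mul (d2 c), Finset.sum_comm, ← Finset.sum_add_distrib]
    refine Finset.sum_congr rfl fun c _ => ?_
    rw [pd_mul (d1 c) (d2 c), hτ.pd_comp (hG'.smooth_christoffel hτ.isOpen' i c j) hz,
      Finset.mul_sum]
    congr 1
    exact Finset.sum_congr rfl fun d _ => by ring
  have e4 : ∑ d, ∑ c, (jac τ z d k * jac τ z c l) • curv G' d c (τ z) =
      (mpd k (pullConn τ G' l) z - mpd l (pullConn τ G' k) z) +
        (pullConn τ G' k z * pullConn τ G' l z - pullConn τ G' l z * pullConn τ G' k z) := by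
    rw [e3, e3]
    have s : ∑ c, mpd k (jac τ) z c l • conn G' c (τ z) =
        ∑ c, mpd l (jac τ) z c k • conn G' c (τ z) :=
      Finset.sum_congr rfl fun c _ => by rw [hτ.mpd_jac_symm hz c k l]
    rw [s, add_sub_add_left_eq_sub]
    have s2 : ∑ d, ∑ c, (jac τ z d l * jac τ z c k) • mpd d (conn G' c) (τ z) =
        ∑ d, ∑ c, (jac τ z d k * jac τ z c l) • mpd c (conn G' d) (τ z) := by
      rw [Finset.sum_comm]
      exact Finset.sum_congr rfl fun c _ => Finset.sum_congr rfl fun b _ => by rw [mul_comm]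
    have s3 : ∀ k l, pullConn τ G' k z * pullConn τ G' l z =
        ∑ d, ∑ c, (jac τ z d k * jac τ z c l) • (conn G' d (τ z) * conn G' c (τ z)) := by
      intro k l
      simp only [pullConn, Finset.sum_mul, Finset.mul_sum, Matrix.smul_mul, Matrix.mul_smul,
        smul_smul]
      rw [Finset.sum_comm]
      exact Finset.sum_congr rfl fun c _ => Finset.sum_congr rfl fun b _ => by rw [mul_comm]
    have s4 : ∑ d, ∑ c, (jac τ z d l * jac τ z c k) • (conn G' d (τ z) * conn G' c (τ z)) =
        ∑ d, ∑ c, (jac τ z d k * jac τ z c l) • (conn G' c (τ z) * conn G' d (τ z)) := by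
      rw [Finset.sum_comm]
      exact Finset.sum_congr rfl fun c _ => Finset.sum_congr rfl fun b _ => by rw [mul_comm]
    rw [s2, s3, s3, s4]
    simp only [← Finset.sum_sub_distrib, ← Finset.sum_add_distrib, ← smul_sub, ← smul_add]
    rfl
  have a1 := e1 k l
  have a2 := e1 l k
  have b1 : mpd k (jac τ) z = jac τ z * conn G k z - pullConn τ G' k z * jac τ z := by
    rw [hτ.jac_mul_conn hG' h hz]; abel
  have b2 : mpd l (jac τ) z = jac τ z * conn G l z - pullConn τ G' l z * jac τ z := by
    rw [hτ.jac_mul_conn hG' h hz]; abel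
  have c1 : jac τ z * mpd k (conn G l) z - jac τ z * mpd l (conn G k) z =
      (mpd k (pullConn τ G' l) z * jac τ z + pullConn τ G' l z * mpd k (jac τ) z) -
      (mpd l (pullConn τ G' k) z * jac τ z + pullConn τ G' k z * mpd l (jac τ) z) -
      (mpd k (jac τ) z * conn G l z - mpd l (jac τ) z * conn G k z) := by
    have a1' := eq_sub_of_add_eq' a1
    have a2' := eq_sub_of_add_eq' a2
    rw [a1', a2', e2]; abel
  rw [e4, curv, Matrix.mul_add, Matrix.mul_sub, c1, b1, b2]
  noncomm_ring

theorem ricci_pull (hτ : ChangeOn τ U V) (hG' : MetricOn G' V)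
    (h : ∀ z ∈ U, G z = (jac τ z).transpose * G' (τ z) * jac τ z) {z : E3} (hz : z ∈ U) :
    (Matrix.of fun i j => ricci G i j z) =
      (jac τ z).transpose * (Matrix.of fun i j => ricci G' i j (τ z)) * jac τ z := by
  ext i j
  have hG := hτ.metricOn hG' h
  set J := jac τ z with hJ
  have hu := hτ.isUnit_det hz
  have e1 : ∀ m, curv G m j z =
      J⁻¹ * ((∑ d, ∑ c, (J d m * J c j) • curv G' d c (τ z)) * J) := fun m => by
    rw [← hτ.curv_pull hG' h hz, ← Matrix.mul_assoc, Matrix.nonsing_inv_mul _ hu, Matrix.one_mul]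
  simp only [Matrix.of_apply, hG.ricci_eq hτ.isOpen hz, e1]
  -- Tracing the curvature pairs J with J⁻¹ in the contracted index, so only the two free indices
  -- are transformed.
  have e2 : ∀ d a, ∑ m, J d m * J⁻¹ m a = if d = a then 1 else 0 := fun d a => by
    rw [← Matrix.mul_apply, Matrix.mul_nonsing_inv _ hu, Matrix.one_apply]
  calc ∑ m, (J⁻¹ * ((∑ d, ∑ c, (J d m * J c j) • curv G' d c (τ z)) * J)) m i
      = ∑ a, ∑ d, (∑ m, J d m * J⁻¹ m a) *
          (∑ b, (∑ c, J c j * curv G' d c (τ z) a b) * J b i) := by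
        simp only [Matrix.mul_apply, Matrix.add_apply, Matrix.smul_apply, smul_eq_mul,
          Fin.sum_univ_three]
        ring
    _ = ∑ a, ∑ b, (∑ c, J c j * curv G' a c (τ z) a b) * J b i := by
        refine Finset.sum_congr rfl fun a _ => ?_
        rw [Finset.sum_eq_single a (fun d _ hd => by rw [e2, if_neg hd, zero_mul]) (by simp), e2,
          if_pos rfl, one_mul]
    _ = _ := by
        simp only [Matrix.mul_apply, Matrix.transpose_apply, Matrix.of_apply,
          hG'.ricci_eq hτ.isOpen' (hτ.mapsTo hz),
          Fin.sum_univ_three]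
        ring

theorem scalarC_eq (hτ : ChangeOn τ U V) (hG' : MetricOn G' V)
    (h : ∀ z ∈ U, G z = (jac τ z).transpose * G' (τ z) * jac τ z) {z : E3} (hz : z ∈ U) :
    scalarC G z = scalarC G' (τ z) := by
  have := contract_pull (G' := G' (τ z)) (hτ.isUnit_det hz)
    (Matrix.of fun i j => ricci G' i j (τ z))
  rw [← hτ.ricci_pull hG' h hz, ← h z hz] at this
  exact this

theorem traceC_eq (hτ : ChangeOn τ U V) {S S' : MatField} {z : E3} (hz : z ∈ U)
    (h : G z = (jac τ z).transpose * G' (τ z) * jac τ z)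
    (hS : S z = (jac τ z).transpose * S' (τ z) * jac τ z) :
    traceC G S z = traceC G' S' (τ z) := by
  unfold traceC
  rw [h, hS, contract_pull (hτ.isUnit_det hz)]

theorem normSqC_eq (hτ : ChangeOn τ U V) {S S' : MatField} {z : E3} (hz : z ∈ U)
    (h : G z = (jac τ z).transpose * G' (τ z) * jac τ z)
    (hS : S z = (jac τ z).transpose * S' (τ z) * jac τ z) :
    normSqC G S z = normSqC G' S' (τ z) := by
  rw [normSqC_eq_trace, normSqC_eq_trace, hS,
    ← mul_inv_mul_transpose (J := jac τ z) (G' := G' (τ z)) (hτ.isUnit_det hz), ← h]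
  simp only [Matrix.transpose_mul, Matrix.transpose_transpose, Matrix.mul_assoc]
  rw [Matrix.trace_mul_comm (jac τ z)]
  simp only [Matrix.mul_assoc]

end ChangeOn

end JangEH

namespace JangEH

/-! ### The deformed metric in a chart -/

/-- The components of `g + φ² df²`. -/
noncomputable def gbarC (G : MatField) (F Φ : E3 → ℝ) : MatField := fun y =>
  Matrix.of fun i j => G y i j + Φ y ^ 2 * (pd i F y * pd j F y)

/-- The squared norm of the differential. -/
noncomputable def dnC (G : MatField) (F : E3 → ℝ) (y : E3) : ℝ :=
  ∑ i, (∑ j, (G y)⁻¹ i j * pd j F y) * pd i F y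

/-- `(1 + φ² |df|²)^{1/2}`. -/
noncomputable def lapC (G : MatField) (F Φ : E3 → ℝ) (y : E3) : ℝ :=
  Real.sqrt (1 + Φ y ^ 2 * dnC G F y)

/-- The components of `h`. -/
noncomputable def hC (G : MatField) (F Φ : E3 → ℝ) : MatField := fun y =>
  Matrix.of fun i j =>
    (Φ y * hessC G F i j y + (pd i F y * pd j Φ y + pd i Φ y * pd j F y)) / lapC G F Φ y

/-- The components of `v`. -/
noncomputable def vC (G : MatField) (F Φ : E3 → ℝ) (y : E3) (i : Fin 3) : ℝ :=
  Φ y / lapC G F Φ y * ∑ j, (G y)⁻¹ i j * pd j F y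

/-- The components of `φ (h - k)(v, ·)`. -/
noncomputable def fluxC (G K : MatField) (F Φ : E3 → ℝ) (y : E3) (j : Fin 3) : ℝ :=
  Φ y * ∑ i, vC G F Φ y i * (hC G F Φ y - K y) i j

/-- The components of the gradient of `log φ` with respect to the deformed metric. -/
noncomputable def logGradC (G : MatField) (F Φ : E3 → ℝ) (y : E3) (m : Fin 3) : ℝ :=
  ∑ l, ((G y)⁻¹ m l - vC G F Φ y m * vC G F Φ y l) * (pd l Φ y / Φ y)

section

variable {G : MatField} {F Φ : E3 → ℝ} {U : Set E3}

theorem MetricOn.dnC_nonneg (hG : MetricOn G U) {y : E3} (hy : y ∈ U) : 0 ≤ dnC G F y := by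
  have := (hG.posDef y hy).inv.posSemidef.dotProduct_mulVec_nonneg fun i => pd i F y
  simpa [dnC, dotProduct, Matrix.mulVec, mul_comm] using this

theorem MetricOn.lapC_pos (hG : MetricOn G U) {y : E3} (hy : y ∈ U) : 0 < lapC G F Φ y :=
  Real.sqrt_pos.2 (by have := hG.dnC_nonneg (F := F) hy; positivity)

theorem MetricOn.lapC_sq (hG : MetricOn G U) {y : E3} (hy : y ∈ U) :
    lapC G F Φ y ^ 2 = 1 + Φ y ^ 2 * dnC G F y :=
  Real.sq_sqrt (by have := hG.dnC_nonneg (F := F) hy; positivity)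

theorem MetricOn.smooth_dnC (hG : MetricOn G U) (hU : IsOpen U) (hF : ContDiffOn ℝ ∞ F U) :
    ContDiffOn ℝ ∞ (dnC G F) U :=
  ContDiffOn.sum fun i _ => (ContDiffOn.sum fun j _ =>
    (hG.smooth_inv i j).mul (contDiffOn_pd hU hF j)).mul (contDiffOn_pd hU hF i)

theorem MetricOn.smooth_lapC (hG : MetricOn G U) (hU : IsOpen U) (hF : ContDiffOn ℝ ∞ F U)
    (hΦ : ContDiffOn ℝ ∞ Φ U) : ContDiffOn ℝ ∞ (lapC G F Φ) U := by
  refine ContDiffOn.sqrt (contDiffOn_const.add ((hΦ.pow 2).mul (hG.smooth_dnC hU hF)))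
    fun y hy => ?_
  have := hG.dnC_nonneg (F := F) hy
  positivity

theorem MetricOn.smooth_hessC (hG : MetricOn G U) (hU : IsOpen U) (hF : ContDiffOn ℝ ∞ F U)
    (i j : Fin 3) : ContDiffOn ℝ ∞ (hessC G F i j) U :=
  (contDiffOn_pd hU (contDiffOn_pd hU hF j) i).sub (ContDiffOn.sum fun m _ =>
    (hG.smooth_christoffel hU m i j).mul (contDiffOn_pd hU hF m))

theorem MetricOn.smooth_hC (hG : MetricOn G U) (hU : IsOpen U) (hF : ContDiffOn ℝ ∞ F U)
    (hΦ : ContDiffOn ℝ ∞ Φ U) : SmoothMat (hC G F Φ) U := fun i j =>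
  ((hΦ.mul (hG.smooth_hessC hU hF i j)).add (((contDiffOn_pd hU hF i).mul
    (contDiffOn_pd hU hΦ j)).add ((contDiffOn_pd hU hΦ i).mul (contDiffOn_pd hU hF j)))).div
    (hG.smooth_lapC hU hF hΦ) fun _ hy => (hG.lapC_pos hy).ne'

theorem MetricOn.smooth_vC (hG : MetricOn G U) (hU : IsOpen U) (hF : ContDiffOn ℝ ∞ F U)
    (hΦ : ContDiffOn ℝ ∞ Φ U) (i : Fin 3) : ContDiffOn ℝ ∞ (fun y => vC G F Φ y i) U :=
  (hΦ.div (hG.smooth_lapC hU hF hΦ) fun _ hy => (hG.lapC_pos hy).ne').mul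
    (ContDiffOn.sum fun j _ => (hG.smooth_inv i j).mul (contDiffOn_pd hU hF j))

theorem MetricOn.smooth_fluxC (hG : MetricOn G U) (hU : IsOpen U) (hF : ContDiffOn ℝ ∞ F U)
    (hΦ : ContDiffOn ℝ ∞ Φ U) {K : MatField} (hK : SmoothMat K U) (j : Fin 3) :
    ContDiffOn ℝ ∞ (fun y => fluxC G K F Φ y j) U :=
  hΦ.mul (ContDiffOn.sum fun i _ => (hG.smooth_vC hU hF hΦ i).mul
    ((hG.smooth_hC hU hF hΦ i j).sub (hK i j)))

theorem MetricOn.gbarC_metricOn (hG : MetricOn G U) (hU : IsOpen U) (hF : ContDiffOn ℝ ∞ F U)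
    (hΦ : ContDiffOn ℝ ∞ Φ U) : MetricOn (gbarC G F Φ) U := by
  refine ⟨fun i j => (hG.smooth i j).add ((hΦ.pow 2).mul ((contDiffOn_pd hU hF i).mul
    (contDiffOn_pd hU hF j))), fun y hy => ?_⟩
  have e : gbarC G F Φ y = G y +
      Matrix.vecMulVec (fun i => Φ y * pd i F y) (star fun i => Φ y * pd i F y) := by
    ext i j
    simp [gbarC, Matrix.vecMulVec_apply]; ring
  rw [e]
  exact (hG.posDef y hy).add_posSemidef (Matrix.posSemidef_vecMulVec_self_star _)

/-- `v` lowered with the deformed metric. -/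
theorem MetricOn.sum_vC_mul_gbarC (hG : MetricOn G U) {y : E3} (hy : y ∈ U) (j : Fin 3) :
    ∑ m, vC G F Φ y m * gbarC G F Φ y m j = lapC G F Φ y * (Φ y * pd j F y) := by
  have hu := hG.lapC_pos (F := F) (Φ := Φ) hy
  have hu2 := hG.lapC_sq (F := F) (Φ := Φ) hy
  have h1 : ∑ m, (∑ l, (G y)⁻¹ m l * pd l F y) * G y m j = pd j F y := by
    have : ∀ w : Fin 3 → ℝ, (G y).mulVec ((G y)⁻¹.mulVec w) = w := fun w => by
      rw [Matrix.mulVec_mulVec, hG.mul_inv hy, Matrix.one_mulVec]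
    have h := congrFun (this fun l => pd l F y) j
    simp only [Matrix.mulVec, dotProduct] at h
    rw [← h]
    exact Finset.sum_congr rfl fun m _ => by rw [hG.symm hy m j]; ring
  have h2 : ∑ m, vC G F Φ y m * gbarC G F Φ y m j =
      Φ y / lapC G F Φ y * (∑ m, (∑ l, (G y)⁻¹ m l * pd l F y) * G y m j +
        Φ y ^ 2 * dnC G F y * pd j F y) := by
    simp only [vC, gbarC, dnC, Matrix.of_apply, Fin.sum_univ_three]
    ring
  rw [h2, h1]
  have h3 : pd j F y + Φ y ^ 2 * dnC G F y * pd j F y = lapC G F Φ y ^ 2 * pd j F y := by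
    rw [hu2]; ring
  rw [h3]
  field_simp

/-- The Sherman–Morrison formula: ḡ is the rank-one perturbation of g by the square of φ df, and
normalizing φ ∇f by the lapse is what makes the correction exactly v ⊗ v. -/
theorem MetricOn.gbarC_inv (hG : MetricOn G U) {y : E3} (hy : y ∈ U) :
    (gbarC G F Φ y)⁻¹ = Matrix.of fun i j => (G y)⁻¹ i j - vC G F Φ y i * vC G F Φ y j := by
  refine Matrix.inv_eq_left_inv ?_
  ext i j
  have hu := hG.lapC_pos (F := F) (Φ := Φ) hy
  have h1 := congrFun (congrFun (hG.inv_mul hy) i) j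
  rw [Matrix.mul_apply] at h1
  have h2 := hG.sum_vC_mul_gbarC (F := F) (Φ := Φ) hy j
  rw [Matrix.mul_apply, ← h1]
  simp only [Matrix.of_apply, sub_mul, Finset.sum_sub_distrib, mul_assoc]
  rw [← Finset.mul_sum, h2, vC]
  simp only [gbarC, Matrix.of_apply, mul_add, Finset.sum_add_distrib]
  have h3 : ∑ x, (G y)⁻¹ i x * (Φ y ^ 2 * (pd x F y * pd j F y)) =
      Φ y * (∑ x, (G y)⁻¹ i x * pd x F y) * (Φ y * pd j F y) := by
    simp only [Fin.sum_univ_three]; ring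
  rw [h3]
  field_simp
  ring

theorem MetricOn.sum_logGradC_mul_gbarC (hG : MetricOn G U) {y : E3} (hU : IsOpen U)
    (hF : ContDiffOn ℝ ∞ F U) (hΦ : ContDiffOn ℝ ∞ Φ U) (hy : y ∈ U) (j : Fin 3) :
    ∑ m, logGradC G F Φ y m * gbarC G F Φ y m j = pd j Φ y / Φ y := by
  have hb := hG.gbarC_metricOn hU hF hΦ
  have : ∀ w : Fin 3 → ℝ, (gbarC G F Φ y).mulVec ((gbarC G F Φ y)⁻¹.mulVec w) = w := fun w => by
    rw [Matrix.mulVec_mulVec, hb.mul_inv hy, Matrix.one_mulVec]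
  have h := congrFun (this fun l => pd l Φ y / Φ y) j
  simp only [Matrix.mulVec, dotProduct, hG.gbarC_inv hy] at h
  rw [← h]
  exact Finset.sum_congr rfl fun m _ => by rw [hb.symm hy m j, mul_comm]; rfl

/-- The Christoffel symbols of the deformed metric. -/
theorem MetricOn.christoffel_gbarC (hG : MetricOn G U) (hU : IsOpen U) (hF : ContDiffOn ℝ ∞ F U)
    (hΦ : ContDiffOn ℝ ∞ Φ U) {y : E3} (hy : y ∈ U) (hpos : 0 < Φ y) (m i j : Fin 3) :
    christoffel (gbarC G F Φ) m i j y = christoffel G m i j y +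
      hC G F Φ y i j * vC G F Φ y m -
        logGradC G F Φ y m * (Φ y ^ 2 * (pd i F y * pd j F y)) := by
  have hb := hG.gbarC_metricOn hU hF hΦ
  have hu := hG.lapC_pos (F := F) (Φ := Φ) hy
  have hF2 := pd_comm hU hF hy
  have hh : ∀ i j, hC G F Φ y i j = hC G F Φ y j i := fun i j => by
    simp only [hC, hessC, Matrix.of_apply, hF2 i j, hG.christoffel_symm hU hy _ i j]
    ring
  -- The claimed symbols are verified to be torsion-free and compatible with ḡ, and are then the
  -- Christoffel symbols of ḡ by uniqueness; the defining formula is never expanded.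
  let A : Fin 3 → Matrix (Fin 3) (Fin 3) ℝ := fun l => Matrix.of fun m j =>
    christoffel G m l j y + hC G F Φ y l j * vC G F Φ y m -
        logGradC G F Φ y m * (Φ y ^ 2 * (pd l F y * pd j F y))
  have hA : ∀ l, mpd l (gbarC G F Φ) y =
      (A l).transpose * gbarC G F Φ y + gbarC G F Φ y * A l := by
    intro l
    ext i j
    have h0 := congrFun (congrFun (hG.mpd_eq hU hy l) i) j
    simp only [mpd, conn, Matrix.of_apply, Matrix.add_apply, Matrix.mul_apply,
      Matrix.transpose_apply] at h0
    have dF := fun a => diffAt_of_contDiffOn hU (contDiffOn_pd hU hF a) hy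
    have dΦ := diffAt_of_contDiffOn hU hΦ hy
    have h1 : pd l (fun z => gbarC G F Φ z i j) y = pd l (fun z => G z i j) y +
        (2 * Φ y * pd l Φ y * (pd i F y * pd j F y) +
          Φ y ^ 2 * (pd l (pd i F) y * pd j F y + pd i F y * pd l (pd j F) y)) := by
      have d1 := diffAt_of_contDiffOn hU (hG.smooth i j) hy
      have d2 : DifferentiableAt ℝ (fun z => Φ z ^ 2) y := dΦ.pow 2
      simp only [gbarC, Matrix.of_apply]
      rw [pd_add d1 (d2.fun_mul ((dF i).fun_mul (dF j))), pd_mul d2 ((dF i).fun_mul (dF j)),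
        pd_mul (dF i) (dF j), pd_pow_two dΦ]
    -- Lowering an index with ḡ turns v into the lapse times φ df, which cancels the denominator of
    -- h, and turns the gradient of log φ into dφ / φ.
    have h2 : ∀ a b, ∑ m, A l m a * gbarC G F Φ y m b =
        ∑ m, christoffel G m l a y * G y m b +
          (∑ m, christoffel G m l a y * pd m F y) * (Φ y ^ 2 * pd b F y) +
        (Φ y * hessC G F l a y + (pd l F y * pd a Φ y + pd l Φ y * pd a F y)) *
          (Φ y * pd b F y) - pd b Φ y / Φ y * (Φ y ^ 2 * (pd l F y * pd a F y)) := by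
      intro a b
      have e1 := hG.sum_vC_mul_gbarC (F := F) (Φ := Φ) hy b
      have e2 := hG.sum_logGradC_mul_gbarC hU hF hΦ hy b
      rw [← e2]
      have e3 : (Φ y * hessC G F l a y + (pd l F y * pd a Φ y + pd l Φ y * pd a F y)) *
          (Φ y * pd b F y) = hC G F Φ y l a * ∑ m, vC G F Φ y m * gbarC G F Φ y m b := by
        rw [e1]; simp only [hC, Matrix.of_apply]; field_simp
      rw [e3]
      have e4 : ∑ m, christoffel G m l a y * G y m b +
          (∑ m, christoffel G m l a y * pd m F y) * (Φ y ^ 2 * pd b F y) =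
          ∑ m, christoffel G m l a y * gbarC G F Φ y m b := by
        simp only [gbarC, Matrix.of_apply, Fin.sum_univ_three]; ring
      rw [e4]
      simp only [A, Matrix.of_apply, Fin.sum_univ_three]
      ring
    have h3 : ∑ m, gbarC G F Φ y i m * A l m j = ∑ m, A l m j * gbarC G F Φ y m i :=
      Finset.sum_congr rfl fun m _ => by rw [hb.symm hy i m, mul_comm]
    have h4 : ∑ m, G y i m * christoffel G m l j y = ∑ m, christoffel G m l j y * G y m i :=
      Finset.sum_congr rfl fun m _ => by rw [hG.symm hy i m, mul_comm]
    simp only [mpd, Matrix.of_apply, Matrix.add_apply, Matrix.mul_apply, Matrix.transpose_apply]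
    rw [h3, h2, h2, h1, h0, h4, hessC, hessC]
    field_simp
    ring
  have := congrFun (congrFun (hb.conn_unique hy A (fun m i j => ?_) hA i) m) j
  · exact this.symm
  · simp only [A, Matrix.of_apply, hG.christoffel_symm hU hy m i j, hh i j]
    ring

end

/-! ### Changes of coordinates -/

namespace ChangeOn

variable {τ : E3 → E3} {U V : Set E3} {G G' K K' : MatField} {F Φ : E3 → ℝ}

theorem dnC_eq (hτ : ChangeOn τ U V) (hF : ContDiffOn ℝ ∞ F V) {z : E3} (hz : z ∈ U)
    (h : G z = (jac τ z).transpose * G' (τ z) * jac τ z) :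
    dnC G (fun w => F (τ w)) z = dnC G' F (τ z) := by
  have := contract_pull (G' := G' (τ z)) (hτ.isUnit_det hz)
    (Matrix.of fun a b => pd a F (τ z) * pd b F (τ z))
  rw [← h] at this
  simp only [dnC, hτ.pd_comp hF hz]
  simp only [Matrix.mul_apply, Matrix.transpose_apply, Matrix.of_apply, Fin.sum_univ_three] at this ⊢
  linear_combination this

theorem lapC_eq (hτ : ChangeOn τ U V) (hF : ContDiffOn ℝ ∞ F V) {z : E3} (hz : z ∈ U)
    (h : G z = (jac τ z).transpose * G' (τ z) * jac τ z) :
    lapC G (fun w => F (τ w)) (fun w => Φ (τ w)) z = lapC G' F Φ (τ z) := by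
  rw [lapC, lapC, hτ.dnC_eq hF hz h]

theorem gbarC_eq (hτ : ChangeOn τ U V) (hF : ContDiffOn ℝ ∞ F V) {z : E3} (hz : z ∈ U)
    (h : G z = (jac τ z).transpose * G' (τ z) * jac τ z) :
    gbarC G (fun w => F (τ w)) (fun w => Φ (τ w)) z =
      (jac τ z).transpose * gbarC G' F Φ (τ z) * jac τ z := by
  ext i j
  simp only [gbarC, h, hτ.pd_comp hF hz]
  simp only [Matrix.mul_apply, Matrix.transpose_apply, Matrix.of_apply, Fin.sum_univ_three]
  ring

theorem hC_eq (hτ : ChangeOn τ U V) (hG' : MetricOn G' V) (hF : ContDiffOn ℝ ∞ F V)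
    (hΦ : ContDiffOn ℝ ∞ Φ V)
    (h : ∀ z ∈ U, G z = (jac τ z).transpose * G' (τ z) * jac τ z) {z : E3} (hz : z ∈ U) :
    hC G (fun w => F (τ w)) (fun w => Φ (τ w)) z =
      (jac τ z).transpose * hC G' F Φ (τ z) * jac τ z := by
  ext i j
  have := congrFun (congrFun (hτ.hessC_eq hG' h hF hz) i) j
  simp only [hC, Matrix.of_apply] at this ⊢
  rw [this, hτ.lapC_eq hF hz (h z hz)]
  simp only [hτ.pd_comp hF hz, hτ.pd_comp hΦ hz]
  simp only [Matrix.mul_apply, Matrix.transpose_apply, Matrix.of_apply, Fin.sum_univ_three]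
  ring

/-- Being a vector field, v is pushed forward by the Jacobian, whereas covectors and 2-tensors are
pulled back; the two directions cancel in pairings. -/
theorem vC_eq (hτ : ChangeOn τ U V) (hF : ContDiffOn ℝ ∞ F V) {z : E3} (hz : z ∈ U)
    (h : G z = (jac τ z).transpose * G' (τ z) * jac τ z) (a : Fin 3) :
    vC G' F Φ (τ z) a = ∑ m, jac τ z a m * vC G (fun w => F (τ w)) (fun w => Φ (τ w)) z m := by
  have e := mul_inv_mul_transpose (G' := G' (τ z)) (hτ.isUnit_det hz)
  rw [← h] at e
  simp only [vC, hτ.lapC_eq hF hz h, ← e, hτ.pd_comp hF hz]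
  simp only [Matrix.mul_apply, Matrix.transpose_apply, Fin.sum_univ_three]
  ring

theorem fluxC_eq (hτ : ChangeOn τ U V) (hG' : MetricOn G' V) (hF : ContDiffOn ℝ ∞ F V)
    (hΦ : ContDiffOn ℝ ∞ Φ V)
    (h : ∀ z ∈ U, G z = (jac τ z).transpose * G' (τ z) * jac τ z) {z : E3} (hz : z ∈ U)
    (hK : K z = (jac τ z).transpose * K' (τ z) * jac τ z) (j : Fin 3) :
    fluxC G K (fun w => F (τ w)) (fun w => Φ (τ w)) z j =
      ∑ a, jac τ z a j * fluxC G' K' F Φ (τ z) a := by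
  simp only [fluxC, hτ.hC_eq hG' hF hΦ h hz, hK, hτ.vC_eq hF hz (h z hz)]
  rw [← Matrix.sub_mul, ← Matrix.mul_sub]
  simp only [Matrix.mul_apply, Matrix.transpose_apply, Fin.sum_univ_three]
  ring

end ChangeOn

end JangEH

namespace JangEH

/-! ### The generalized Schoen–Yau identity -/

/-- The Gauss equation at a point, reduced to an identity between real numbers. The coordinates are
normal for g, and df points along axis 0. Then `v` is the only component of the vector field v, `u2`
the squared lapse, `b` is d log φ, `B` its derivative, `T` the third derivatives of f times φ over
the lapse, and `D` the derivatives of the Christoffel symbols of g. The remaining data are the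
derivatives of v, of the ḡ-gradient of log φ, of φ² df ⊗ df, of h and of the Christoffel symbols of
ḡ. The equality `hR` says that the curvature of g in the planes of axes 0 and i is symmetric, and it
enters only with the weight v². -/
theorem gauss_algebra (v u2 : ℝ) (hu : u2 * (1 - v ^ 2) = 1)
    (b : Fin 3 → ℝ) (B h : Fin 3 → Fin 3 → ℝ) (T : Fin 3 → Fin 3 → Fin 3 → ℝ)
    (D : Fin 3 → Fin 3 → Fin 3 → Fin 3 → ℝ) (hh : ∀ i j, h i j = h j i)
    (hT : ∀ i j k, T i j k = T j i k) (hT' : ∀ i j k, T i j k = T i k j)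
    (hR : ∀ i, D i i 0 0 - D 0 i 0 i = D 0 0 i i - D i 0 i 0)
    (dv dbe : Fin 3 → Fin 3 → ℝ) (dh dE : Fin 3 → Fin 3 → Fin 3 → ℝ)
    (V : Fin 3 → ℝ) (hV : V = ![v, 0, 0])
    (hdv : ∀ l m, dv l m = h l m - V m * (v * h l 0) - V l * b m + V l * V m * (v * b 0))
    (hdbe : ∀ l m, dbe l m = B l m - dv l m * (v * b 0) -
      V m * ((dv l 0 * b 0 + dv l 1 * b 1 + dv l 2 * b 2) + v * B l 0))
    (hdE : ∀ l i j, dE l i j = u2 * ((h l i - b i * V l) * V j + V i * (h l j - b j * V l)))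
    (hdh : ∀ l i j, dh l i j = b l * (h i j - V i * b j - b i * V j) + T l i j - v * D l 0 i j +
      (h i l - V i * b l - b i * V l) * b j + V i * (B j l + b j * b l) +
      (B i l + b i * b l) * V j + b i * (h j l - V j * b l - b j * V l) -
      h i j * (v * h l 0 - v * b 0 * V l))
    (Γ : Fin 3 → Fin 3 → Fin 3 → ℝ)
    (hΓ : ∀ m i j, Γ m i j = h i j * V m - (b m - V m * (v * b 0)) * (u2 * V i * V j))
    (dΓ : Fin 3 → Fin 3 → Fin 3 → Fin 3 → ℝ)
    (hdΓ : ∀ l m i j, dΓ l m i j = D l m i j + dh l i j * V m + h i j * dv l m -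
      dbe l m * (u2 * V i * V j) - (b m - V m * (v * b 0)) * dE l i j)
    (ric ric0 : Fin 3 → Fin 3 → ℝ)
    (hric : ∀ i j, ric i j = ∑ m, (dΓ m m i j - dΓ j m i m) +
      ∑ m, ∑ l, (Γ m m l * Γ l i j - Γ m j l * Γ l i m))
    (hric0 : ∀ i j, ric0 i j = ∑ m, (D m m i j - D j m i m)) :
    (1 - v ^ 2) * ric 0 0 + ric 1 1 + ric 2 2 = ric0 0 0 + ric0 1 1 + ric0 2 2 +
      (h 0 0 + h 1 1 + h 2 2) ^ 2 - ∑ i, ∑ j, h i j ^ 2 - 2 * v * ∑ l, (dh l l 0 - dh 0 l l) := by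
  have hu' : 1 - v ^ 2 ≠ 0 := fun h => by simp [h] at hu
  have V0 : V 0 = v := by simp [hV]
  have V1 : V 1 = 0 := by simp [hV]
  have V2 : V 2 = 0 := by simp [hV]
  have hu2 : u2 = 1 / (1 - v ^ 2) := by field_simp; linarith
  simp only [hric, hric0, Fin.sum_univ_three, hΓ, hdΓ, hdE, V0, V1, V2, mul_zero, zero_mul,
    add_zero, sub_zero, zero_sub, zero_add]
  simp only [hdh, hdbe, hdv, V0, V1, V2, mul_zero, zero_mul, add_zero, sub_zero]
  rw [hh 1 0, hh 2 0, hh 2 1, hT' 1 1 0, hT 1 0 1, hT' 2 2 0, hT 2 0 2, hu2]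
  field_simp
  linear_combination (-v ^ 2) * hR 1 - v ^ 2 * hR 2

/-- Exchanges h for k in the combination of constraint expressions produced by the Gauss equation.
The price is the squared norm of h - k, twice that of q, and a divergence: the last bracket is the
covariant derivative of φ q divided by φ. The Jang equation enters as `htr` and its derivative as
`hdtr`; the derivative along axis 0 is enough because v points along that axis. -/
theorem codazzi_algebra (v u2 : ℝ) (hu : u2 * (1 - v ^ 2) = 1)
    (b : Fin 3 → ℝ) (h k : Fin 3 → Fin 3 → ℝ) (hh : ∀ i j, h i j = h j i)
    (hk : ∀ i j, k i j = k j i)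
    (dv : Fin 3 → Fin 3 → ℝ) (dh dk : Fin 3 → Fin 3 → Fin 3 → ℝ)
    (hdh : ∀ l i j, dh l i j = dh l j i) (hdk : ∀ l i j, dk l i j = dk l j i)
    (V : Fin 3 → ℝ) (hV : V = ![v, 0, 0])
    (hdv : ∀ l m, dv l m = h l m - V m * (v * h l 0) - V l * b m + V l * V m * (v * b 0))
    (Γ : Fin 3 → Fin 3 → Fin 3 → ℝ)
    (hΓ : ∀ m i j, Γ m i j = h i j * V m - (b m - V m * (v * b 0)) * (u2 * V i * V j))
    (gi : Fin 3 → Fin 3 → ℝ) (hgi : gi = ![![1 - v ^ 2, 0, 0], ![0, 1, 0], ![0, 0, 1]])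
    (htr : ∑ i, ∑ j, gi i j * (h i j - k i j) = 0)
    (hdtr : ∑ i, ∑ j, (-(dv 0 i * V j + V i * dv 0 j) * (h i j - k i j) +
      gi i j * (dh 0 i j - dk 0 i j)) = 0)
    (q : Fin 3 → ℝ) (hq : ∀ j, q j = ∑ i, V i * (h i j - k i j))
    (dq : Fin 3 → Fin 3 → ℝ)
    (hdq : ∀ l j, dq l j = ∑ i, (dv l i * (h i j - k i j) + V i * (dh l i j - dk l i j))) :
    (∑ i, h i i) ^ 2 - ∑ i, ∑ j, h i j ^ 2 - 2 * v * ∑ l, (dh l l 0 - dh 0 l l) =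
      (∑ i, k i i) ^ 2 - ∑ i, ∑ j, k i j ^ 2 - 2 * v * ∑ l, (dk l l 0 - dk 0 l l) +
      ∑ i, ∑ j, ∑ a, ∑ c, gi i a * gi j c * (h i j - k i j) * (h a c - k a c) +
      2 * ∑ i, ∑ j, gi i j * (q i * q j) -
      2 * ∑ i, ∑ j, gi i j * (b i * q j + dq i j - ∑ m, Γ m i j * q m) := by
  have hu' : 1 - v ^ 2 ≠ 0 := fun h => by simp [h] at hu
  have V0 : V 0 = v := by simp [hV]
  have V1 : V 1 = 0 := by simp [hV]
  have V2 : V 2 = 0 := by simp [hV]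
  have g00 : gi 0 0 = 1 - v ^ 2 := by simp [hgi]
  have g11 : gi 1 1 = 1 := by simp [hgi]
  have g22 : gi 2 2 = 1 := by simp [hgi]
  have g01 : gi 0 1 = 0 := by simp [hgi]
  have g02 : gi 0 2 = 0 := by simp [hgi]
  have g10 : gi 1 0 = 0 := by simp [hgi]
  have g12 : gi 1 2 = 0 := by simp [hgi]
  have g20 : gi 2 0 = 0 := by simp [hgi]
  have g21 : gi 2 1 = 0 := by simp [hgi]
  have hu2 : u2 = 1 / (1 - v ^ 2) := by field_simp; linarith
  simp only [Fin.sum_univ_three, hΓ, hdq, hq, V0, V1, V2, g00, g11, g22, g01, g02, g10, g12, g20,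
    g21, mul_zero, zero_mul, add_zero, sub_zero, zero_sub, zero_add, one_mul, mul_one,
    hdv] at htr hdtr ⊢
  rw [hh 1 0, hh 2 0, hh 2 1, hk 1 0, hk 2 0, hk 2 1] at *
  rw [hdh 1 1 0, hdh 2 2 0, hdk 1 1 0, hdk 2 2 0, hu2] at *
  field_simp
  linear_combination ((1 - v ^ 2) * h 0 0 + (1 + v ^ 2) * k 0 0 + h 1 1 + k 1 1 + h 2 2 + k 2 2) * htr +
    2 * v * hdtr

end JangEH

/-! ### First derivatives of the deformation data in adapted normal coordinates. -/

namespace JangEH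

/-- Data of the deformation near a point at which the coordinates are normal and adapted to `df`. -/
structure NormalAt (G : MatField) (F Φ : E3 → ℝ) (U : Set E3) (y : E3) : Prop where
  metric : MetricOn G U
  isOpen : IsOpen U
  smooth_f : ContDiffOn ℝ ∞ F U
  smooth_φ : ContDiffOn ℝ ∞ Φ U
  pos : ∀ z ∈ U, 0 < Φ z
  mem : y ∈ U
  eq_one : G y = 1
  pd_metric : ∀ l i j, pd l (fun z => G z i j) y = 0
  pd_f : ∀ i, i ≠ 0 → pd i F y = 0

namespace NormalAt

variable {G : MatField} {F Φ : E3 → ℝ} {U : Set E3} {y : E3}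

theorem inv_eq_one (n : NormalAt G F Φ U y) : (G y)⁻¹ = 1 := by rw [n.eq_one, inv_one]

theorem pd_inv (n : NormalAt G F Φ U y) (l i j : Fin 3) : pd l (fun z => (G z)⁻¹ i j) y = 0 := by
  have h1 := mpd_mul n.isOpen n.metric.smooth n.metric.smooth_inv n.mem l
  have h2 : mpd l (fun z => G z * (G z)⁻¹) y = 0 := by
    rw [mpd_congr_on n.isOpen (B := fun _ => 1) (fun z hz => n.metric.mul_inv hz) n.mem]
    ext a b
    exact pd_const _ _ _
  have h3 : mpd l G y = 0 := by ext a b; exact n.pd_metric l a b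
  rw [h2, h3, n.eq_one, Matrix.zero_mul, zero_add, Matrix.one_mul] at h1
  exact (congrFun (congrFun h1 i) j).symm

theorem christoffel_eq_zero (n : NormalAt G F Φ U y) (m i j : Fin 3) :
    christoffel G m i j y = 0 := by
  simp [christoffel, n.pd_metric]

/-- Since G = 1 and its first derivatives vanish, so do those of the inverse, and only second
derivatives of the metric survive. -/
theorem pd_christoffel (n : NormalAt G F Φ U y) (l m i j : Fin 3) :
    pd l (christoffel G m i j) y = (1 / 2) * (pd l (pd i (fun z => G z j m)) y +
      pd l (pd j (fun z => G z i m)) y - pd l (pd m (fun z => G z i j)) y) := by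
  have dI := fun i j => diffAt_of_contDiffOn n.isOpen (n.metric.smooth_inv i j) n.mem
  have d2 := fun a i j =>
    diffAt_of_contDiffOn n.isOpen (contDiffOn_pd n.isOpen (n.metric.smooth i j) a) n.mem
  unfold christoffel
  rw [pd_mul (differentiableAt_const _) (DifferentiableAt.fun_sum fun a _ =>
      (dI m a).fun_mul (((d2 _ _ _).fun_add (d2 _ _ _)).fun_sub (d2 _ _ _))), pd_const,
    pd_sum fun a _ => (dI m a).fun_mul (((d2 _ _ _).fun_add (d2 _ _ _)).fun_sub (d2 _ _ _))]
  simp only [pd_mul (dI m _) (((d2 _ _ _).fun_add (d2 _ _ _)).fun_sub (d2 _ _ _)), n.pd_inv,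
    n.inv_eq_one, pd_sub ((d2 _ _ _).fun_add (d2 _ _ _)) (d2 _ _ _), pd_add (d2 _ _ _) (d2 _ _ _),
    zero_mul, zero_add, Matrix.one_apply, ite_mul, one_mul, Finset.sum_ite_eq, Finset.mem_univ,
    if_true]

theorem dnC_eq (n : NormalAt G F Φ U y) : dnC G F y = pd 0 F y ^ 2 := by
  simp [dnC, n.inv_eq_one, Matrix.one_apply, Fin.sum_univ_three, n.pd_f 1, n.pd_f 2]
  ring

theorem vC_eq (n : NormalAt G F Φ U y) (i : Fin 3) :
    vC G F Φ y i = Φ y / lapC G F Φ y * pd i F y := by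
  simp [vC, n.inv_eq_one, Matrix.one_apply]

theorem vC_eq_vec (n : NormalAt G F Φ U y) : vC G F Φ y = ![vC G F Φ y 0, 0, 0] := by
  ext i
  fin_cases i <;> simp [n.vC_eq, n.pd_f 1, n.pd_f 2]

theorem lapC_sq (n : NormalAt G F Φ U y) :
    lapC G F Φ y ^ 2 = 1 + Φ y ^ 2 * pd 0 F y ^ 2 := by
  rw [n.metric.lapC_sq n.mem, n.dnC_eq]

theorem lapC_pos (n : NormalAt G F Φ U y) : 0 < lapC G F Φ y := n.metric.lapC_pos n.mem

/-- The relation between the lapse and |v| which allows the lapse to be eliminated in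
`gauss_algebra` and `codazzi_algebra`. -/
theorem lapC_sq_mul (n : NormalAt G F Φ U y) :
    lapC G F Φ y ^ 2 * (1 - vC G F Φ y 0 ^ 2) = 1 := by
  have := n.lapC_pos
  rw [n.vC_eq]
  field_simp
  linarith [n.lapC_sq]

/-- Solves the definition of h for the second derivatives of f, which are thereby eliminated in
favour of h. -/
theorem pd_pd_f (n : NormalAt G F Φ U y) (i j : Fin 3) :
    pd i (pd j F) y = (lapC G F Φ y * hC G F Φ y i j -
      (pd i F y * pd j Φ y + pd i Φ y * pd j F y)) / Φ y := by
  have h1 := n.lapC_pos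
  have h2 := n.pos y n.mem
  simp only [hC, Matrix.of_apply, hessC, n.christoffel_eq_zero, zero_mul, Finset.sum_const_zero,
    sub_zero]
  field_simp
  ring

theorem diffAt_f (n : NormalAt G F Φ U y) (i : Fin 3) : DifferentiableAt ℝ (pd i F) y :=
  diffAt_of_contDiffOn n.isOpen (contDiffOn_pd n.isOpen n.smooth_f i) n.mem

theorem diffAt_φ (n : NormalAt G F Φ U y) : DifferentiableAt ℝ Φ y :=
  diffAt_of_contDiffOn n.isOpen n.smooth_φ n.mem

theorem diffAt_pd_φ (n : NormalAt G F Φ U y) (i : Fin 3) : DifferentiableAt ℝ (pd i Φ) y :=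
  diffAt_of_contDiffOn n.isOpen (contDiffOn_pd n.isOpen n.smooth_φ i) n.mem

theorem diffAt_inv (n : NormalAt G F Φ U y) (i j : Fin 3) :
    DifferentiableAt ℝ (fun z => (G z)⁻¹ i j) y :=
  diffAt_of_contDiffOn n.isOpen (n.metric.smooth_inv i j) n.mem

theorem pd_grad (n : NormalAt G F Φ U y) (l m : Fin 3) :
    pd l (fun z => ∑ j, (G z)⁻¹ m j * pd j F z) y = pd l (pd m F) y := by
  rw [pd_sum fun a _ => (n.diffAt_inv m a).fun_mul (n.diffAt_f a)]
  simp only [pd_mul (n.diffAt_inv m _) (n.diffAt_f _), n.pd_inv, n.inv_eq_one, zero_mul, zero_add,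
    Matrix.one_apply, ite_mul, one_mul, Finset.sum_ite_eq, Finset.mem_univ, if_true]

theorem pd_lapC (n : NormalAt G F Φ U y) (l : Fin 3) :
    pd l (lapC G F Φ) y = lapC G F Φ y * (vC G F Φ y 0 * hC G F Φ y l 0 -
      vC G F Φ y 0 * (pd 0 Φ y / Φ y) * vC G F Φ y l) := by
  have h1 := n.lapC_pos
  have h2 := n.pos y n.mem
  have dS := fun m => DifferentiableAt.fun_sum fun a (_ : a ∈ Finset.univ) =>
    (n.diffAt_inv m a).fun_mul (n.diffAt_f a)
  have dn : DifferentiableAt ℝ (dnC G F) y :=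
    diffAt_of_contDiffOn n.isOpen (n.metric.smooth_dnC n.isOpen n.smooth_f) n.mem
  have e1 : pd l (dnC G F) y = 2 * pd 0 F y * pd l (pd 0 F) y := by
    have hval : ∀ i, ∑ j, (G y)⁻¹ i j * pd j F y = pd i F y := fun i => by
      simp [n.inv_eq_one, Matrix.one_apply]
    have e : pd l (dnC G F) y = ∑ i, (pd l (pd i F) y * pd i F y + pd i F y * pd l (pd i F) y) := by
      unfold dnC
      rw [pd_sum fun i _ => (dS i).fun_mul (n.diffAt_f i)]
      exact Finset.sum_congr rfl fun i _ => by
        rw [pd_mul (dS i) (n.diffAt_f i), n.pd_grad, hval]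
    rw [e, Fin.sum_univ_three, n.pd_f 1 (by decide), n.pd_f 2 (by decide)]
    ring
  have dφ2 : DifferentiableAt ℝ (fun z => Φ z ^ 2) y := n.diffAt_φ.pow 2
  have hp : 0 < 1 + Φ y ^ 2 * dnC G F y := by
    have := n.metric.dnC_nonneg (F := F) n.mem; positivity
  have e2 : pd l (lapC G F Φ) y = (2 * Φ y * pd l Φ y * pd 0 F y ^ 2 +
      Φ y ^ 2 * (2 * pd 0 F y * pd l (pd 0 F) y)) / (2 * lapC G F Φ y) := by
    have := pd_sqrt (F := fun z => 1 + Φ z ^ 2 * dnC G F z)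
      ((differentiableAt_const _).fun_add (dφ2.fun_mul dn)) hp l
    rw [pd_add (differentiableAt_const _) (dφ2.fun_mul dn), pd_const, pd_mul dφ2 dn, e1,
      pd_pow_two n.diffAt_φ, n.dnC_eq, zero_add] at this
    refine Eq.trans this ?_
    rw [lapC, n.dnC_eq]
  rw [e2, n.pd_pd_f, n.vC_eq, n.vC_eq]
  field_simp
  ring

theorem pd_vC (n : NormalAt G F Φ U y) (l m : Fin 3) :
    pd l (fun z => vC G F Φ z m) y = hC G F Φ y l m -
      vC G F Φ y m * (vC G F Φ y 0 * hC G F Φ y l 0) - vC G F Φ y l * (pd m Φ y / Φ y) +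
      vC G F Φ y l * vC G F Φ y m * (vC G F Φ y 0 * (pd 0 Φ y / Φ y)) := by
  have h1 := n.lapC_pos
  have h2 := n.pos y n.mem
  have du := diffAt_of_contDiffOn n.isOpen
    (n.metric.smooth_lapC n.isOpen n.smooth_f n.smooth_φ) n.mem
  have dS := DifferentiableAt.fun_sum fun a (_ : a ∈ Finset.univ) =>
    (n.diffAt_inv m a).fun_mul (n.diffAt_f a)
  have dui : DifferentiableAt ℝ (fun z => (lapC G F Φ z)⁻¹) y := du.fun_inv h1.ne'
  unfold vC
  simp only [div_eq_mul_inv (Φ _)]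
  rw [pd_mul (n.diffAt_φ.fun_mul dui) dS, pd_mul n.diffAt_φ dui, JangEH.pd_inv du h1.ne',
    n.pd_grad, n.pd_lapC, n.pd_pd_f]
  simp only [n.vC_eq]
  simp only [n.inv_eq_one, Matrix.one_apply, ite_mul, one_mul, zero_mul, Finset.sum_ite_eq,
    Finset.mem_univ, if_true]
  field_simp
  ring

/-- Trades the second derivatives of φ for the derivatives of d log φ, the variables in which the
pointwise identities are written. -/
theorem pd_pd_φ (n : NormalAt G F Φ U y) (l m : Fin 3) :
    pd l (pd m Φ) y = Φ y * (pd l (fun z => pd m Φ z / Φ z) y +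
      pd l Φ y / Φ y * (pd m Φ y / Φ y)) := by
  have h2 := n.pos y n.mem
  have di : DifferentiableAt ℝ (fun z => (Φ z)⁻¹) y := n.diffAt_φ.fun_inv h2.ne'
  simp only [div_eq_mul_inv (pd m Φ _)]
  rw [pd_mul (n.diffAt_pd_φ m) di, JangEH.pd_inv n.diffAt_φ h2.ne']
  field_simp
  ring

theorem pd_hessC (n : NormalAt G F Φ U y) (l i j : Fin 3) :
    pd l (hessC G F i j) y = pd l (pd i (pd j F)) y -
      pd l (christoffel G 0 i j) y * pd 0 F y := by
  have d1 := diffAt_of_contDiffOn n.isOpen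
    (contDiffOn_pd n.isOpen (contDiffOn_pd n.isOpen n.smooth_f j) i) n.mem
  have d2 := fun m => diffAt_of_contDiffOn n.isOpen
    (n.metric.smooth_christoffel n.isOpen m i j) n.mem
  unfold hessC
  rw [pd_sub d1 (DifferentiableAt.fun_sum fun m _ => (d2 m).fun_mul (n.diffAt_f m)),
    pd_sum fun m _ => (d2 m).fun_mul (n.diffAt_f m)]
  simp only [pd_mul (d2 _) (n.diffAt_f _), n.christoffel_eq_zero, Fin.sum_univ_three,
    n.pd_f 1 (by decide), n.pd_f 2 (by decide)]
  ring

/-- The shape is dictated by the hypothesis `hdh` of `gauss_algebra`: the derivatives of f below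
third order are absorbed in h and v, and the factor v in front of the derivative of Γ⁰ comes from
differentiating the Hessian. -/
theorem pd_hC (n : NormalAt G F Φ U y) (l i j : Fin 3) :
    pd l (fun z => hC G F Φ z i j) y =
      pd l Φ y / Φ y * (hC G F Φ y i j - vC G F Φ y i * (pd j Φ y / Φ y) -
        pd i Φ y / Φ y * vC G F Φ y j) +
      Φ y / lapC G F Φ y * pd l (pd i (pd j F)) y -
      vC G F Φ y 0 * pd l (christoffel G 0 i j) y +
      (hC G F Φ y i l - vC G F Φ y i * (pd l Φ y / Φ y) -
        pd i Φ y / Φ y * vC G F Φ y l) * (pd j Φ y / Φ y) +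
      vC G F Φ y i * (pd j (fun z => pd l Φ z / Φ z) y + pd j Φ y / Φ y * (pd l Φ y / Φ y)) +
      (pd i (fun z => pd l Φ z / Φ z) y + pd i Φ y / Φ y * (pd l Φ y / Φ y)) * vC G F Φ y j +
      pd i Φ y / Φ y * (hC G F Φ y j l - vC G F Φ y j * (pd l Φ y / Φ y) -
        pd j Φ y / Φ y * vC G F Φ y l) -
      hC G F Φ y i j * (vC G F Φ y 0 * hC G F Φ y l 0 -
        vC G F Φ y 0 * (pd 0 Φ y / Φ y) * vC G F Φ y l) := by
  have h1 := n.lapC_pos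
  have h2 := n.pos y n.mem
  have du := diffAt_of_contDiffOn n.isOpen
    (n.metric.smooth_lapC n.isOpen n.smooth_f n.smooth_φ) n.mem
  have dui : DifferentiableAt ℝ (fun z => (lapC G F Φ z)⁻¹) y := du.fun_inv h1.ne'
  have dH := diffAt_of_contDiffOn n.isOpen (n.metric.smooth_hessC n.isOpen n.smooth_f i j) n.mem
  have e1 : hC G F Φ y i j * lapC G F Φ y =
      Φ y * hessC G F i j y + (pd i F y * pd j Φ y + pd i Φ y * pd j F y) := by
    simp only [hC, Matrix.of_apply]; field_simp
  have e2 : hessC G F i j y = pd i (pd j F) y := by simp [hessC, n.christoffel_eq_zero]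
  have eB : ∀ a b, pd a (pd b Φ) y = pd b (pd a Φ) y :=
    pd_comm n.isOpen n.smooth_φ n.mem
  have eF : ∀ a b, pd a (pd b F) y = pd b (pd a F) y :=
    pd_comm n.isOpen n.smooth_f n.mem
  have e3 : pd l (fun z => hC G F Φ z i j) y =
      (pd l Φ y * pd i (pd j F) y + Φ y * pd l (hessC G F i j) y +
        (pd i (pd l F) y * pd j Φ y + pd i F y * pd j (pd l Φ) y +
          (pd i (pd l Φ) y * pd j F y + pd i Φ y * pd j (pd l F) y))) / lapC G F Φ y -
      hC G F Φ y i j * lapC G F Φ y * pd l (lapC G F Φ) y / lapC G F Φ y ^ 2 := by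
    rw [e1, ← eF l i, ← eF l j, ← eB l i, ← eB l j]
    simp only [hC, Matrix.of_apply, div_eq_mul_inv (_ + _) (lapC _ _ _ _)]
    rw [pd_mul ((n.diffAt_φ.fun_mul dH).fun_add (((n.diffAt_f i).fun_mul
        (n.diffAt_pd_φ j)).fun_add ((n.diffAt_pd_φ i).fun_mul (n.diffAt_f j)))) dui,
      pd_add (n.diffAt_φ.fun_mul dH) (((n.diffAt_f i).fun_mul
        (n.diffAt_pd_φ j)).fun_add ((n.diffAt_pd_φ i).fun_mul (n.diffAt_f j))),
      pd_add ((n.diffAt_f i).fun_mul (n.diffAt_pd_φ j)) ((n.diffAt_pd_φ i).fun_mul (n.diffAt_f j)),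
      pd_mul n.diffAt_φ dH, pd_mul (n.diffAt_f i) (n.diffAt_pd_φ j),
      pd_mul (n.diffAt_pd_φ i) (n.diffAt_f j), JangEH.pd_inv du h1.ne', e2]
    ring
  rw [e3, n.pd_lapC, n.pd_hessC, n.pd_pd_f i j, n.pd_pd_f i l, n.pd_pd_f j l, n.pd_pd_φ j l,
    n.pd_pd_φ i l]
  simp only [n.vC_eq]
  field_simp
  ring

theorem logGradC_eq (n : NormalAt G F Φ U y) (m : Fin 3) :
    logGradC G F Φ y m = pd m Φ y / Φ y - vC G F Φ y m * (vC G F Φ y 0 * (pd 0 Φ y / Φ y)) := by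
  have h1 : vC G F Φ y 1 = 0 := by rw [n.vC_eq_vec]; rfl
  have h2 : vC G F Φ y 2 = 0 := by rw [n.vC_eq_vec]; rfl
  simp only [logGradC, sub_mul, Finset.sum_sub_distrib, n.inv_eq_one, Matrix.one_apply, ite_mul,
    one_mul, zero_mul, Finset.sum_ite_eq, Finset.mem_univ, if_true, Fin.sum_univ_three, h1, h2]
  ring

theorem pd_logGradC (n : NormalAt G F Φ U y) (l m : Fin 3) :
    pd l (fun z => logGradC G F Φ z m) y = pd l (fun z => pd m Φ z / Φ z) y -
      pd l (fun z => vC G F Φ z m) y * (vC G F Φ y 0 * (pd 0 Φ y / Φ y)) -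
      vC G F Φ y m * ((pd l (fun z => vC G F Φ z 0) y * (pd 0 Φ y / Φ y) +
        pd l (fun z => vC G F Φ z 1) y * (pd 1 Φ y / Φ y) +
        pd l (fun z => vC G F Φ z 2) y * (pd 2 Φ y / Φ y)) +
        vC G F Φ y 0 * pd l (fun z => pd 0 Φ z / Φ z) y) := by
  have h1 : vC G F Φ y 1 = 0 := by rw [n.vC_eq_vec]; rfl
  have h2 : vC G F Φ y 2 = 0 := by rw [n.vC_eq_vec]; rfl
  have hp := n.pos y n.mem
  have dv := fun i => diffAt_of_contDiffOn n.isOpen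
    (n.metric.smooth_vC n.isOpen n.smooth_f n.smooth_φ i) n.mem
  have db : ∀ m, DifferentiableAt ℝ (fun z => pd m Φ z / Φ z) y := fun m =>
    by simpa only [div_eq_mul_inv] using (n.diffAt_pd_φ m).fun_mul (n.diffAt_φ.fun_inv hp.ne')
  have dA := fun a => (n.diffAt_inv m a).fun_sub ((dv m).fun_mul (dv a))
  unfold logGradC
  rw [pd_sum fun a _ => (dA a).fun_mul (db a)]
  simp only [pd_mul (dA _) (db _), pd_sub (n.diffAt_inv m _) ((dv m).fun_mul (dv _)),
    pd_mul (dv m) (dv _), n.pd_inv, n.inv_eq_one]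
  have h3 : ∀ c : Fin 3 → ℝ, ∑ a, (1 : Matrix (Fin 3) (Fin 3) ℝ) m a * c a = c m := by
    intro c; simp [Matrix.one_apply]
  simp only [sub_mul, Finset.sum_add_distrib, Finset.sum_sub_distrib, h3]
  simp only [Fin.sum_univ_three, h1, h2]
  ring

end NormalAt

end JangEH

/-! ### The Schoen–Yau identity at the origin of adapted normal coordinates. -/

namespace JangEH

/-- The generalized Schoen–Yau identity in a chart, for solutions of the generalized Jang
equation. -/
def SchoenYauAt (G K : MatField) (F Φ : E3 → ℝ) (y : E3) : Prop :=
  Φ y * scalarC (gbarC G F Φ) y + 2 * codivC (gbarC G F Φ) (fluxC G K F Φ) y =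
    Φ y * (scalarC G y + traceC G K y ^ 2 - normSqC G K y -
      2 * ∑ j, vC G F Φ y j * divC G (fun z => K z - traceC G K z • G z) j y +
      normSqC (gbarC G F Φ) (fun z => hC G F Φ z - K z) y) +
    2 / Φ y * ∑ i, ∑ j, (gbarC G F Φ y)⁻¹ i j * (fluxC G K F Φ y i * fluxC G K F Φ y j)

namespace NormalAt

variable {G K : MatField} {F Φ : E3 → ℝ} {U : Set E3} {y : E3}

theorem sq_mul_pd (n : NormalAt G F Φ U y) (i j : Fin 3) :
    Φ y ^ 2 * (pd i F y * pd j F y) = lapC G F Φ y ^ 2 * vC G F Φ y i * vC G F Φ y j := by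
  have h1 := n.lapC_pos
  rw [n.vC_eq, n.vC_eq]
  field_simp

theorem pd_sq_mul_pd (n : NormalAt G F Φ U y) (l i j : Fin 3) :
    pd l (fun z => Φ z ^ 2 * (pd i F z * pd j F z)) y = lapC G F Φ y ^ 2 *
      ((hC G F Φ y l i - pd i Φ y / Φ y * vC G F Φ y l) * vC G F Φ y j +
        vC G F Φ y i * (hC G F Φ y l j - pd j Φ y / Φ y * vC G F Φ y l)) := by
  have h1 := n.lapC_pos
  have h2 := n.pos y n.mem
  rw [pd_mul (n.diffAt_φ.fun_pow 2) ((n.diffAt_f i).fun_mul (n.diffAt_f j)),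
    pd_mul (n.diffAt_f i) (n.diffAt_f j), pd_pow_two n.diffAt_φ, n.pd_pd_f, n.pd_pd_f]
  simp only [n.vC_eq]
  field_simp
  ring

theorem christoffel_gbarC_eq (n : NormalAt G F Φ U y) (m i j : Fin 3) :
    christoffel (gbarC G F Φ) m i j y = hC G F Φ y i j * vC G F Φ y m -
      (pd m Φ y / Φ y - vC G F Φ y m * (vC G F Φ y 0 * (pd 0 Φ y / Φ y))) *
        (lapC G F Φ y ^ 2 * vC G F Φ y i * vC G F Φ y j) := by
  rw [n.metric.christoffel_gbarC n.isOpen n.smooth_f n.smooth_φ n.mem (n.pos y n.mem),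
    n.christoffel_eq_zero, n.logGradC_eq, n.sq_mul_pd, zero_add]

theorem pd_christoffel_gbarC (n : NormalAt G F Φ U y) (l m i j : Fin 3) :
    pd l (christoffel (gbarC G F Φ) m i j) y = pd l (christoffel G m i j) y +
      pd l (fun z => hC G F Φ z i j) y * vC G F Φ y m +
      hC G F Φ y i j * pd l (fun z => vC G F Φ z m) y -
      pd l (fun z => logGradC G F Φ z m) y *
        (lapC G F Φ y ^ 2 * vC G F Φ y i * vC G F Φ y j) -
      (pd m Φ y / Φ y - vC G F Φ y m * (vC G F Φ y 0 * (pd 0 Φ y / Φ y))) *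
        pd l (fun z => Φ z ^ 2 * (pd i F z * pd j F z)) y := by
  have hU := n.isOpen
  have hp := n.pos y n.mem
  have dΓ := diffAt_of_contDiffOn hU (n.metric.smooth_christoffel hU m i j) n.mem
  have dh := diffAt_of_contDiffOn hU (n.metric.smooth_hC hU n.smooth_f n.smooth_φ i j) n.mem
  have dv := fun i => diffAt_of_contDiffOn hU
    (n.metric.smooth_vC hU n.smooth_f n.smooth_φ i) n.mem
  have dL : DifferentiableAt ℝ (fun z => logGradC G F Φ z m) y := by
    unfold logGradC
    simp only [div_eq_mul_inv]
    exact DifferentiableAt.fun_sum fun a _ =>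
      ((n.diffAt_inv m a).fun_sub ((dv m).fun_mul (dv a))).fun_mul
        ((n.diffAt_pd_φ a).fun_mul (n.diffAt_φ.fun_inv hp.ne'))
  have dE : DifferentiableAt ℝ (fun z => Φ z ^ 2 * (pd i F z * pd j F z)) y :=
    (n.diffAt_φ.fun_pow 2).fun_mul ((n.diffAt_f i).fun_mul (n.diffAt_f j))
  rw [pd_congr_on hU (fun z hz => n.metric.christoffel_gbarC hU n.smooth_f n.smooth_φ hz
      (n.pos z hz) m i j) n.mem, pd_sub (dΓ.fun_add (dh.fun_mul (dv m))) (dL.fun_mul dE),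
    pd_add dΓ (dh.fun_mul (dv m)), pd_mul dh (dv m), pd_mul dL dE, n.logGradC_eq, n.sq_mul_pd]
  ring

theorem gbarC_inv_eq (n : NormalAt G F Φ U y) : (gbarC G F Φ y)⁻¹ =
    Matrix.of ![![1 - vC G F Φ y 0 ^ 2, 0, 0], ![0, 1, 0], ![0, 0, 1]] := by
  have h1 : vC G F Φ y 1 = 0 := by rw [n.vC_eq_vec]; rfl
  have h2 : vC G F Φ y 2 = 0 := by rw [n.vC_eq_vec]; rfl
  rw [n.metric.gbarC_inv n.mem, n.inv_eq_one]
  ext i j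
  fin_cases i <;> fin_cases j <;> simp [h1, h2, pow_two]

theorem hC_symm (n : NormalAt G F Φ U y) {z : E3} (hz : z ∈ U) (i j : Fin 3) :
    hC G F Φ z i j = hC G F Φ z j i := by
  simp only [hC, hessC, Matrix.of_apply, pd_comm n.isOpen n.smooth_f hz i j,
    n.metric.christoffel_symm n.isOpen hz _ i j]
  ring

/-- Valid for arbitrary f and φ > 0: the Jang equation plays no role yet. The last sum is the
Codazzi expression of h in the direction of v. -/
theorem gauss (n : NormalAt G F Φ U y) :
    scalarC (gbarC G F Φ) y = scalarC G y + (∑ i, hC G F Φ y i i) ^ 2 -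
      ∑ i, ∑ j, hC G F Φ y i j ^ 2 - 2 * vC G F Φ y 0 *
        ∑ l, (pd l (fun z => hC G F Φ z l 0) y - pd 0 (fun z => hC G F Φ z l l) y) := by
  have hU := n.isOpen
  have eF : ∀ a b, pd a (pd b F) y = pd b (pd a F) y := pd_comm hU n.smooth_f n.mem
  have eF3 : ∀ a b c, pd a (pd b (pd c F)) y = pd b (pd a (pd c F)) y := fun a b c =>
    pd_comm hU (contDiffOn_pd hU n.smooth_f c) n.mem a b
  have eF3' : ∀ a b c, pd a (pd b (pd c F)) y = pd a (pd c (pd b F)) y := fun a b c =>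
    pd_congr_on hU (fun z hz => pd_comm hU n.smooth_f hz b c) n.mem a
  have eG : ∀ a b i j, pd a (pd b (fun z => G z i j)) y = pd b (pd a (fun z => G z i j)) y :=
    fun a b i j => pd_comm hU (n.metric.smooth i j) n.mem a b
  have eG' : ∀ a b i j, pd a (pd b (fun z => G z i j)) y = pd a (pd b (fun z => G z j i)) y :=
    fun a b i j => pd_congr_on hU (fun z hz => n.metric.pd_symm hU hz b i j) n.mem a
  -- The symmetries demanded of `T` and `hR` all come from commuting partial derivatives of f and of
  -- the metric.
  have key := gauss_algebra (vC G F Φ y 0) (lapC G F Φ y ^ 2) n.lapC_sq_mul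
    (fun i => pd i Φ y / Φ y) (fun l m => pd l (fun z => pd m Φ z / Φ z) y)
    (fun i j => hC G F Φ y i j)
    (fun l i j => Φ y / lapC G F Φ y * pd l (pd i (pd j F)) y)
    (fun l m i j => pd l (christoffel G m i j) y) (n.hC_symm n.mem)
    (fun i j k => by simp only [eF3 i j k]) (fun i j k => by simp only [eF3' i j k])
    (fun i => by
      simp only [n.pd_christoffel]
      linear_combination (eG i 0 0 i).trans (eG' 0 i 0 i))
    (fun l m => pd l (fun z => vC G F Φ z m) y)
    (fun l m => pd l (fun z => logGradC G F Φ z m) y)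
    (fun l i j => pd l (fun z => hC G F Φ z i j) y)
    (fun l i j => pd l (fun z => Φ z ^ 2 * (pd i F z * pd j F z)) y)
    (vC G F Φ y) n.vC_eq_vec n.pd_vC (fun l m => n.pd_logGradC l m)
    (fun l i j => n.pd_sq_mul_pd l i j) (fun l i j => n.pd_hC l i j)
    (fun m i j => christoffel (gbarC G F Φ) m i j y) (fun m i j => n.christoffel_gbarC_eq m i j)
    (fun l m i j => pd l (christoffel (gbarC G F Φ) m i j) y)
    (fun l m i j => n.pd_christoffel_gbarC l m i j)
    (fun i j => ricci (gbarC G F Φ) i j y) (fun i j => ricci G i j y)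
    (fun i j => rfl) (fun i j => by simp [ricci, n.christoffel_eq_zero])
  have e1 : scalarC (gbarC G F Φ) y = (1 - vC G F Φ y 0 ^ 2) * ricci (gbarC G F Φ) 0 0 y +
      ricci (gbarC G F Φ) 1 1 y + ricci (gbarC G F Φ) 2 2 y := by
    simp [scalarC, n.gbarC_inv_eq, Fin.sum_univ_three]
  have e2 : scalarC G y = ricci G 0 0 y + ricci G 1 1 y + ricci G 2 2 y := by
    simp [scalarC, n.inv_eq_one, Fin.sum_univ_three]
  rw [e1, key, e2, Fin.sum_univ_three (fun i => hC G F Φ y i i)]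

theorem traceC_eq (n : NormalAt G F Φ U y) : traceC G K y = ∑ i, K y i i := by
  simp [traceC, n.inv_eq_one, Fin.sum_univ_three]

theorem normSqC_eq (n : NormalAt G F Φ U y) : normSqC G K y = ∑ i, ∑ j, K y i j ^ 2 := by
  simp [normSqC, n.inv_eq_one, Fin.sum_univ_three]
  ring

theorem divC_eq (n : NormalAt G F Φ U y) (hK : SmoothMat K U) (j : Fin 3) :
    divC G (fun z => K z - traceC G K z • G z) j y =
      ∑ l, (pd l (fun z => K z l j) y - pd j (fun z => K z l l) y) := by
  have hU := n.isOpen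
  have dK := fun i j => diffAt_of_contDiffOn hU (hK i j) n.mem
  have dG := fun i j => diffAt_of_contDiffOn hU (n.metric.smooth i j) n.mem
  have dT : DifferentiableAt ℝ (traceC G K) y := DifferentiableAt.fun_sum fun a _ =>
    DifferentiableAt.fun_sum fun b _ => (n.diffAt_inv a b).fun_mul (dK a b)
  have e1 : ∀ l, pd l (traceC G K) y = ∑ a, pd l (fun z => K z a a) y := by
    intro l
    unfold traceC
    rw [pd_sum fun a _ => DifferentiableAt.fun_sum fun b _ => (n.diffAt_inv a b).fun_mul (dK a b)]
    refine Finset.sum_congr rfl fun a _ => ?_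
    rw [pd_sum fun b _ => (n.diffAt_inv a b).fun_mul (dK a b)]
    simp only [pd_mul (n.diffAt_inv a _) (dK a _), n.pd_inv, n.inv_eq_one, Matrix.one_apply]
    simp
  have e2 : ∀ l i, covDerivC G (fun z => K z - traceC G K z • G z) l i j y =
      pd l (fun z => K z i j) y -
        (∑ a, pd l (fun z => K z a a) y) * (1 : Matrix (Fin 3) (Fin 3) ℝ) i j := by
    intro l i
    simp only [covDerivC, n.christoffel_eq_zero, zero_mul, add_zero, Finset.sum_const_zero,
      sub_zero, Matrix.sub_apply, Matrix.smul_apply, smul_eq_mul]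
    rw [pd_sub (dK i j) (dT.fun_mul (dG i j)), pd_mul dT (dG i j), n.pd_metric, e1, n.eq_one,
      mul_zero, add_zero]
  simp only [divC, e2, n.inv_eq_one]
  fin_cases j <;> simp [Fin.sum_univ_three, Matrix.one_apply]

/-- The Gauss equation followed by the exchange of h for k. The Jang equation is required on a
neighbourhood, since it is differentiated. -/
theorem schoenYau (n : NormalAt G F Φ U y) (hK : SmoothMat K U)
    (hKs : ∀ z ∈ U, ∀ i j, K z i j = K z j i)
    (htr : ∀ z ∈ U, traceC (gbarC G F Φ) (fun w => hC G F Φ w - K w) z = 0) :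
    SchoenYauAt G K F Φ y := by
  have hU := n.isOpen
  have hp := n.pos y n.mem
  have dK := fun i j => diffAt_of_contDiffOn hU (hK i j) n.mem
  have dh := fun i j => diffAt_of_contDiffOn hU
    (n.metric.smooth_hC hU n.smooth_f n.smooth_φ i j) n.mem
  have dv := fun i => diffAt_of_contDiffOn hU
    (n.metric.smooth_vC hU n.smooth_f n.smooth_φ i) n.mem
  have h1 : vC G F Φ y 1 = 0 := by rw [n.vC_eq_vec]; rfl
  have h2 : vC G F Φ y 2 = 0 := by rw [n.vC_eq_vec]; rfl
  have hgi : ∀ i j, (gbarC G F Φ y)⁻¹ i j =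
      (![![1 - vC G F Φ y 0 ^ 2, 0, 0], ![0, 1, 0], ![0, 0, 1]] : Fin 3 → Fin 3 → ℝ) i j := by
    intro i j; rw [n.gbarC_inv_eq]; rfl
  have ds := fun i j => (dh i j).fun_sub (dK i j)
  have htr0 := htr y n.mem
  simp only [traceC, Matrix.sub_apply, hgi] at htr0
  -- The Jang equation is differentiated with ḡ⁻¹ written as g⁻¹ - v ⊗ v; at the origin only the
  -- factor v ⊗ v of the inverse metric has a derivative.
  have hdtr : ∑ i, ∑ j, (-(pd 0 (fun z => vC G F Φ z i) y * vC G F Φ y j +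
      vC G F Φ y i * pd 0 (fun z => vC G F Φ z j) y) * (hC G F Φ y i j - K y i j) +
      (![![1 - vC G F Φ y 0 ^ 2, 0, 0], ![0, 1, 0], ![0, 0, 1]] : Fin 3 → Fin 3 → ℝ) i j *
        (pd 0 (fun z => hC G F Φ z i j) y - pd 0 (fun z => K z i j) y)) = 0 := by
    have e := pd_congr_on hU (H := fun _ => (0 : ℝ)) htr n.mem 0
    have e' : pd 0 (traceC (gbarC G F Φ) (fun w => hC G F Φ w - K w)) y =
        pd 0 (fun z => ∑ i, ∑ j, ((G z)⁻¹ i j - vC G F Φ z i * vC G F Φ z j) *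
          (hC G F Φ z i j - K z i j)) y := by
      refine pd_congr_on hU (fun z hz => ?_) n.mem 0
      simp only [traceC, n.metric.gbarC_inv hz, Matrix.of_apply, Matrix.sub_apply]
    have dg := fun i j => (n.diffAt_inv i j).fun_sub ((dv i).fun_mul (dv j))
    rw [e', pd_const, pd_sum fun i _ => DifferentiableAt.fun_sum fun j _ =>
      (dg i j).fun_mul (ds i j)] at e
    refine Eq.trans ?_ e
    refine Finset.sum_congr rfl fun i _ => ?_
    rw [pd_sum fun j _ => (dg i j).fun_mul (ds i j)]
    refine Finset.sum_congr rfl fun j _ => ?_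
    rw [pd_mul (dg i j) (ds i j), pd_sub (n.diffAt_inv i j) ((dv i).fun_mul (dv j)),
      pd_mul (dv i) (dv j), pd_sub (dh i j) (dK i j), n.pd_inv, ← hgi, n.metric.gbarC_inv n.mem,
      Matrix.of_apply]
    ring
  set q : Fin 3 → ℝ := fun j => ∑ i, vC G F Φ y i * (hC G F Φ y i j - K y i j) with hq
  set dq : Fin 3 → Fin 3 → ℝ := fun l j =>
    ∑ i, (pd l (fun z => vC G F Φ z i) y * (hC G F Φ y i j - K y i j) +
      vC G F Φ y i * (pd l (fun z => hC G F Φ z i j) y - pd l (fun z => K z i j) y)) with hdq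
  have key := codazzi_algebra (vC G F Φ y 0) (lapC G F Φ y ^ 2) n.lapC_sq_mul
    (fun i => pd i Φ y / Φ y) (fun i j => hC G F Φ y i j) (fun i j => K y i j)
    (n.hC_symm n.mem) (hKs y n.mem)
    (fun l m => pd l (fun z => vC G F Φ z m) y)
    (fun l i j => pd l (fun z => hC G F Φ z i j) y) (fun l i j => pd l (fun z => K z i j) y)
    (fun l i j => pd_congr_on hU (fun z hz => n.hC_symm hz i j) n.mem l)
    (fun l i j => pd_congr_on hU (fun z hz => hKs z hz i j) n.mem l)
    (vC G F Φ y) n.vC_eq_vec n.pd_vC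
    (fun m i j => christoffel (gbarC G F Φ) m i j y) (fun m i j => n.christoffel_gbarC_eq m i j)
    _ rfl htr0 hdtr q (fun _ => rfl) dq (fun _ _ => rfl)
  have eα : ∀ j, fluxC G K F Φ y j = Φ y * q j := fun j => rfl
  have edα : ∀ l j, pd l (fun z => fluxC G K F Φ z j) y = pd l Φ y * q j + Φ y * dq l j := by
    intro l j
    have dS := DifferentiableAt.fun_sum fun a (_ : a ∈ Finset.univ) => (dv a).fun_mul (ds a j)
    unfold fluxC
    simp only [Matrix.sub_apply]
    rw [pd_mul n.diffAt_φ dS, pd_sum fun a _ => (dv a).fun_mul (ds a j)]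
    simp only [pd_mul (dv _) (ds _ j), pd_sub (dh _ j) (dK _ j), hq, hdq]
  -- Taking out the factor φ of φ q turns dφ into d log φ, which accounts for the term with b in
  -- `codazzi_algebra`.
  have ecod : codivC (gbarC G F Φ) (fluxC G K F Φ) y = Φ y * ∑ i, ∑ j,
      (![![1 - vC G F Φ y 0 ^ 2, 0, 0], ![0, 1, 0], ![0, 0, 1]] : Fin 3 → Fin 3 → ℝ) i j *
        (pd i Φ y / Φ y * q j + dq i j - ∑ m, christoffel (gbarC G F Φ) m i j y * q m) := by
    rw [codivC, Finset.mul_sum]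
    refine Finset.sum_congr rfl fun i _ => ?_
    rw [Finset.mul_sum]
    refine Finset.sum_congr rfl fun j _ => ?_
    simp only [covC, Matrix.of_apply, edα, eα, hgi, Fin.sum_univ_three]
    field_simp
  have edot : ∑ j, vC G F Φ y j * divC G (fun z => K z - traceC G K z • G z) j y =
      vC G F Φ y 0 * ∑ l, (pd l (fun z => K z l 0) y - pd 0 (fun z => K z l l) y) := by
    rw [Fin.sum_univ_three (fun j => vC G F Φ y j * _), h1, h2, n.divC_eq hK]
    ring
  have eqq : ∑ i, ∑ j, (gbarC G F Φ y)⁻¹ i j * (fluxC G K F Φ y i * fluxC G K F Φ y j) =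
      Φ y ^ 2 * ∑ i, ∑ j,
        (![![1 - vC G F Φ y 0 ^ 2, 0, 0], ![0, 1, 0], ![0, 0, 1]] : Fin 3 → Fin 3 → ℝ) i j *
          (q i * q j) := by
    simp only [hgi, eα, Finset.mul_sum]
    exact Finset.sum_congr rfl fun i _ => Finset.sum_congr rfl fun j _ => by ring
  have ens : normSqC (gbarC G F Φ) (fun z => hC G F Φ z - K z) y = ∑ i, ∑ j, ∑ a, ∑ c,
      (![![1 - vC G F Φ y 0 ^ 2, 0, 0], ![0, 1, 0], ![0, 0, 1]] : Fin 3 → Fin 3 → ℝ) i a *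
      (![![1 - vC G F Φ y 0 ^ 2, 0, 0], ![0, 1, 0], ![0, 0, 1]] : Fin 3 → Fin 3 → ℝ) j c *
        (hC G F Φ y i j - K y i j) * (hC G F Φ y a c - K y a c) := by
    simp only [normSqC, hgi, Matrix.sub_apply]
  rw [SchoenYauAt, n.gauss, ecod, edot, eqq, ens, n.traceC_eq, n.normSqC_eq]
  have e9 : ∀ X : ℝ, 2 / Φ y * (Φ y ^ 2 * X) = Φ y * (2 * X) := fun X => by field_simp
  rw [e9]
  linear_combination Φ y * key

end NormalAt

end JangEH

/-! ### Adapted frames, normal coordinates and the identity in an arbitrary chart. -/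

namespace JangEH

open scoped MatrixOrder Matrix.Norms.L2Operator in
theorem posDef_eq_transpose_mul {P : Matrix (Fin 3) (Fin 3) ℝ} (hP : P.PosDef) :
    ∃ B : Matrix (Fin 3) (Fin 3) ℝ, IsUnit B.det ∧ P = B.transpose * B := by
  obtain ⟨B, hB, h⟩ := CStarAlgebra.isStrictlyPositive_iff_eq_star_mul_self.1
    (Matrix.isStrictlyPositive_iff_posDef.2 hP)
  exact ⟨B, (Matrix.isUnit_iff_isUnit_det _).1 hB, h⟩

/-- A frame which is orthonormal for `P` and whose last two vectors are annihilated by `w`. -/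
theorem exists_adapted_frame {P : Matrix (Fin 3) (Fin 3) ℝ} (hP : P.PosDef) (w : Fin 3 → ℝ) :
    ∃ A : Matrix (Fin 3) (Fin 3) ℝ, A.det ≠ 0 ∧ A.transpose * P * A = 1 ∧
      ∀ i, i ≠ 0 → ∑ a, A a i * w a = 0 := by
  obtain ⟨B, hB, rfl⟩ := posDef_eq_transpose_mul hP
  -- In the frame given by the columns of B⁻¹ the form P is the standard one and w has the
  -- components w'. An orthonormal basis beginning with w' normalized has its other vectors
  -- orthogonal to w'; if w' = 0, any basis will do.
  set w' : E3 := WithLp.toLp 2 (B⁻¹.transpose.mulVec w) with hw'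
  obtain ⟨b, hb⟩ : ∃ b : OrthonormalBasis (Fin 3) ℝ E3, ∀ i, i ≠ 0 → inner ℝ (b i) w' = 0 := by
    by_cases h0 : w' = 0
    · exact ⟨EuclideanSpace.basisFun (Fin 3) ℝ, fun i _ => by rw [h0, inner_zero_right]⟩
    · obtain ⟨b, hb⟩ := Orthonormal.exists_orthonormalBasis_extension_of_card_eq (𝕜 := ℝ)
        (E := E3) (ι := Fin 3) (by simp) (v := fun _ => ‖w'‖⁻¹ • w') (s := {0}) (by
          constructor
          · intro i; simp [norm_smul, h0]
          · intro i j hij; exact absurd (Subsingleton.elim i j) hij)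
      refine ⟨b, fun i hi => ?_⟩
      have h1 : w' = ‖w'‖ • b 0 := by
        rw [hb 0 rfl, smul_smul, mul_inv_cancel₀ (norm_ne_zero_iff.2 h0), one_smul]
      rw [h1, inner_smul_right, b.orthonormal.2 hi, mul_zero]
  set O : Matrix (Fin 3) (Fin 3) ℝ := Matrix.of fun a i => b i a with hO
  have hOO : O.transpose * O = 1 := by
    ext i j
    have := orthonormal_iff_ite.1 b.orthonormal j i
    simp only [PiLp.inner_apply, RCLike.inner_apply, conj_trivial] at this
    simp only [Matrix.mul_apply, Matrix.transpose_apply, hO, Matrix.of_apply, Matrix.one_apply]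
    rw [this]
    simp only [eq_comm]
  have hOd : O.det ≠ 0 := by
    intro h
    have := congrArg Matrix.det hOO
    simp [h] at this
  refine ⟨B⁻¹ * O, ?_, ?_, fun i hi => ?_⟩
  · rw [Matrix.det_mul]
    exact mul_ne_zero (Matrix.isUnit_nonsing_inv_det _ hB).ne_zero hOd
  · have h1 : B * B⁻¹ = 1 := Matrix.mul_nonsing_inv _ hB
    calc (B⁻¹ * O).transpose * (B.transpose * B) * (B⁻¹ * O)
        = O.transpose * (B * B⁻¹).transpose * (B * B⁻¹) * O := by
          simp only [Matrix.transpose_mul, Matrix.mul_assoc]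
      _ = 1 := by rw [h1]; simp [hOO]
  · have h2 := hb i hi
    simp only [PiLp.inner_apply, RCLike.inner_apply, conj_trivial, hw', Matrix.mulVec,
      dotProduct, Matrix.transpose_apply] at h2
    simp only [Matrix.mul_apply, hO, Matrix.of_apply, Fin.sum_univ_three] at h2 ⊢
    linear_combination h2

/-! ### Normal coordinates -/

/-- A quadratic change of coordinates. -/
noncomputable def quadMap (y : E3) (A : Matrix (Fin 3) (Fin 3) ℝ)
    (Q : Fin 3 → Fin 3 → Fin 3 → ℝ) (z : E3) : E3 :=
  WithLp.toLp 2 fun a => y a + ∑ j, A a j * z j - (1 / 2) * ∑ l, ∑ j, Q a l j * (z l * z j)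

theorem pd_proj (i j : Fin 3) (z : E3) : pd i (fun w : E3 => w j) z = if i = j then 1 else 0 := by
  have : HasFDerivAt (fun w : E3 => w j) (EuclideanSpace.proj j : E3 →L[ℝ] ℝ) z :=
    (EuclideanSpace.proj j : E3 →L[ℝ] ℝ).hasFDerivAt
  simp [pd, this.fderiv, basisVec, eq_comm]

theorem contDiff_proj (j : Fin 3) : ContDiff ℝ ∞ (fun w : E3 => w j) :=
  (EuclideanSpace.proj j : E3 →L[ℝ] ℝ).contDiff

theorem contDiff_quadMap (y : E3) (A : Matrix (Fin 3) (Fin 3) ℝ)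
    (Q : Fin 3 → Fin 3 → Fin 3 → ℝ) : ContDiff ℝ ∞ (quadMap y A Q) := by
  refine contDiff_euclidean.2 fun a => ?_
  exact (contDiff_const.add (ContDiff.sum fun j _ => contDiff_const.mul (contDiff_proj j))).sub
    (contDiff_const.mul (ContDiff.sum fun l _ => ContDiff.sum fun j _ =>
      contDiff_const.mul ((contDiff_proj l).mul (contDiff_proj j))))

theorem jac_quadMap (y : E3) (A : Matrix (Fin 3) (Fin 3) ℝ) {Q : Fin 3 → Fin 3 → Fin 3 → ℝ}
    (hQ : ∀ a l j, Q a l j = Q a j l) (z : E3) (a i : Fin 3) :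
    jac (quadMap y A Q) z a i = A a i - ∑ l, Q a i l * z l := by
  have dp : ∀ j, DifferentiableAt ℝ (fun w : E3 => w j) z := fun j =>
    (contDiff_proj j).differentiable (by simp) z
  have d1 : ∀ j, DifferentiableAt ℝ (fun w : E3 => A a j * w j) z := fun j =>
    (differentiableAt_const _).fun_mul (dp j)
  have d2 : ∀ l j, DifferentiableAt ℝ (fun w : E3 => Q a l j * (w l * w j)) z := fun l j =>
    (differentiableAt_const _).fun_mul ((dp l).fun_mul (dp j))
  have e1 : ∀ j, pd i (fun w : E3 => A a j * w j) z = A a j * if i = j then 1 else 0 := fun j => by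
    rw [pd_mul (differentiableAt_const _) (dp j), pd_const, pd_proj]; ring
  have e2 : ∀ l j, pd i (fun w : E3 => Q a l j * (w l * w j)) z =
      Q a l j * ((if i = l then 1 else 0) * z j + z l * if i = j then 1 else 0) := fun l j => by
    rw [pd_mul (differentiableAt_const _) ((dp l).fun_mul (dp j)), pd_const, pd_mul (dp l) (dp j),
      pd_proj, pd_proj]; ring
  have s1 := DifferentiableAt.fun_sum fun j (_ : j ∈ Finset.univ) => d1 j
  have s2 := DifferentiableAt.fun_sum fun l (_ : l ∈ Finset.univ) =>
    DifferentiableAt.fun_sum fun j (_ : j ∈ Finset.univ) => d2 l j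
  have : pd i (fun w => y a + ∑ j, A a j * w j - (1 / 2) * ∑ l, ∑ j, Q a l j * (w l * w j)) z =
      ∑ j, A a j * (if i = j then 1 else 0) - (1 / 2) * ∑ l, ∑ j,
        Q a l j * ((if i = l then 1 else 0) * z j + z l * if i = j then 1 else 0) := by
    rw [pd_sub ((differentiableAt_const _).fun_add s1) ((differentiableAt_const _).fun_mul s2),
      pd_add (differentiableAt_const _) s1, pd_mul (differentiableAt_const _) s2, pd_const,
      pd_const, pd_sum fun j _ => d1 j,
      pd_sum fun l _ => DifferentiableAt.fun_sum fun j _ => d2 l j]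
    simp only [pd_sum fun j _ => d2 _ j, e1, e2]
    ring
  refine Eq.trans this ?_
  simp only [Fin.sum_univ_three, hQ a 1 0, hQ a 2 0, hQ a 2 1]
  fin_cases i <;> simp [hQ a 1 0, hQ a 2 0, hQ a 2 1] <;> ring

theorem quadMap_zero (y : E3) (A : Matrix (Fin 3) (Fin 3) ℝ) (Q : Fin 3 → Fin 3 → Fin 3 → ℝ) :
    quadMap y A Q 0 = y := by
  ext a; simp [quadMap]

-- Every term of the identity is invariant under changes of coordinates, and a quadratic change
-- brings any given point to the origin of adapted normal coordinates, where the identity is known.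
set_option maxHeartbeats 1000000 in
theorem schoenYauAt {G K : MatField} {F Φ : E3 → ℝ} {V : Set E3} (hG : MetricOn G V)
    (hV : IsOpen V) (hF : ContDiffOn ℝ ∞ F V) (hΦ : ContDiffOn ℝ ∞ Φ V) (hpos : ∀ z ∈ V, 0 < Φ z)
    (hK : SmoothMat K V) (hKs : ∀ z ∈ V, ∀ i j, K z i j = K z j i)
    (htr : ∀ z ∈ V, traceC (gbarC G F Φ) (fun w => hC G F Φ w - K w) z = 0) {y : E3} (hy : y ∈ V) :
    SchoenYauAt G K F Φ y := by
  obtain ⟨A, hA, hA1, hA2⟩ := exists_adapted_frame (hG.posDef y hy) fun i => pd i F y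
  -- The Christoffel symbols at y read in the frame A. With this quadratic part, ∂J cancels Γ J in
  -- the transformation law, so the new connection vanishes at the origin and with it the first
  -- derivatives of the new metric.
  let Q : Fin 3 → Fin 3 → Fin 3 → ℝ := fun a l j =>
    ∑ c, ∑ b, A c l * A b j * christoffel G a c b y
  have hQ : ∀ a l j, Q a l j = Q a j l := by
    intro a l j
    simp only [Q]
    rw [Finset.sum_comm]
    exact Finset.sum_congr rfl fun c _ => Finset.sum_congr rfl fun b _ => by
      rw [hG.christoffel_symm hV hy]; ring
  set τ := quadMap y A Q with hτdef
  have hτ0 : τ 0 = y := quadMap_zero y A Q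
  have hτs : ContDiff ℝ ∞ τ := contDiff_quadMap y A Q
  have hJ : ∀ z a i, jac τ z a i = A a i - ∑ l, Q a i l * z l := fun z a i => jac_quadMap y A hQ z a i
  have hJ0 : jac τ 0 = A := by ext a i; simp [hJ]
  -- Only an invertible Jacobian is required of a change of coordinates, so U need not be shrunk to
  -- make the quadratic map injective.
  let U : Set E3 := {z | τ z ∈ V ∧ (jac τ z).det ≠ 0}
  have hJc : Continuous fun z => (jac τ z).det := by
    have : jac τ = fun z => Matrix.of fun a i => A a i - ∑ l, Q a i l * z l := by
      ext z a i; exact hJ z a i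
    rw [this]
    refine Continuous.matrix_det (continuous_matrix fun a i => ?_)
    exact continuous_const.sub (continuous_finsetSum _ fun l _ =>
      continuous_const.mul (contDiff_proj l).continuous)
  have hU : IsOpen U := (hV.preimage hτs.continuous).inter (isOpen_ne.preimage hJc)
  have hτ : ChangeOn τ U V := ⟨hU, hV, hτs.contDiffOn, fun z hz => hz.1, fun z hz => hz.2⟩
  have h0 : (0 : E3) ∈ U := ⟨by rw [hτ0]; exact hy, by rw [hJ0]; exact hA⟩
  let G₁ : MatField := fun z => (jac τ z).transpose * G (τ z) * jac τ z
  let K₁ : MatField := fun z => (jac τ z).transpose * K (τ z) * jac τ z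
  have hG₁ : ∀ z ∈ U, G₁ z = (jac τ z).transpose * G (τ z) * jac τ z := fun _ _ => rfl
  have hK₁ : ∀ z ∈ U, K₁ z = (jac τ z).transpose * K (τ z) * jac τ z := fun _ _ => rfl
  have mG₁ := hτ.metricOn hG hG₁
  have sK₁ : SmoothMat K₁ U := (hτ.smooth_jac.transpose.mul (hτ.smoothMat_comp hK)).mul hτ.smooth_jac
  have hconn : ∀ l, conn G₁ l 0 = 0 := by
    intro l
    have h1 := hτ.jac_mul_conn hG hG₁ h0 l
    have h2 : mpd l (jac τ) 0 + ChangeOn.pullConn τ G l 0 * jac τ 0 = 0 := by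
      ext a j
      have dp : ∀ j, DifferentiableAt ℝ (fun w : E3 => w j) 0 := fun j =>
        (contDiff_proj j).differentiable (by simp) 0
      have e1 : mpd l (jac τ) 0 a j = -Q a j l := by
        have : (fun z => jac τ z a j) = fun z => A a j - ∑ l, Q a j l * z l := by
          ext z; exact hJ z a j
        simp only [mpd, Matrix.of_apply, this]
        rw [pd_sub (differentiableAt_const _) (DifferentiableAt.fun_sum fun l _ =>
            (differentiableAt_const _).fun_mul (dp l)), pd_const,
          pd_sum fun l _ => (differentiableAt_const _).fun_mul (dp l)]
        simp only [pd_mul (differentiableAt_const _) (dp _), pd_const, pd_proj]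
        simp
      rw [Matrix.add_apply, e1, hQ]
      simp only [ChangeOn.pullConn, hJ0, hτ0, Matrix.mul_apply, Matrix.sum_apply, Matrix.smul_apply,
        conn, Matrix.of_apply, smul_eq_mul, Finset.sum_mul, Q]
      rw [Finset.sum_comm]
      simp only [Matrix.zero_apply, neg_add_eq_zero]
      exact Finset.sum_congr rfl fun c _ => Finset.sum_congr rfl fun b _ => by ring
    rw [h2] at h1
    calc conn G₁ l 0 = (jac τ 0)⁻¹ * (jac τ 0 * conn G₁ l 0) := by
          rw [← Matrix.mul_assoc, Matrix.nonsing_inv_mul _ (hτ.isUnit_det h0), Matrix.one_mul]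
      _ = 0 := by rw [h1, Matrix.mul_zero]
  have n : NormalAt G₁ (fun z => F (τ z)) (fun z => Φ (τ z)) U 0 := by
    refine ⟨mG₁, hU, hτ.smooth_comp hF, hτ.smooth_comp hΦ, fun z hz => hpos _ hz.1, h0, ?_, ?_, ?_⟩
    · change (jac τ 0).transpose * G (τ 0) * jac τ 0 = 1
      rw [hJ0, hτ0, hA1]
    · intro l i j
      have := mG₁.mpd_eq hU h0 l
      rw [hconn, Matrix.transpose_zero, Matrix.zero_mul, Matrix.mul_zero, add_zero] at this
      exact congrFun (congrFun this i) j
    · intro i hi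
      rw [hτ.pd_comp hF h0, hJ0, hτ0]
      exact hA2 i hi
  have mb := hG.gbarC_metricOn hV hF hΦ
  have hgb : ∀ z ∈ U, gbarC G₁ (fun z => F (τ z)) (fun z => Φ (τ z)) z =
      (jac τ z).transpose * gbarC G F Φ (τ z) * jac τ z := fun z hz => hτ.gbarC_eq hF hz (hG₁ z hz)
  have hs : ∀ z ∈ U, (fun w => hC G₁ (fun z => F (τ z)) (fun z => Φ (τ z)) w - K₁ w) z =
      (jac τ z).transpose * (fun w => hC G F Φ w - K w) (τ z) * jac τ z := fun z hz => by
    simp only [hτ.hC_eq hG hF hΦ hG₁ hz, hK₁ z hz, Matrix.mul_sub, Matrix.sub_mul]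
  have key := n.schoenYau sK₁ (fun z hz i j => by
      have h1 : (K (τ z)).transpose = K (τ z) := by ext a b; exact hKs _ hz.1 b a
      have h2 : (K₁ z).transpose = K₁ z := by
        simp only [K₁, Matrix.transpose_mul, Matrix.transpose_transpose, h1, Matrix.mul_assoc]
      exact congrFun (congrFun h2 j) i)
    (fun z hz => (hτ.traceC_eq (S' := fun w => hC G F Φ w - K w) hz (hgb z hz) (hs z hz)).trans
      (htr _ hz.1))
  have hflux := fun z hz j => hτ.fluxC_eq hG hF hΦ hG₁ (z := z) hz (hK₁ z hz) j
  have htrK : ∀ z ∈ U, traceC G₁ K₁ z = traceC G K (τ z) := fun z hz =>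
    hτ.traceC_eq hz (hG₁ z hz) (hK₁ z hz)
  have hSS : ∀ z ∈ U, (fun z => K₁ z - traceC G₁ K₁ z • G₁ z) z = (jac τ z).transpose *
      (fun z => K z - traceC G K z • G z) (τ z) * jac τ z := fun z hz => by
    simp only [htrK z hz, hK₁ z hz, hG₁ z hz, Matrix.mul_sub, Matrix.sub_mul, Matrix.mul_smul,
      Matrix.smul_mul]
  have sS : SmoothMat (fun z => K z - traceC G K z • G z) V := fun i j =>
    (hK i j).sub ((ContDiffOn.sum fun a _ => ContDiffOn.sum fun b _ =>
      (hG.smooth_inv a b).mul (hK a b)).mul (hG.smooth i j))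
  have hdot : ∑ j, vC G₁ (fun z => F (τ z)) (fun z => Φ (τ z)) 0 j *
      divC G₁ (fun z => K₁ z - traceC G₁ K₁ z • G₁ z) j 0 =
      ∑ j, vC G F Φ (τ 0) j * divC G (fun z => K z - traceC G K z • G z) j (τ 0) := by
    simp only [hτ.divC_eq hG hG₁ sS hSS h0, hτ.vC_eq hF h0 (hG₁ 0 h0), Fin.sum_univ_three]
    ring
  have hqq := contract_pull (G' := gbarC G F Φ (τ 0)) (hτ.isUnit_det h0)
    (Matrix.of fun i j => fluxC G K F Φ (τ 0) i * fluxC G K F Φ (τ 0) j)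
  rw [← hgb 0 h0] at hqq
  have hqq' : ∀ i j, fluxC G₁ K₁ (fun z => F (τ z)) (fun z => Φ (τ z)) 0 i *
      fluxC G₁ K₁ (fun z => F (τ z)) (fun z => Φ (τ z)) 0 j = ((jac τ 0).transpose *
      (Matrix.of fun i j => fluxC G K F Φ (τ 0) i * fluxC G K F Φ (τ 0) j) * jac τ 0) i j := by
    intro i j
    simp only [hflux 0 h0, Matrix.mul_apply, Matrix.transpose_apply, Matrix.of_apply,
      Fin.sum_univ_three]
    ring
  simp only [SchoenYauAt, hqq'] at key
  rw [hqq, hdot, htrK 0 h0, hτ.normSqC_eq h0 (hG₁ 0 h0) (hK₁ 0 h0),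
    hτ.normSqC_eq (S' := fun w => hC G F Φ w - K w) h0 (hgb 0 h0) (hs 0 h0), hτ.scalarC_eq hG hG₁ h0, hτ.scalarC_eq mb hgb h0,
    hτ.codivC_eq mb hgb (fun a => hG.smooth_fluxC hV hF hΦ hK a) hflux h0, hτ0] at key
  exact key

end JangEH

namespace JangEH

/-! ### Signs -/

/-- With P = Bᵀ B the trace is the sum of the squares of the entries of B K Bᵀ. -/
theorem trace_mul_mul_nonneg {P : Matrix (Fin 3) (Fin 3) ℝ} (hP : P.PosDef)
    (K : Matrix (Fin 3) (Fin 3) ℝ) : 0 ≤ (P * K * P.transpose * K.transpose).trace := by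
  obtain ⟨B, -, rfl⟩ := posDef_eq_transpose_mul hP
  have : (B.transpose * B * K * (B.transpose * B).transpose * K.transpose).trace =
      ((B * K * B.transpose) * (B * K * B.transpose).transpose).trace := by
    simp only [Matrix.transpose_mul, Matrix.transpose_transpose, Matrix.mul_assoc]
    rw [Matrix.trace_mul_comm B.transpose]
    simp only [Matrix.mul_assoc]
  rw [this, ← sum_mul_eq_trace]
  exact Finset.sum_nonneg fun i _ => Finset.sum_nonneg fun j _ => mul_self_nonneg _

theorem posDef_cauchy_schwarz {P : Matrix (Fin 3) (Fin 3) ℝ} (hP : P.PosDef) (x w : Fin 3 → ℝ) :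
    (∑ i, ∑ j, P i j * (x i * w j)) ^ 2 ≤
      (∑ i, ∑ j, P i j * (x i * x j)) * ∑ i, ∑ j, P i j * (w i * w j) := by
  obtain ⟨B, -, rfl⟩ := posDef_eq_transpose_mul hP
  have e : ∀ a b : Fin 3 → ℝ, ∑ i, ∑ j, (B.transpose * B) i j * (a i * b j) =
      ∑ k, (∑ i, B k i * a i) * (∑ j, B k j * b j) := by
    intro a b
    simp only [Matrix.mul_apply, Matrix.transpose_apply, Fin.sum_univ_three]
    ring
  rw [e, e, e]
  simpa only [pow_two] using Finset.sum_mul_sq_le_sq_mul_sq Finset.univ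
    (fun k => ∑ i, B k i * x i) (fun k => ∑ j, B k j * w j)

theorem posDef_quadratic_nonneg {P : Matrix (Fin 3) (Fin 3) ℝ} (hP : P.PosDef) (x : Fin 3 → ℝ) :
    0 ≤ ∑ i, ∑ j, P i j * (x i * x j) := by
  have := hP.posSemidef.dotProduct_mulVec_nonneg x
  simp only [dotProduct, Matrix.mulVec, Fin.sum_univ_three, star_trivial] at this ⊢
  linarith

/-- Cauchy–Schwarz together with |v|² = φ²|df|² / (1 + φ²|df|²) ≤ 1. -/
theorem MetricOn.sum_vC_mul_le {G : MatField} {F Φ : E3 → ℝ} {U : Set E3} (hG : MetricOn G U)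
    {y : E3} (hy : y ∈ U) (w : Fin 3 → ℝ) :
    ∑ j, vC G F Φ y j * w j ≤ Real.sqrt (∑ i, ∑ j, (G y)⁻¹ i j * (w i * w j)) := by
  have hP := (hG.posDef y hy).inv
  have h0 := posDef_quadratic_nonneg hP w
  have hu := hG.lapC_pos (F := F) (Φ := Φ) hy
  have hu2 := hG.lapC_sq (F := F) (Φ := Φ) hy
  refine Real.le_sqrt_of_sq_le ?_
  have h1 := posDef_cauchy_schwarz hP (fun i => pd i F y) w
  have h2 : ∑ i, ∑ j, (G y)⁻¹ i j * (pd i F y * pd j F y) = dnC G F y := by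
    simp only [dnC, Fin.sum_univ_three]; ring
  have h3 : ∑ j, vC G F Φ y j * w j = Φ y / lapC G F Φ y *
      ∑ i, ∑ j, (G y)⁻¹ i j * (pd i F y * w j) := by
    simp only [vC, Fin.sum_univ_three, hG.inv_symm hy 1 0, hG.inv_symm hy 2 0,
      hG.inv_symm hy 2 1]
    ring
  rw [h2] at h1
  set S := ∑ i, ∑ j, (G y)⁻¹ i j * (w i * w j)
  rw [h3, mul_pow, div_pow]
  calc Φ y ^ 2 / lapC G F Φ y ^ 2 * (∑ i, ∑ j, (G y)⁻¹ i j * (pd i F y * w j)) ^ 2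
      ≤ Φ y ^ 2 / lapC G F Φ y ^ 2 * (dnC G F y * S) := by gcongr
    _ = (Φ y ^ 2 * dnC G F y) / lapC G F Φ y ^ 2 * S := by ring
    _ ≤ 1 * S := by
        gcongr
        rw [div_le_one (by positivity), hu2]
        linarith
    _ = S := one_mul S

/-- In the Schoen–Yau identity the energy condition dominates the pairing of v with the momentum
density, and the other two terms are squared norms for the positive form ḡ⁻¹. -/
theorem scalarC_add_codivC_nonneg {G K : MatField} {F Φ : E3 → ℝ} {V : Set E3} (hG : MetricOn G V)
    (hV : IsOpen V) (hF : ContDiffOn ℝ ∞ F V) (hΦ : ContDiffOn ℝ ∞ Φ V) (hpos : ∀ z ∈ V, 0 < Φ z)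
    (hK : SmoothMat K V) (hKs : ∀ z ∈ V, ∀ i j, K z i j = K z j i)
    (htr : ∀ z ∈ V, traceC (gbarC G F Φ) (fun w => hC G F Φ w - K w) z = 0) {y : E3} (hy : y ∈ V)
    (hμ : Real.sqrt (∑ i, ∑ j, (G y)⁻¹ i j *
        (divC G (fun z => K z - traceC G K z • G z) i y / (8 * Real.pi)) *
        (divC G (fun z => K z - traceC G K z • G z) j y / (8 * Real.pi))) ≤
      (scalarC G y + traceC G K y ^ 2 - normSqC G K y) / (16 * Real.pi)) :
    0 ≤ Φ y * scalarC (gbarC G F Φ) y + 2 * codivC (gbarC G F Φ) (fluxC G K F Φ) y := by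
  have key := schoenYauAt hG hV hF hΦ hpos hK hKs htr hy
  have mb := hG.gbarC_metricOn hV hF hΦ
  have hp := hpos y hy
  set w : Fin 3 → ℝ := fun j => divC G (fun z => K z - traceC G K z • G z) j y with hw
  have h1 := hG.sum_vC_mul_le (F := F) (Φ := Φ) hy w
  have hpi := Real.pi_pos
  have h2 : ∑ i, ∑ j, (G y)⁻¹ i j * (w i / (8 * Real.pi)) * (w j / (8 * Real.pi)) =
      (∑ i, ∑ j, (G y)⁻¹ i j * (w i * w j)) / (8 * Real.pi) ^ 2 := by
    rw [Finset.sum_div]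
    refine Finset.sum_congr rfl fun i _ => ?_
    rw [Finset.sum_div]
    exact Finset.sum_congr rfl fun j _ => by ring
  rw [h2, Real.sqrt_div' _ (by positivity), Real.sqrt_sq (by positivity),
    div_le_div_iff₀ (by positivity) (by positivity)] at hμ
  set S := Real.sqrt (∑ i, ∑ j, (G y)⁻¹ i j * (w i * w j))
  -- The factor 2 is the quotient of the normalizations 16π of μ and 8π of J; it matches the factor
  -- of the momentum term in the identity.
  have h3 : 2 * S ≤ scalarC G y + traceC G K y ^ 2 - normSqC G K y := by
    have : 2 * S * (8 * Real.pi) ≤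
        (scalarC G y + traceC G K y ^ 2 - normSqC G K y) * (8 * Real.pi) := by linarith
    exact le_of_mul_le_mul_right this (by positivity)
  have h4 : 0 ≤ normSqC (gbarC G F Φ) (fun z => hC G F Φ z - K z) y := by
    rw [normSqC_eq_trace]
    exact trace_mul_mul_nonneg (mb.posDef y hy).inv _
  have h5 := posDef_quadratic_nonneg (mb.posDef y hy).inv (fluxC G K F Φ y)
  rw [SchoenYauAt] at key
  rw [key]
  have h6 : 0 ≤ scalarC G y + traceC G K y ^ 2 - normSqC G K y -
      2 * ∑ j, vC G F Φ y j * w j +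
      normSqC (gbarC G F Φ) (fun z => hC G F Φ z - K z) y := by linarith
  exact add_nonneg (mul_nonneg hp.le h6) (mul_nonneg (by positivity) h5)

/-! ### The divergence in coordinates -/

/-- Jacobi's formula, by expansion of the 3 × 3 determinant. -/
theorem pd_det {A : MatField} {y : E3} (hA : ∀ i j, DifferentiableAt ℝ (fun z => A z i j) y)
    (l : Fin 3) : pd l (fun z => (A z).det) y = ((A y).adjugate * mpd l A y).trace := by
  simp only [Matrix.det_fin_three]
  have d2 := fun a b c d => (hA a b).fun_mul (hA c d)
  have d3 := fun a b c d e f => (d2 a b c d).fun_mul (hA e f)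
  have p3 : ∀ a b c d e f, pd l (fun z => A z a b * A z c d * A z e f) y =
      (pd l (fun z => A z a b) y * A y c d + A y a b * pd l (fun z => A z c d) y) * A y e f +
        A y a b * A y c d * pd l (fun z => A z e f) y := fun a b c d e f => by
    rw [pd_mul (d2 a b c d) (hA e f), pd_mul (hA a b) (hA c d)]
  rw [pd_sub (((((d3 _ _ _ _ _ _).fun_sub (d3 _ _ _ _ _ _)).fun_sub (d3 _ _ _ _ _ _)).fun_add
      (d3 _ _ _ _ _ _)).fun_add (d3 _ _ _ _ _ _)) (d3 _ _ _ _ _ _),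
    pd_add ((((d3 _ _ _ _ _ _).fun_sub (d3 _ _ _ _ _ _)).fun_sub (d3 _ _ _ _ _ _)).fun_add
      (d3 _ _ _ _ _ _)) (d3 _ _ _ _ _ _),
    pd_add (((d3 _ _ _ _ _ _).fun_sub (d3 _ _ _ _ _ _)).fun_sub (d3 _ _ _ _ _ _))
      (d3 _ _ _ _ _ _),
    pd_sub ((d3 _ _ _ _ _ _).fun_sub (d3 _ _ _ _ _ _)) (d3 _ _ _ _ _ _),
    pd_sub (d3 _ _ _ _ _ _) (d3 _ _ _ _ _ _), p3, p3, p3, p3, p3, p3]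
  simp [Matrix.trace, Fin.sum_univ_three, Matrix.adjugate_fin_three, mpd, Matrix.vecHead,
    Matrix.vecTail]
  ring

namespace MetricOn

variable {G : MatField} {U : Set E3}

/-- By metric compatibility the trace of G⁻¹ ∂ₗG is twice the trace of the connection matrix, and
the square root halves it. -/
theorem pd_sqrt_det (hG : MetricOn G U) (hU : IsOpen U) {y : E3} (hy : y ∈ U) (l : Fin 3) :
    pd l (fun z => Real.sqrt (G z).det) y =
      Real.sqrt (G y).det * ∑ m, christoffel G m l m y := by
  have hd := hG.det_pos hy
  have hs := Real.sqrt_pos.2 hd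
  have e1 : ((G y).adjugate * mpd l G y).trace = (G y).det * (2 * ∑ m, christoffel G m l m y) := by
    have h1 : (G y).adjugate = (G y).det • (G y)⁻¹ := by
      rw [Matrix.inv_def, smul_smul, Ring.mul_inverse_cancel _ (hG.isUnit_det hy), one_smul]
    have h2 : (conn G l y).trace = ∑ m, christoffel G m l m y := rfl
    have h3 : ((G y)⁻¹ * ((conn G l y).transpose * G y)).trace = (conn G l y).trace := by
      rw [Matrix.trace_mul_comm, Matrix.mul_assoc, hG.mul_inv hy, Matrix.mul_one,
        Matrix.trace_transpose]
    rw [h1, hG.mpd_eq hU hy, Matrix.smul_mul, Matrix.trace_smul, Matrix.mul_add, Matrix.trace_add,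
      ← Matrix.mul_assoc _ (G y), hG.inv_mul hy, Matrix.one_mul, h3, h2, smul_eq_mul]
    ring
  rw [pd_sqrt (diffAt_of_contDiffOn hU hG.smooth.det hy) hd,
    pd_det (fun i j => diffAt_of_contDiffOn hU (hG.smooth i j) hy), e1]
  have h4 : (G y).det = Real.sqrt (G y).det * Real.sqrt (G y).det := (Real.mul_self_sqrt hd.le).symm
  rw [div_eq_iff (by positivity)]
  nth_rewrite 1 [h4]
  ring

theorem mpd_inv (hG : MetricOn G U) (hU : IsOpen U) {y : E3} (hy : y ∈ U) (l : Fin 3) :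
    mpd l (fun z => (G z)⁻¹) y =
      -((G y)⁻¹ * (conn G l y).transpose + conn G l y * (G y)⁻¹) := by
  have h1 := mpd_mul hU hG.smooth hG.smooth_inv hy l
  have h2 : mpd l (fun z => G z * (G z)⁻¹) y = 0 := by
    rw [mpd_congr_on hU (B := fun _ => 1) (fun z hz => hG.mul_inv hz) hy]
    ext a b
    exact pd_const _ _ _
  rw [h2, hG.mpd_eq hU hy] at h1
  have h3 : G y * mpd l (fun z => (G z)⁻¹) y =
      -(((conn G l y).transpose * G y + G y * conn G l y) * (G y)⁻¹) := by
    rw [eq_neg_iff_add_eq_zero, add_comm]; exact h1.symm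
  calc mpd l (fun z => (G z)⁻¹) y = (G y)⁻¹ * (G y * mpd l (fun z => (G z)⁻¹) y) := by
        rw [← Matrix.mul_assoc, hG.inv_mul hy, Matrix.one_mul]
    _ = -((G y)⁻¹ * (conn G l y).transpose * (G y * (G y)⁻¹) +
          ((G y)⁻¹ * G y) * conn G l y * (G y)⁻¹) := by rw [h3]; noncomm_ring
    _ = _ := by rw [hG.mul_inv hy, hG.inv_mul hy, Matrix.mul_one, Matrix.one_mul]

/-- The divergence of a covector field in terms of the volume density. -/
theorem sqrt_det_mul_codivC (hG : MetricOn G U) (hU : IsOpen U) {α : E3 → Fin 3 → ℝ}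
    (hα : ∀ j, DifferentiableOn ℝ (fun z => α z j) U) {y : E3} (hy : y ∈ U) :
    ∑ i, pd i (fun z => Real.sqrt (G z).det * ∑ j, (G z)⁻¹ i j * α z j) y =
      Real.sqrt (G y).det * codivC G α y := by
  have dα := fun j => (hα j).differentiableAt (hU.mem_nhds hy)
  have dI := fun i j => diffAt_of_contDiffOn hU (hG.smooth_inv i j) hy
  have dS : DifferentiableAt ℝ (fun z => Real.sqrt (G z).det) y :=
    (diffAt_of_contDiffOn hU hG.smooth.det hy).sqrt (hG.det_pos hy).ne'
  have e1 : ∀ i, pd i (fun z => Real.sqrt (G z).det * ∑ j, (G z)⁻¹ i j * α z j) y =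
      Real.sqrt (G y).det * ((∑ m, christoffel G m i m y) * (∑ j, (G y)⁻¹ i j * α y j) +
        ∑ j, (-(∑ m, (G y)⁻¹ i m * christoffel G j i m y +
          ∑ m, christoffel G i i m y * (G y)⁻¹ m j) * α y j +
          (G y)⁻¹ i j * pd i (fun z => α z j) y)) := by
    intro i
    have e2 : ∀ j, pd i (fun z => (G z)⁻¹ i j) y = -(∑ m, (G y)⁻¹ i m * christoffel G j i m y +
          ∑ m, christoffel G i i m y * (G y)⁻¹ m j) := by
      intro j
      have := congrFun (congrFun (hG.mpd_inv hU hy i) i) j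
      simpa only [mpd, Matrix.of_apply, Matrix.neg_apply, Matrix.add_apply, Matrix.mul_apply, conn,
        Matrix.transpose_apply] using this
    rw [pd_mul dS (DifferentiableAt.fun_sum fun j _ => (dI i j).fun_mul (dα j)),
      hG.pd_sqrt_det hU hy, pd_sum fun j _ => (dI i j).fun_mul (dα j)]
    simp only [pd_mul (dI i _) (dα _), e2]
    ring
  simp only [e1, codivC, covC, Matrix.of_apply, ← Finset.mul_sum]
  congr 1
  have s := hG.christoffel_symm hU hy
  simp only [Fin.sum_univ_three, s 0 1 0, s 0 2 0, s 1 1 0, s 1 2 1, s 2 2 0, s 2 2 1, s 0 2 1,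
    s 1 2 0, s 2 1 0]
  ring

end MetricOn

end JangEH

namespace JangEH

/-! ### The divergence theorem on a half-space -/

theorem pd_eq_zero_of_notMem_tsupport {F : E3 → ℝ} {y : E3} (hy : y ∉ tsupport F) (i : Fin 3) :
    pd i F y = 0 := by
  have : F =ᶠ[𝓝 y] fun _ => 0 := notMem_tsupport_iff_eventuallyEq.1 hy
  rw [pd_congr this, pd_const]

theorem continuous_pd {F : E3 → ℝ} (hF : ContDiff ℝ 1 F) (i : Fin 3) : Continuous (pd i F) :=
  (hF.continuous_fderiv (by simp)).clm_apply continuous_const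

/-- The divergence theorem on the half-space `x₂ < 0` for compactly supported vector fields. -/
theorem integral_divergence_halfSpace {F : Fin 3 → E3 → ℝ} (hF : ∀ i, ContDiff ℝ 1 (F i))
    (hc : ∀ i, HasCompactSupport (F i)) :
    ∫ x in {x : E3 | x 2 < 0}, ∑ i, pd i (F i) x =
      ∫ y : EuclideanSpace ℝ (Fin 2), F 2 (planeIncl y) := by
  obtain ⟨R, hR0, hR⟩ : ∃ R : ℝ, 0 < R ∧ ∀ i, tsupport (F i) ⊆ Metric.ball 0 R := by
    have hb : Bornology.IsBounded (⋃ i, tsupport (F i)) :=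
      (isCompact_iUnion fun i => hc i).isBounded
    obtain ⟨R, hR0, hR⟩ := hb.subset_ball_lt 0 (0 : E3)
    exact ⟨R, hR0, fun i => (subset_iUnion _ i).trans hR⟩
  have hout : ∀ (i : Fin 3) (x : Fin 3 → ℝ) (j : Fin 3), R ≤ |x j| →
      WithLp.toLp 2 x ∉ tsupport (F i) := by
    intro i x j hj hx
    have h1 := hR i hx
    rw [mem_ball_zero_iff] at h1
    have h2 : |x j| ≤ ‖(WithLp.toLp 2 x : E3)‖ := by
      have := PiLp.norm_apply_le (WithLp.toLp 2 x : E3) j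
      simpa using this
    linarith
  have hF0 : ∀ (i : Fin 3) (x : Fin 3 → ℝ) (j : Fin 3), R ≤ |x j| → F i (WithLp.toLp 2 x) = 0 :=
    fun i x j hj => image_eq_zero_of_notMem_tsupport (hout i x j hj)
  set D : E3 → ℝ := fun x => ∑ i, pd i (F i) x with hD
  have hDc : Continuous D := continuous_finsetSum _ fun i _ => continuous_pd (hF i) i
  have hD0 : ∀ (x : Fin 3 → ℝ) (j : Fin 3), R ≤ |x j| → D (WithLp.toLp 2 x) = 0 :=
    fun x j hj => Finset.sum_eq_zero fun i _ =>
      pd_eq_zero_of_notMem_tsupport (hout i x j hj) i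
  have htoLp : Continuous (fun x : Fin 3 → ℝ => (WithLp.toLp 2 x : E3)) :=
    PiLp.continuous_toLp 2 _
  -- The box has its top face in the plane x₂ = 0, and its other five faces lie outside the
  -- supports; only the top face contributes to the divergence theorem.
  set a : Fin 3 → ℝ := ![-R, -R, -R]
  set b : Fin 3 → ℝ := ![R, R, 0]
  have hle : a ≤ b := by
    intro i; fin_cases i <;> simp [a, b] <;> linarith
  have hder : ∀ (i : Fin 3) (x : Fin 3 → ℝ), HasFDerivAt (fun x : Fin 3 → ℝ => F i (WithLp.toLp 2 x))
      ((fderiv ℝ (F i) (WithLp.toLp 2 x)).comp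
        (PiLp.continuousLinearEquiv 2 ℝ (fun _ : Fin 3 => ℝ)).symm.toContinuousLinearMap) x := by
    intro i x
    exact ((hF i).differentiable (by simp) _).hasFDerivAt.comp x
      (PiLp.continuousLinearEquiv 2 ℝ (fun _ : Fin 3 => ℝ)).symm.hasFDerivAt
  have hsum : ∀ x : Fin 3 → ℝ, ∑ i, ((fderiv ℝ (F i) (WithLp.toLp 2 x)).comp
        (PiLp.continuousLinearEquiv 2 ℝ (fun _ : Fin 3 => ℝ)).symm.toContinuousLinearMap)
          (Pi.single i 1) = D (WithLp.toLp 2 x) := by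
    intro x
    rfl
  have main := integral_divergence_of_hasFDerivAt_off_countable' (n := 2) a b hle
    (fun i x => F i (WithLp.toLp 2 x)) _ ∅ countable_empty
    (fun i => ((hF i).continuous.comp htoLp).continuousOn) (fun x _ i => hder i x)
    (by
      simp only [hsum]
      exact ((hDc.comp htoLp).continuousOn).integrableOn_compact isCompact_Icc)
  simp only [hsum] at main
  -- the left-hand side
  have hL : ∫ x in {x : E3 | x 2 < 0}, D x = ∫ x in Icc a b, D (WithLp.toLp 2 x) := by
    have h1 := (PiLp.volume_preserving_toLp (Fin 3)).setIntegral_preimage_emb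
      (MeasurableEquiv.toLp 2 (Fin 3 → ℝ)).measurableEmbedding D {x : E3 | x 2 < 0}
    -- The open box differs from the closed one by a null set and, unlike the closed box, is
    -- contained in the open half-space.
    have h2 : (Set.univ.pi fun i => Ioo (a i) (b i)) =ᵐ[(volume : Measure (Fin 3 → ℝ))] Icc a b :=
      Measure.univ_pi_Ioo_ae_eq_Icc (μ := fun _ => volume)
    rw [← h1, ← setIntegral_congr_set h2]
    refine setIntegral_eq_of_subset_of_forall_sdiff_eq_zero ?_ ?_ ?_
    · exact (isOpen_lt (f := fun x : Fin 3 → ℝ => x 2) (continuous_apply 2)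
        continuous_const).measurableSet
    · intro x hx
      exact (hx 2 trivial).2
    · rintro x ⟨hx, hx'⟩
      by_contra hne
      apply hx'
      have hlt : ∀ j, |x j| < R := fun j => by
        by_contra h; exact hne (hD0 x j (not_lt.1 h))
      intro j _
      have := abs_lt.1 (hlt j)
      have hx2 : x 2 < 0 := hx
      fin_cases j
      · exact this
      · exact this
      · exact ⟨this.1, hx2⟩
  rw [hL, main, Fin.sum_univ_three]
  have hz : ∀ (i : Fin 3) (c : ℝ), R ≤ |c| → ∀ x : Fin 2 → ℝ,
      F i (WithLp.toLp 2 (i.insertNth c x)) = 0 := by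
    intro i c h x
    refine hF0 i _ i ?_
    simpa using h
  have hRR : R ≤ |R| := le_abs_self R
  have hRR' : R ≤ |-R| := by rw [abs_neg]; exact hRR
  have e0 : ∀ x : Fin 2 → ℝ, F 0 (WithLp.toLp 2 ((0 : Fin 3).insertNth (b 0) x)) = 0 := hz 0 R hRR
  have e1 : ∀ x : Fin 2 → ℝ, F 1 (WithLp.toLp 2 ((1 : Fin 3).insertNth (b 1) x)) = 0 := hz 1 R hRR
  have e0' : ∀ x : Fin 2 → ℝ, F 0 (WithLp.toLp 2 ((0 : Fin 3).insertNth (a 0) x)) = 0 := hz 0 _ hRR'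
  have e1' : ∀ x : Fin 2 → ℝ, F 1 (WithLp.toLp 2 ((1 : Fin 3).insertNth (a 1) x)) = 0 := hz 1 _ hRR'
  have e2' : ∀ x : Fin 2 → ℝ, F 2 (WithLp.toLp 2 ((2 : Fin 3).insertNth (a 2) x)) = 0 := hz 2 _ hRR'
  simp only [e0, e1, e0', e1', e2', integral_zero, sub_zero, zero_add]
  have hpl : ∀ x : Fin 2 → ℝ, (WithLp.toLp 2 ((2 : Fin 3).insertNth (b 2) x) : E3) =
      planeIncl (WithLp.toLp 2 x) := by
    intro x
    ext j
    fin_cases j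
    · exact Fin.insertNth_apply_succAbove (α := fun _ => ℝ) (2 : Fin 3) (b 2) x 0
    · exact Fin.insertNth_apply_succAbove (α := fun _ => ℝ) (2 : Fin 3) (b 2) x 1
    · exact Fin.insertNth_apply_same (α := fun _ => ℝ) (2 : Fin 3) (b 2) x
  simp only [hpl]
  have h2 := (PiLp.volume_preserving_toLp (Fin 2)).integral_comp
      (MeasurableEquiv.toLp 2 (Fin 2 → ℝ)).measurableEmbedding (fun y => F 2 (planeIncl y))
  rw [← h2]
  refine setIntegral_eq_integral_of_forall_compl_eq_zero fun x hx => ?_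
  by_contra hne
  apply hx
  rw [← hpl] at hne
  have hlt : ∀ j : Fin 2, |x j| < R := fun j => by
    by_contra h
    refine hne (hF0 2 _ ((2 : Fin 3).succAbove j) ?_)
    simpa using h
  rw [mem_Icc, Pi.le_def, Pi.le_def]
  have h0 := abs_lt.1 (hlt 0)
  have h1 := abs_lt.1 (hlt 1)
  constructor <;> intro j <;> fin_cases j
  · exact h0.1.le
  · exact h1.1.le
  · exact h0.2.le
  · exact h1.2.le

end JangEH

namespace JangEH

variable {M : Type*} [TopologicalSpace M] [ChartedSpace (EuclideanHalfSpace 3) M]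

/-! ### Coordinate charts of the interior and their transition maps -/

section Charts

variable [IsManifold (𝓡∂ 3) ∞ M]

theorem isOpen_interior_manifold : IsOpen ((𝓡∂ 3).interior M) :=
  ModelWithCorners.isOpen_interior (n := ∞) (by simp)

/-- The preferred chart at `p`, restricted to the interior of `M`. -/
noncomputable def ichart (p : M) : OpenPartialHomeomorph M E3 where
  -- Map and inverse are those of the preferred chart, unrestricted; only source and target shrink.
  -- Hence expressions in the preferred chart are by definition expressions in this chart.
  toFun := extChartAt (𝓡∂ 3) p
  invFun := (extChartAt (𝓡∂ 3) p).symm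
  source := (chartAt (EuclideanHalfSpace 3) p).source ∩ (𝓡∂ 3).interior M
  target := interior (extChartAt (𝓡∂ 3) p).target
  map_source' := fun q hq =>
    ((𝓡∂ 3).isInteriorPoint_iff_of_mem_atlas (n := ∞) (by simp)
      (chart_mem_atlas (EuclideanHalfSpace 3) p) hq.1).1 hq.2
  map_target' := fun y hy => by
    have h1 : (extChartAt (𝓡∂ 3) p).symm y ∈ (chartAt (EuclideanHalfSpace 3) p).source := by
      rw [← extChartAt_source (𝓡∂ 3)]
      exact (extChartAt (𝓡∂ 3) p).map_target (interior_subset hy)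
    refine ⟨h1, ((𝓡∂ 3).isInteriorPoint_iff_of_mem_atlas (n := ∞) (by simp)
      (chart_mem_atlas (EuclideanHalfSpace 3) p) h1).2 ?_⟩
    have h2 := (extChartAt (𝓡∂ 3) p).right_inv (interior_subset hy)
    change extChartAt (𝓡∂ 3) p ((extChartAt (𝓡∂ 3) p).symm y) ∈ interior (extChartAt (𝓡∂ 3) p).target
    rwa [h2]
  left_inv' := fun q hq => (extChartAt (𝓡∂ 3) p).left_inv (by rw [extChartAt_source]; exact hq.1)
  right_inv' := fun y hy => (extChartAt (𝓡∂ 3) p).right_inv (interior_subset hy)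
  open_source := (chartAt (EuclideanHalfSpace 3) p).open_source.inter isOpen_interior_manifold
  open_target := isOpen_interior
  continuousOn_toFun := (continuousOn_extChartAt p).mono (by
    rw [extChartAt_source]; exact inter_subset_left)
  continuousOn_invFun := (continuousOn_extChartAt_symm p).mono interior_subset

theorem isCoordChart_ichart (p : M) : IsCoordChart (ichart p) where
  source_subset := inter_subset_right
  smooth := (contMDiffOn_extChartAt (I := 𝓡∂ 3) (n := ∞) (x := p)).mono inter_subset_left
  smooth_symm := (contMDiffOn_extChartAt_symm (I := 𝓡∂ 3) (n := ∞) p).mono interior_subset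

theorem mem_ichart_source {p : M} (hp : p ∈ (𝓡∂ 3).interior M) : p ∈ (ichart p).source :=
  ⟨mem_chart_source _ p, hp⟩

end Charts

theorem fderiv_basisVec_eq_sum {τ : E3 → E3} {y : E3} (h : DifferentiableAt ℝ τ y) (i : Fin 3) :
    fderiv ℝ τ y (basisVec i) = ∑ a, jac τ y a i • basisVec a := by
  rw [eq_sum_basisVec (fderiv ℝ τ y (basisVec i))]
  refine Finset.sum_congr rfl fun a _ => ?_
  congr 1
  exact (pd_coord h i a).symm

/-- The differential of the inverse of a coordinate chart, as a map between model spaces. -/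
noncomputable def dsymm (e : OpenPartialHomeomorph M E3) (y : E3) : E3 →L[ℝ] E3 :=
  mfderiv 𝓘(ℝ, E3) (𝓡∂ 3) e.symm y

/-- The coordinate vectors, as elements of the model space. -/
noncomputable def cvec (e : OpenPartialHomeomorph M E3) (y : E3) (i : Fin 3) : E3 :=
  coordVec e.toPartialEquiv y i

/-- The values of a 2-tensor, as functions on the model space. -/
def tval (T : Tensor2 M) (p : M) (a b : E3) : ℝ := T p a b

theorem components_apply (T : Tensor2 M) (e : OpenPartialHomeomorph M E3) (y : E3) (i j : Fin 3) :
    components T e.toPartialEquiv y i j = tval T (e.symm y) (cvec e y i) (cvec e y j) := rfl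

theorem cvec_eq (e : OpenPartialHomeomorph M E3) (y : E3) (i : Fin 3) :
    cvec e y i = dsymm e y (basisVec i) := rfl

namespace IsCoordChart

variable {e e' : OpenPartialHomeomorph M E3}

theorem mdifferentiableAt (he : IsCoordChart e) {p : M} (hp : p ∈ e.source) :
    MDifferentiableAt (𝓡∂ 3) 𝓘(ℝ, E3) e p :=
  (he.smooth.contMDiffAt (e.open_source.mem_nhds hp)).mdifferentiableAt (by simp)

theorem mdifferentiableAt_symm (he : IsCoordChart e) {y : E3} (hy : y ∈ e.target) :
    MDifferentiableAt 𝓘(ℝ, E3) (𝓡∂ 3) e.symm y :=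
  (he.smooth_symm.contMDiffAt (e.open_target.mem_nhds hy)).mdifferentiableAt (by simp)

theorem contDiffOn_transition (he : IsCoordChart e) (he' : IsCoordChart e') :
    ContDiffOn ℝ ∞ (e' ∘ e.symm) (e.target ∩ e.symm ⁻¹' e'.source) := by
  rw [← contMDiffOn_iff_contDiffOn]
  exact he'.smooth.comp (he.smooth_symm.mono inter_subset_left) fun y hy => hy.2

/-- Transition maps between coordinate charts are changes of coordinates. -/
theorem changeOn (he : IsCoordChart e) (he' : IsCoordChart e') :
    ChangeOn (e' ∘ e.symm) (e.target ∩ e.symm ⁻¹' e'.source) e'.target where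
  isOpen := e.isOpen_inter_preimage_symm e'.open_source
  isOpen' := e'.open_target
  smooth := he.contDiffOn_transition he'
  mapsTo := fun y hy => e'.map_source hy.2
  det_ne := fun y hy hdet => by
    have ho := e.isOpen_inter_preimage_symm e'.open_source
    have ho' := e'.isOpen_inter_preimage_symm e.open_source
    have hmem : (e' ∘ e.symm) y ∈ e'.target ∩ e'.symm ⁻¹' e.source :=
      ⟨e'.map_source hy.2, by
        simpa [e'.left_inv hy.2] using e.map_target hy.1⟩
    have hd := diffAt_of_contDiffOn ho (he.contDiffOn_transition he') hy
    have hd' := diffAt_of_contDiffOn ho' (he'.contDiffOn_transition he) hmem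
    have hid : (e ∘ e'.symm) ∘ (e' ∘ e.symm) =ᶠ[𝓝 y] id := by
      filter_upwards [ho.mem_nhds hy] with z hz
      simp [e'.left_inv hz.2, e.right_inv hz.1]
    have hcomp : (fderiv ℝ (e ∘ e'.symm) ((e' ∘ e.symm) y)).comp (fderiv ℝ (e' ∘ e.symm) y) =
        ContinuousLinearMap.id ℝ E3 := by
      rw [← fderiv_comp y hd' hd, hid.fderiv_eq, fderiv_id]
    -- A vector in the kernel of the Jacobian would be annihilated by the derivative of the
    -- identity, since the transition map has a differentiable local left inverse.
    obtain ⟨v, hv, hv0⟩ := Matrix.exists_mulVec_eq_zero_iff.2 hdet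
    apply hv
    have h0 : fderiv ℝ (e' ∘ e.symm) y (∑ i, v i • basisVec i) = 0 := by
      simp only [map_sum, map_smul, fderiv_basisVec_eq_sum hd, Finset.smul_sum, smul_smul]
      rw [Finset.sum_comm]
      refine Finset.sum_eq_zero fun a _ => ?_
      rw [← Finset.sum_smul]
      have := congrFun hv0 a
      rw [Matrix.mulVec, dotProduct] at this
      simp only [Pi.zero_apply] at this
      rw [← this.symm.trans (Finset.sum_congr rfl fun i _ => mul_comm _ _), zero_smul]
    have h1 := congrArg (fun L : E3 →L[ℝ] E3 => L (∑ i, v i • basisVec i)) hcomp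
    simp only [ContinuousLinearMap.comp_apply, h0, map_zero, ContinuousLinearMap.id_apply] at h1
    funext i
    have h2 := congrArg (fun x : E3 => x i) h1
    fin_cases i <;> simpa [Fin.sum_univ_three, basisVec] using h2.symm

theorem dsymm_transition (he : IsCoordChart e) (he' : IsCoordChart e') {y : E3}
    (hy : y ∈ e.target ∩ e.symm ⁻¹' e'.source) :
    dsymm e y = (dsymm e' ((e' ∘ e.symm) y)).comp (fderiv ℝ (e' ∘ e.symm) y) := by
  have hτ := he.changeOn he'
  have h1 : e.symm =ᶠ[𝓝 y] e'.symm ∘ (e' ∘ e.symm) := by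
    filter_upwards [hτ.isOpen.mem_nhds hy] with z hz
    exact (e'.left_inv hz.2).symm
  have h3 := mfderiv_comp y (he'.mdifferentiableAt_symm (hτ.mapsTo hy))
      (hτ.diffAt hy).mdifferentiableAt
  have h4 : mfderiv 𝓘(ℝ, E3) 𝓘(ℝ, E3) (e' ∘ e.symm) y = fderiv ℝ (e' ∘ e.symm) y :=
    mfderiv_eq_fderiv
  rw [h4] at h3
  exact h1.mfderiv_eq.trans h3

theorem cvec_transition (he : IsCoordChart e) (he' : IsCoordChart e') {y : E3}
    (hy : y ∈ e.target ∩ e.symm ⁻¹' e'.source) (i : Fin 3) :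
    cvec e y i = ∑ a, jac (e' ∘ e.symm) y a i • cvec e' ((e' ∘ e.symm) y) a := by
  rw [cvec_eq, he.dsymm_transition he' hy, ContinuousLinearMap.comp_apply,
    fderiv_basisVec_eq_sum ((he.changeOn he').diffAt hy), map_sum]
  simp only [map_smul, cvec_eq]

end IsCoordChart

/-! ### Components of tensors -/

/-- Bilinearity of the values of a 2-tensor. -/
def IsBilin (T : Tensor2 M) : Prop :=
  ∀ p : M, ∃ B : E3 →ₗ[ℝ] E3 →ₗ[ℝ] ℝ, ∀ a b : E3, tval T p a b = B a b

theorem IsBilin.apply_sum {T : Tensor2 M} (hT : IsBilin T) (p : M) (c d : Fin 3 → ℝ)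
    (u w : Fin 3 → E3) : tval T p (∑ i, c i • u i) (∑ j, d j • w j) =
      ∑ i, ∑ j, c i * d j * tval T p (u i) (w j) := by
  obtain ⟨B, hB⟩ := hT p
  simp only [hB, map_sum, map_smul, LinearMap.sum_apply, LinearMap.smul_apply, smul_eq_mul,
    Finset.mul_sum]
  rw [Finset.sum_comm]
  exact Finset.sum_congr rfl fun i _ => Finset.sum_congr rfl fun j _ => by ring

theorem IsCoordChart.components_transition {e e' : OpenPartialHomeomorph M E3}
    (he : IsCoordChart e) (he' : IsCoordChart e') {T : Tensor2 M} (hT : IsBilin T) {y : E3}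
    (hy : y ∈ e.target ∩ e.symm ⁻¹' e'.source) :
    components T e.toPartialEquiv y = (jac (e' ∘ e.symm) y).transpose *
      components T e'.toPartialEquiv ((e' ∘ e.symm) y) * jac (e' ∘ e.symm) y := by
  ext i j
  rw [components_apply, he.cvec_transition he' hy, he.cvec_transition he' hy, hT.apply_sum]
  simp only [Matrix.mul_apply, Matrix.transpose_apply, Finset.sum_mul]
  rw [Finset.sum_comm]
  refine Finset.sum_congr rfl fun b _ => Finset.sum_congr rfl fun a _ => ?_
  have h2 : e'.symm ((e' ∘ e.symm) y) = e.symm y := e'.left_inv hy.2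
  rw [components_apply, h2]
  ring

end JangEH

/-! ### Smoothness of functions and tensor components in a coordinate chart. -/

namespace JangEH

variable {M : Type*} [TopologicalSpace M] [ChartedSpace (EuclideanHalfSpace 3) M]
  {e e' : OpenPartialHomeomorph M E3}

namespace IsCoordChart

theorem contDiffOn_comp_symm (he : IsCoordChart e) {f : M → ℝ}
    (hf : ContMDiffOn (𝓡∂ 3) 𝓘(ℝ, ℝ) ∞ f ((𝓡∂ 3).interior M)) :
    ContDiffOn ℝ ∞ (f ∘ e.symm) e.target := by
  rw [← contMDiffOn_iff_contDiffOn]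
  exact hf.comp he.smooth_symm fun y hy => he.source_subset (e.map_target hy)

variable [IsManifold (𝓡∂ 3) ∞ M]

/-- The coordinate field is the tangent map of the inverse chart applied to a constant section,
which makes it smooth as a map into the tangent bundle, the form needed for evaluating bundle
tensors. -/
theorem smooth_cvec (he : IsCoordChart e) (i : Fin 3) :
    ContMDiffOn 𝓘(ℝ, E3) ((𝓡∂ 3).prod 𝓘(ℝ, E3)) ∞
      (fun y => (Bundle.TotalSpace.mk' E3 (E := fun p : M => TangentSpace (𝓡∂ 3) p)
        (e.symm y) (coordVec e.toPartialEquiv y i))) e.target := by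
  have h1 := he.smooth_symm.contMDiffOn_tangentMapWithin (m := ∞) (by simp)
    e.open_target.uniqueMDiffOn
  have h2 : ContMDiff 𝓘(ℝ, E3) (𝓘(ℝ, E3).prod 𝓘(ℝ, E3)) ∞
      (fun y : E3 => (Bundle.TotalSpace.mk' E3 (E := fun y : E3 => TangentSpace 𝓘(ℝ, E3) y)
        y (basisVec i))) := by
    have h3 : ContDiff ℝ ∞ (fun _ : E3 => basisVec i) := contDiff_const
    exact contMDiff_vectorSpace_iff_contDiff.2 h3
  refine (h1.comp h2.contMDiffOn (s := e.target) fun y hy => hy).congr fun y hy => ?_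
  have h3 := tangentMapWithin_eq_tangentMap (I := 𝓘(ℝ, E3)) (I' := 𝓡∂ 3) (f := e.symm) (s := e.target)
    (p := (Bundle.TotalSpace.mk' E3 (E := fun y : E3 => TangentSpace 𝓘(ℝ, E3) y)
        y (basisVec i))) (e.open_target.uniqueMDiffOn y hy) (he.mdifferentiableAt_symm hy)
  simp only [Function.comp_apply]
  rw [h3]
  rfl

/-- The components of a smooth 2-tensor are smooth. -/
theorem smoothMat_components (he : IsCoordChart e)
    {ψ : (p : M) → TangentSpace (𝓡∂ 3) p →L[ℝ] TangentSpace (𝓡∂ 3) p →L[ℝ] ℝ}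
    (hψ : ContMDiff (𝓡∂ 3) ((𝓡∂ 3).prod 𝓘(ℝ, E3 →L[ℝ] E3 →L[ℝ] ℝ)) ∞
    (fun p : M => Bundle.TotalSpace.mk' (E3 →L[ℝ] E3 →L[ℝ] ℝ)
      (E := fun p : M => TangentSpace (𝓡∂ 3) p →L[ℝ] TangentSpace (𝓡∂ 3) p →L[ℝ] ℝ) p (ψ p))) :
    SmoothMat (components (fun p a b => ψ p a b) e.toPartialEquiv) e.target := by
  intro i j
  have h1 := hψ.comp_contMDiffOn he.smooth_symm
  have h2 := ContMDiffOn.clm_bundle_apply₂ (F₁ := E3) (F₂ := E3) (F₃ := ℝ)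
    (E₃ := Bundle.Trivial M ℝ) h1 (he.smooth_cvec i) (he.smooth_cvec j)
  rw [← contMDiffOn_iff_contDiffOn]
  intro y hy
  have h3 := h2 y hy
  rw [Bundle.contMDiffWithinAt_totalSpace] at h3
  exact h3.2

end IsCoordChart
end JangEH

namespace JangEH

/-! ### Dependence of the chart expressions on germs -/

section Germs

variable {F F' Φ Φ' : E3 → ℝ} {y : E3}

theorem hessC_congr (G : MatField) (h : F =ᶠ[𝓝 y] F') (i j : Fin 3) :
    hessC G F i j y = hessC G F' i j y := by
  have h1 : ∀ j, pd j F =ᶠ[𝓝 y] pd j F' := fun j =>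
    h.eventuallyEq_nhds.mono fun z hz => pd_congr hz j
  simp only [hessC, pd_congr (h1 j), pd_congr h]

theorem dnC_congr (G : MatField) (h : F =ᶠ[𝓝 y] F') : dnC G F y = dnC G F' y := by
  simp only [dnC, pd_congr h]

theorem vC_congr (G : MatField) (h : F =ᶠ[𝓝 y] F') (h' : Φ y = Φ' y) (i : Fin 3) :
    vC G F Φ y i = vC G F' Φ' y i := by
  simp only [vC, lapC, dnC_congr G h, h', pd_congr h]

end Germs

variable {M : Type*} [TopologicalSpace M] [ChartedSpace (EuclideanHalfSpace 3) M]
  {e e' : OpenPartialHomeomorph M E3}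

/-- The differential of a function, as a linear form on the model space. -/
noncomputable def dval (f : M → ℝ) (p : M) : E3 →L[ℝ] ℝ := mfderiv (𝓡∂ 3) 𝓘(ℝ, ℝ) f p

/-- The differential of a chart, as a map between model spaces. -/
noncomputable def dfwd (e : OpenPartialHomeomorph M E3) (p : M) : E3 →L[ℝ] E3 :=
  mfderiv (𝓡∂ 3) 𝓘(ℝ, E3) e p

namespace IsCoordChart

theorem dfwd_comp_dsymm (he : IsCoordChart e) {y : E3} (hy : y ∈ e.target) :
    (dfwd e (e.symm y)).comp (dsymm e y) = ContinuousLinearMap.id ℝ E3 := by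
  have h3 := mfderiv_comp y (he.mdifferentiableAt (e.map_target hy)) (he.mdifferentiableAt_symm hy)
  have h5 : e ∘ e.symm =ᶠ[𝓝 y] id := by
    filter_upwards [e.open_target.mem_nhds hy] with z hz
    exact e.right_inv hz
  rw [h5.mfderiv_eq] at h3
  exact h3.symm.trans mfderiv_id

theorem dsymm_injective (he : IsCoordChart e) {y : E3} (hy : y ∈ e.target) :
    Function.Injective (dsymm e y) := fun a b hab => by
  have := congrArg (dfwd e (e.symm y)) hab
  rwa [← ContinuousLinearMap.comp_apply, ← ContinuousLinearMap.comp_apply,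
    he.dfwd_comp_dsymm hy] at this

theorem dval_cvec (he : IsCoordChart e) {f : M → ℝ} {y : E3} (hy : y ∈ e.target)
    (hf : MDifferentiableAt (𝓡∂ 3) 𝓘(ℝ, ℝ) f (e.symm y)) (i : Fin 3) :
    dval f (e.symm y) (cvec e y i) = pd i (f ∘ e.symm) y := by
  have h3 := mfderiv_comp y hf (he.mdifferentiableAt_symm hy)
  have h4 : mfderiv 𝓘(ℝ, E3) 𝓘(ℝ, ℝ) (f ∘ e.symm) y = fderiv ℝ (f ∘ e.symm) y := mfderiv_eq_fderiv
  rw [h4] at h3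
  exact (congrArg (fun L : E3 →L[ℝ] ℝ => L (basisVec i)) h3).symm

theorem dfwd_cvec [IsManifold (𝓡∂ 3) ∞ M] (he : IsCoordChart e) (he' : IsCoordChart e') {y : E3}
    (hy : y ∈ e.target ∩ e.symm ⁻¹' e'.source) (i k : Fin 3) :
    dfwd e' (e.symm y) (cvec e y k) i = jac (e' ∘ e.symm) y i k := by
  have h3 := mfderiv_comp y (he'.mdifferentiableAt hy.2) (he.mdifferentiableAt_symm hy.1)
  have h4 : mfderiv 𝓘(ℝ, E3) 𝓘(ℝ, E3) (e' ∘ e.symm) y = fderiv ℝ (e' ∘ e.symm) y :=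
    mfderiv_eq_fderiv
  rw [h4] at h3
  refine Eq.trans ?_ (pd_coord ((he.changeOn he').diffAt hy) k i).symm
  exact (congrArg (fun L : E3 →L[ℝ] E3 => L (basisVec k) i) h3).symm

end IsCoordChart

/-! ### Bilinearity of the tensors -/

theorem IsBilin.of {T : Tensor2 M} (h1 : ∀ p a b c, tval T p (a + b) c = tval T p a c + tval T p b c)
    (h2 : ∀ p (r : ℝ) a c, tval T p (r • a) c = r * tval T p a c)
    (h3 : ∀ p a b c, tval T p a (b + c) = tval T p a b + tval T p a c)
    (h4 : ∀ p (r : ℝ) a c, tval T p a (r • c) = r * tval T p a c) : IsBilin T := fun p =>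
  ⟨LinearMap.mk₂ ℝ (tval T p) (h1 p) (h2 p) (h3 p) (h4 p), fun _ _ => rfl⟩

variable [IsManifold (𝓡∂ 3) ∞ M] (D : CauchyData M) (f φ : M → ℝ)

/-- The value of the metric, as a bilinear form on the model space. -/
noncomputable def CauchyData.gval (p : M) : E3 →L[ℝ] E3 →L[ℝ] ℝ := D.g.inner p

/-- The value of the second tensor, as a bilinear form on the model space. -/
noncomputable def CauchyData.kval (p : M) : E3 →L[ℝ] E3 →L[ℝ] ℝ := D.k p

theorem CauchyData.tval_gT (p : M) (a b : E3) : tval D.gT p a b = D.gval p a b := rfl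

theorem CauchyData.isBilin_gT : IsBilin D.gT := by
  apply IsBilin.of <;> intros <;> simp [D.tval_gT]

theorem tval_gBar (p : M) (a b : E3) :
    tval (gBar D f φ) p a b = D.gval p a b + φ p ^ 2 * (dval f p a * dval f p b) := rfl

theorem isBilin_gBar : IsBilin (gBar D f φ) := by
  apply IsBilin.of <;> intros <;> simp [tval_gBar] <;> ring

theorem tval_hTensor (p : M) (a b : E3) :
    tval (hTensor D f φ) p a b = (φ p * (∑ i, ∑ j,
      hessC (components D.gT (ichart p).toPartialEquiv) (f ∘ (ichart p).symm) i j (ichart p p) *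
        dfwd (ichart p) p a i * dfwd (ichart p) p b j) +
      (dval f p a * dval φ p b + dval φ p a * dval f p b)) / lapse D f φ p := rfl

theorem tval_hMinusK (p : M) (a b : E3) :
    tval (hMinusK D f φ) p a b = tval (hTensor D f φ) p a b - D.kval p a b := rfl

theorem isBilin_hMinusK : IsBilin (hMinusK D f φ) := by
  apply IsBilin.of <;> intros <;>
    simp [tval_hMinusK, tval_hTensor, Fin.sum_univ_three] <;> ring

/-! ### Chart expressions of the tensors -/

theorem mdifferentiableAt_of_interior {f : M → ℝ}
    (hf : ContMDiffOn (𝓡∂ 3) 𝓘(ℝ, ℝ) ∞ f ((𝓡∂ 3).interior M)) {p : M}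
    (hp : p ∈ (𝓡∂ 3).interior M) : MDifferentiableAt (𝓡∂ 3) 𝓘(ℝ, ℝ) f p :=
  (hf.contMDiffAt (isOpen_interior_manifold.mem_nhds hp)).mdifferentiableAt (by simp)

theorem IsCoordChart.metricOn_gT (he : IsCoordChart e) :
    MetricOn (components D.gT e.toPartialEquiv) e.target where
  smooth := he.smoothMat_components D.g.contMDiff
  posDef := fun y hy => by
    refine Matrix.PosDef.of_dotProduct_mulVec_pos ?_ fun x hx => ?_
    · ext i j
      exact D.g.symm _ _ _
    · have h1 : star x ⬝ᵥ (components D.gT e.toPartialEquiv y).mulVec x =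
          tval D.gT (e.symm y) (∑ i, x i • cvec e y i) (∑ i, x i • cvec e y i) := by
        rw [D.isBilin_gT.apply_sum]
        simp only [dotProduct, Matrix.mulVec, components_apply, Pi.star_apply, star_trivial,
          Finset.mul_sum]
        exact Finset.sum_congr rfl fun i _ => Finset.sum_congr rfl fun j _ => by ring
      rw [h1]
      refine D.g.pos _ _ fun h0 => hx ?_
      have h2 : dsymm e y (∑ i, x i • basisVec i) = dsymm e y 0 := by
        simp only [map_sum, map_smul, ← cvec_eq, map_zero]
        exact h0
      have h3 := he.dsymm_injective hy h2
      funext i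
      have h4 := congrArg (fun v : E3 => v i) h3
      fin_cases i <;> simpa [Fin.sum_univ_three, basisVec] using h4

theorem IsCoordChart.smooth_kT (he : IsCoordChart e) :
    SmoothMat (components D.kT e.toPartialEquiv) e.target :=
  he.smoothMat_components D.k_smooth

theorem components_kT_symm (e : OpenPartialHomeomorph M E3) (y : E3) (i j : Fin 3) :
    components D.kT e.toPartialEquiv y i j = components D.kT e.toPartialEquiv y j i :=
  D.k_symm _ _ _

section Interior

variable {D f φ}
variable (hf : ContMDiffOn (𝓡∂ 3) 𝓘(ℝ, ℝ) ∞ f ((𝓡∂ 3).interior M))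
  (hφ : ContMDiffOn (𝓡∂ 3) 𝓘(ℝ, ℝ) ∞ φ ((𝓡∂ 3).interior M))

include hf in
theorem IsCoordChart.components_gBar (he : IsCoordChart e) {y : E3} (hy : y ∈ e.target) :
    components (gBar D f φ) e.toPartialEquiv y =
      gbarC (components D.gT e.toPartialEquiv) (f ∘ e.symm) (φ ∘ e.symm) y := by
  have h0 := mdifferentiableAt_of_interior hf (he.source_subset (e.map_target hy))
  ext i j
  rw [components_apply, tval_gBar, he.dval_cvec hy h0, he.dval_cvec hy h0]
  rfl

include hf hφ in
theorem IsCoordChart.metricOn_gBar (he : IsCoordChart e) :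
    MetricOn (components (gBar D f φ) e.toPartialEquiv) e.target := by
  have h := (he.metricOn_gT D).gbarC_metricOn e.open_target (he.contDiffOn_comp_symm hf)
    (he.contDiffOn_comp_symm hφ)
  refine ⟨h.smooth.congr fun y hy => he.components_gBar hf hy, fun y hy => ?_⟩
  rw [he.components_gBar hf hy]
  exact h.posDef y hy

omit [IsManifold (𝓡∂ 3) ∞ M] in
theorem comp_transition_eventuallyEq (he : IsCoordChart e) (he' : IsCoordChart e') (f : M → ℝ)
    {y : E3} (hy : y ∈ e.target ∩ e.symm ⁻¹' e'.source) :
    (fun w => (f ∘ e'.symm) ((e' ∘ e.symm) w)) =ᶠ[𝓝 y] f ∘ e.symm := by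
  filter_upwards [(he.changeOn he').isOpen.mem_nhds hy] with z hz
  exact congrArg f (e'.left_inv hz.2)

include hf in
theorem diffNormSq_eq {p : M} (hp : p ∈ (𝓡∂ 3).interior M) :
    diffNormSq D.gT f p =
      dnC (components D.gT (ichart p).toPartialEquiv) (f ∘ (ichart p).symm) (ichart p p) := by
  have hs := mem_ichart_source hp
  have h1 : ∀ j, dval f p (cvec (ichart p) (ichart p p) j) =
      pd j (f ∘ (ichart p).symm) (ichart p p) := fun j => by
    have := (isCoordChart_ichart p).dval_cvec (f := f) ((ichart p).map_source hs)
      (by rw [(ichart p).left_inv hs]; exact mdifferentiableAt_of_interior hf hp) j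
    rwa [(ichart p).left_inv hs] at this
  have h2 : diffNormSq D.gT f p = dval f p (∑ i, (∑ j,
      (components D.gT (ichart p).toPartialEquiv (ichart p p))⁻¹ i j *
        dval f p (cvec (ichart p) (ichart p p) j)) • cvec (ichart p) (ichart p p) i) := rfl
  rw [h2]
  simp only [map_sum, map_smul, h1, smul_eq_mul, dnC]

-- The lapse at each point is computed in that point's own preferred chart; the change of
-- coordinates to that chart brings all these values into the one chart e.
include hf in
theorem IsCoordChart.lapse_eq (he : IsCoordChart e) {y : E3} (hy : y ∈ e.target) :
    lapse D f φ (e.symm y) =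
      lapC (components D.gT e.toPartialEquiv) (f ∘ e.symm) (φ ∘ e.symm) y := by
  have hp := he.source_subset (e.map_target hy)
  have he' := isCoordChart_ichart (e.symm y)
  have hov : y ∈ e.target ∩ e.symm ⁻¹' (ichart (e.symm y)).source := ⟨hy, mem_ichart_source hp⟩
  rw [lapse, diffNormSq_eq hf hp, lapC, ← dnC_congr _ (comp_transition_eventuallyEq he he' f hov),
    (he.changeOn he').dnC_eq (he'.contDiffOn_comp_symm hf) hov
      (he.components_transition he' D.isBilin_gT hov)]
  rfl

-- The Hessian inside h uses a chart that varies with the point, so a formula valid on the whole of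
-- e needs the tensoriality of the Hessian, applied separately at each point.
include hf hφ in
theorem IsCoordChart.components_hMinusK (he : IsCoordChart e) {y : E3} (hy : y ∈ e.target) :
    components (hMinusK D f φ) e.toPartialEquiv y =
      hC (components D.gT e.toPartialEquiv) (f ∘ e.symm) (φ ∘ e.symm) y -
        components D.kT e.toPartialEquiv y := by
  have hp := he.source_subset (e.map_target hy)
  have he' := isCoordChart_ichart (e.symm y)
  have hov : y ∈ e.target ∩ e.symm ⁻¹' (ichart (e.symm y)).source := ⟨hy, mem_ichart_source hp⟩
  have h0 := mdifferentiableAt_of_interior hf hp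
  have h0' := mdifferentiableAt_of_interior hφ hp
  have hh := (he.changeOn he').hessC_eq (he'.metricOn_gT D)
    (fun z hz => he.components_transition he' D.isBilin_gT hz) (he'.contDiffOn_comp_symm hf) hov
  ext i j
  have hh' := congrFun (congrFun hh i) j
  simp only [Matrix.of_apply, hessC_congr _ (comp_transition_eventuallyEq he he' f hov)] at hh'
  rw [components_apply, tval_hMinusK, tval_hTensor, he.lapse_eq hf hy, he.dval_cvec hy h0,
    he.dval_cvec hy h0, he.dval_cvec hy h0', he.dval_cvec hy h0', Matrix.sub_apply, hC,
    Matrix.of_apply, hh']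
  have hk : components D.kT e.toPartialEquiv y i j =
    D.kval (e.symm y) (cvec e y i) (cvec e y j) := rfl
  rw [hk]
  simp only [he.dfwd_cvec he' hov]
  congr 4
  simp only [Matrix.mul_apply, Matrix.transpose_apply, Matrix.of_apply, Finset.sum_mul,
    Function.comp_apply]
  rw [Finset.sum_comm]
  exact Finset.sum_congr rfl fun a _ => Finset.sum_congr rfl fun b _ => by ring

include hf in
theorem IsCoordChart.vField_eq (he : IsCoordChart e) {y : E3} (hy : y ∈ e.target) :
    (vField D f φ (e.symm y) : E3) = ∑ i, vC (components D.gT e.toPartialEquiv) (f ∘ e.symm)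
      (φ ∘ e.symm) y i • cvec e y i := by
  have hp := he.source_subset (e.map_target hy)
  have he' := isCoordChart_ichart (e.symm y)
  have hov : y ∈ e.target ∩ e.symm ⁻¹' (ichart (e.symm y)).source := ⟨hy, mem_ichart_source hp⟩
  set p := e.symm y with hpdef
  have hs := mem_ichart_source hp
  have h1 : ∀ j, dval f p (cvec (ichart p) (ichart p p) j) =
      pd j (f ∘ (ichart p).symm) (ichart p p) := fun j => by
    have := (isCoordChart_ichart p).dval_cvec (f := f) ((ichart p).map_source hs)
      (by rw [(ichart p).left_inv hs]; exact mdifferentiableAt_of_interior hf hp) j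
    rwa [(ichart p).left_inv hs] at this
  have h2 : (vField D f φ p : E3) = (φ p / lapse D f φ p) • ∑ i, (∑ j,
      (components D.gT (ichart p).toPartialEquiv (ichart p p))⁻¹ i j *
        dval f p (cvec (ichart p) (ichart p p) j)) • cvec (ichart p) (ichart p p) i := rfl
  have h3 : lapse D f φ p = lapC (components D.gT (ichart p).toPartialEquiv) (f ∘ (ichart p).symm)
      (φ ∘ (ichart p).symm) (ichart p p) := by
    have := (isCoordChart_ichart p).lapse_eq (D := D) (φ := φ) hf ((ichart p).map_source hs)
    rwa [(ichart p).left_inv hs] at this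
  have h4 : φ p = (φ ∘ (ichart p).symm) (ichart p p) := by
    rw [Function.comp_apply, (ichart p).left_inv hs]
  rw [h2, h3, h4]
  simp only [h1, Finset.smul_sum, smul_smul]
  have h5 : ∀ i, vC (components D.gT (ichart p).toPartialEquiv) (f ∘ (ichart p).symm)
      (φ ∘ (ichart p).symm) (ichart p p) i = ∑ m, jac (ichart p ∘ e.symm) y i m *
        vC (components D.gT e.toPartialEquiv) (f ∘ e.symm) (φ ∘ e.symm) y m := by
    intro i
    refine ((he.changeOn he').vC_eq (he'.contDiffOn_comp_symm hf) hov
      (he.components_transition he' D.isBilin_gT hov) i).trans ?_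
    refine Finset.sum_congr rfl fun m _ => ?_
    rw [vC_congr _ (comp_transition_eventuallyEq he he' f hov)
      (comp_transition_eventuallyEq he he' φ hov).eq_of_nhds]
  have h6 : ∀ i, cvec e y i = ∑ a, jac (ichart p ∘ e.symm) y a i • cvec (ichart p) (ichart p p) a :=
    he.cvec_transition he' hov
  simp only [h6, Finset.smul_sum, smul_smul]
  rw [Finset.sum_comm]
  refine Finset.sum_congr rfl fun i _ => ?_
  rw [← Finset.sum_smul]
  congr 1
  exact (h5 i).trans (Finset.sum_congr rfl fun m _ => mul_comm _ _)

end Interior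
end JangEH

namespace JangEH

/-! ### Gluing measures -/

section Glue

variable {X ι : Type*} [TopologicalSpace X] [SecondCountableTopology X] [MeasurableSpace X]
  [BorelSpace X] {S : ι → Set X} {μ : ι → Measure X}

/-- Measures on the members of an open cover which agree on overlaps are restrictions of their
least upper bound, which is concentrated on the union of the cover. -/
theorem iSup_measure_glue (hS : ∀ i, IsOpen (S i)) (hsupp : ∀ i, μ i (S i)ᶜ = 0)
    (hag : ∀ i j A, MeasurableSet A → A ⊆ S i → A ⊆ S j → μ i A = μ j A) :
    (∀ i, (⨆ i, μ i).restrict (S i) = μ i) ∧ (⨆ i, μ i) (⋃ i, S i)ᶜ = 0 := by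
  have hinter : ∀ i A, μ i A = μ i (A ∩ S i) := fun i A =>
    (measure_inter_conull (hsupp i)).symm
  -- Second countability reduces the cover to a countable one, for which countable additivity is
  -- available.
  obtain ⟨T, hTc, hT⟩ := TopologicalSpace.isOpen_iUnion_countable S hS
  rcases T.eq_empty_or_nonempty with rfl | hne
  · have hSe : ∀ i, S i = ∅ := fun i => by
      have : (⋃ i, S i) = ∅ := by rw [← hT]; simp
      exact subset_empty_iff.1 (this ▸ subset_iUnion S i)
    have h0 : ∀ i, μ i = 0 := fun i => by
      have := hsupp i
      rw [hSe i, compl_empty] at this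
      exact Measure.measure_univ_eq_zero.1 this
    have h1 : (⨆ i, μ i) = 0 := le_antisymm (iSup_le fun i => (h0 i).le) (Measure.zero_le _)
    exact ⟨fun i => by rw [h1, h0 i, Measure.restrict_zero], by rw [h1]; rfl⟩
  obtain ⟨u, rfl⟩ := hTc.exists_eq_range hne
  rw [biUnion_range] at hT
  set d : ℕ → Set X := disjointed fun n => S (u n) with hd
  have hdm : ∀ n, MeasurableSet (d n) := fun n =>
    MeasurableSet.disjointed (fun n => (hS (u n)).measurableSet) n
  have hdS : ∀ n, d n ⊆ S (u n) := fun n => disjointed_subset _ n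
  have hdd : Pairwise (Function.onFun Disjoint d) := disjoint_disjointed _
  have hdU : (⋃ n, d n) = ⋃ i, S i := by rw [← hT]; exact iUnion_disjointed
  -- Cutting a countable subcover into disjoint pieces gives a measure which evidently restricts to
  -- each μ i. The supremum is squeezed onto it: every μ i lies below it, and it is the sum of
  -- pieces of measures which lie below the supremum.
  set μ' : Measure X := Measure.sum fun n => (μ (u n)).restrict (d n) with hμ'
  have happ : ∀ A, MeasurableSet A → μ' A = ∑' n, μ (u n) (A ∩ d n) := fun A hA => by
    rw [hμ', Measure.sum_apply _ hA]
    exact tsum_congr fun n => Measure.restrict_apply hA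
  have hdisj : ∀ A, Pairwise (Function.onFun Disjoint fun n => A ∩ d n) := fun A i j hij =>
    (hdd hij).mono inter_subset_right inter_subset_right
  have hloc : ∀ i A, MeasurableSet A → A ⊆ S i → μ' A = μ i A := fun i A hA hAi => by
    rw [happ A hA]
    have : ∀ n, μ (u n) (A ∩ d n) = μ i (A ∩ d n) := fun n =>
      hag _ _ _ (hA.inter (hdm n)) (inter_subset_right.trans (hdS n)) (inter_subset_left.trans hAi)
    simp only [this]
    rw [← measure_iUnion (hdisj A) fun n => hA.inter (hdm n), ← inter_iUnion, hdU,
      inter_eq_left.2 (hAi.trans (subset_iUnion S i))]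
  have hsup : (⨆ i, μ i) = μ' := by
    refine le_antisymm (iSup_le fun i => Measure.le_iff.2 fun A hA => ?_)
      (Measure.le_iff.2 fun A hA => ?_)
    · rw [hinter, ← hloc i _ (hA.inter (hS i).measurableSet) inter_subset_right]
      exact measure_mono inter_subset_left
    · rw [happ A hA]
      calc ∑' n, μ (u n) (A ∩ d n) ≤ ∑' n, (⨆ i, μ i) (A ∩ d n) :=
            ENNReal.tsum_le_tsum fun n => le_iSup μ (u n) _
        _ = (⨆ i, μ i) (⋃ n, A ∩ d n) := (measure_iUnion (hdisj A) fun n => hA.inter (hdm n)).symm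
        _ ≤ _ := measure_mono (iUnion_subset fun n => inter_subset_left)
  rw [hsup]
  refine ⟨fun i => Measure.ext fun A hA => ?_, ?_⟩
  · rw [Measure.restrict_apply hA, hloc i _ (hA.inter (hS i).measurableSet) inter_subset_right,
      ← hinter]
  · rw [happ _ (isOpen_iUnion hS).measurableSet.compl]
    refine ENNReal.tsum_eq_zero.2 fun n => ?_
    have : (⋃ i, S i)ᶜ ∩ d n = ∅ := by
      rw [← hdU]
      ext x
      simp only [mem_inter_iff, mem_compl_iff, mem_iUnion, mem_empty_iff_false, iff_false]
      exact fun h => h.1 ⟨n, h.2⟩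
    rw [this, measure_empty]

end Glue

/-! ### Measures given by a density in a parametrization -/

section Param

variable {n : ℕ} {X : Type*} [TopologicalSpace X] [MeasurableSpace X] [BorelSpace X]

/-- The image under `ψ` of the measure with density `ρ` on `t`. -/
noncomputable def paramMeasure (t : Set (EuclideanSpace ℝ (Fin n)))
    (ρ : EuclideanSpace ℝ (Fin n) → ℝ) (ψ : EuclideanSpace ℝ (Fin n) → X) : Measure X :=
  ((volume.restrict t).withDensity fun y => ENNReal.ofReal (ρ y)).map ψ

variable {t t' : Set (EuclideanSpace ℝ (Fin n))} {ρ ρ' : EuclideanSpace ℝ (Fin n) → ℝ}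
  {ψ ψ' : EuclideanSpace ℝ (Fin n) → X}

theorem aemeasurable_param (ht : IsOpen t) (hψ : ContinuousOn ψ t) :
    AEMeasurable ψ ((volume.restrict t).withDensity fun y => ENNReal.ofReal (ρ y)) :=
  (hψ.aemeasurable ht.measurableSet).mono_ac (withDensity_absolutelyContinuous _ _)

theorem paramMeasure_apply (ht : IsOpen t) (hψ : ContinuousOn ψ t) {A : Set X}
    (hA : MeasurableSet A) :
    paramMeasure t ρ ψ A = ∫⁻ y in t ∩ ψ ⁻¹' A, ENNReal.ofReal (ρ y) := by
  rw [paramMeasure, Measure.map_apply_of_aemeasurable (aemeasurable_param ht hψ) hA,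
    withDensity_apply', Measure.restrict_restrict' ht.measurableSet, inter_comm]

theorem measurableSet_param (ht : IsOpen t) (hψ : ContinuousOn ψ t) {A : Set X}
    (hA : MeasurableSet A) : MeasurableSet (t ∩ ψ ⁻¹' A) := by
  have h := (continuousOn_iff_continuous_domRestrict.1 hψ).measurable hA
  have := ht.measurableSet.subtype_image h
  convert this using 1
  ext y
  simp [and_comm]

/-- Change of variables between two parametrizations. -/
theorem paramMeasure_eq (ht : IsOpen t) (hψ : ContinuousOn ψ t) (ht' : IsOpen t')
    (hψ' : ContinuousOn ψ' t') {A : Set X} (hA : MeasurableSet A)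
    {τ τ' : EuclideanSpace ℝ (Fin n) → EuclideanSpace ℝ (Fin n)}
    (h : ∀ y ∈ t ∩ ψ ⁻¹' A, τ y ∈ t' ∧ ψ' (τ y) = ψ y ∧ τ' (τ y) = y)
    (h' : ∀ y ∈ t' ∩ ψ' ⁻¹' A, τ' y ∈ t ∧ ψ (τ' y) = ψ' y ∧ τ (τ' y) = y)
    (hd : ∀ y ∈ t ∩ ψ ⁻¹' A, DifferentiableAt ℝ τ y)
    (hρ : ∀ y ∈ t ∩ ψ ⁻¹' A, ρ y = |(fderiv ℝ τ y).det| * ρ' (τ y)) :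
    paramMeasure t ρ ψ A = paramMeasure t' ρ' ψ' A := by
  rw [paramMeasure_apply ht hψ hA, paramMeasure_apply ht' hψ' hA]
  have him : τ '' (t ∩ ψ ⁻¹' A) = t' ∩ ψ' ⁻¹' A := by
    ext z
    constructor
    · rintro ⟨y, hy, rfl⟩
      obtain ⟨h1, h2, -⟩ := h y hy
      exact ⟨h1, by rw [mem_preimage, h2]; exact hy.2⟩
    · intro hz
      obtain ⟨h1, h2, h3⟩ := h' z hz
      exact ⟨τ' z, ⟨h1, by rw [mem_preimage, h2]; exact hz.2⟩, h3⟩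
  have hms := measurableSet_param ht hψ hA
  rw [← him, lintegral_image_eq_lintegral_abs_det_fderiv_mul volume hms
    (fun y hy => (hd y hy).hasFDerivAt.hasFDerivWithinAt)
    (fun a ha b hb hab => by rw [← (h a ha).2.2, hab, (h b hb).2.2])]
  refine setLIntegral_congr_fun hms fun y hy => ?_
  rw [hρ y hy, ENNReal.ofReal_mul (abs_nonneg _)]

theorem paramMeasure_restrict (ht : IsOpen t) (hψ : ContinuousOn ψ t) {A : Set X}
    (hA : MeasurableSet A) :
    (paramMeasure t ρ ψ).restrict A =
      ((volume.restrict (t ∩ ψ ⁻¹' A)).withDensity fun y => ENNReal.ofReal (ρ y)).map ψ := by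
  rw [paramMeasure, Measure.restrict_map_of_aemeasurable (aemeasurable_param ht hψ) hA,
    restrict_withDensity', Measure.restrict_restrict' ht.measurableSet, inter_comm]

/-- A function which is continuous in the parameters is measurable for the measure given by
the parametrization. -/
theorem aestronglyMeasurable_param [SecondCountableTopology X] [T2Space X] (ht : IsOpen t)
    (hψ : ContinuousOn ψ t) {W : Set X} (hW : IsOpen W) {χ : X → EuclideanSpace ℝ (Fin n)}
    (hχ : ContinuousOn χ W) (hinv : ∀ y ∈ t, ψ y ∈ W ∧ χ (ψ y) = y)
    {F : X → ℝ} (hF : ContinuousOn (fun y => F (ψ y)) t) :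
    AEStronglyMeasurable F (paramMeasure t ρ ψ) := by
  -- Almost every point of X lies in the image of ψ, where F equals F ∘ ψ ∘ χ; that function is
  -- continuous on the open set V.
  set V : Set X := W ∩ χ ⁻¹' t with hVdef
  have hV : IsOpen V := hχ.isOpen_inter_preimage hW ht
  have hmem : ∀ y ∈ t, ψ y ∈ V := fun y hy => ⟨(hinv y hy).1, by
    rw [mem_preimage, (hinv y hy).2]; exact hy⟩
  have hae : ∀ B : Set X, MeasurableSet B → (∀ y ∈ t, ψ y ∈ B) →
      ∀ᵐ x ∂paramMeasure t ρ ψ, x ∈ B := fun B hB h => by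
    change paramMeasure t ρ ψ Bᶜ = 0
    rw [paramMeasure_apply ht hψ hB.compl]
    have : t ∩ ψ ⁻¹' Bᶜ = ∅ := by
      ext y
      simp only [mem_inter_iff, mem_preimage, mem_compl_iff, mem_empty_iff_false, iff_false]
      exact fun hy => hy.2 (h y hy.1)
    rw [this]; simp
  have hcont : ContinuousOn (fun x => F (ψ (χ x))) V :=
    hF.comp (hχ.mono inter_subset_left) fun x hx => hx.2
  have h1 : AEStronglyMeasurable (fun x => F (ψ (χ x))) (paramMeasure t ρ ψ) := by
    rw [← Measure.restrict_eq_self_of_ae_mem (hae V hV.measurableSet hmem)]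
    exact hcont.aestronglyMeasurable hV.measurableSet
  refine h1.congr ?_
  -- In a Hausdorff space the points of V at which ψ ∘ χ is not the identity form an open set, so
  -- the exceptional set is measurable.
  have hN : IsOpen (V ∩ (fun x => (ψ (χ x), x)) ⁻¹' (diagonal X)ᶜ) :=
    ((hψ.comp (hχ.mono inter_subset_left) fun x hx => hx.2).prodMk continuousOn_id
      ).isOpen_inter_preimage hV isClosed_diagonal.isOpen_compl
  have hB : MeasurableSet (V \ (V ∩ (fun x => (ψ (χ x), x)) ⁻¹' (diagonal X)ᶜ)) :=
    hV.measurableSet.diff hN.measurableSet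
  filter_upwards [hae _ hB fun y hy => ⟨hmem y hy, fun h => h.2 (by
    change ψ (χ (ψ y)) = ψ y
    rw [(hinv y hy).2])⟩] with x hx
  have hx' : ψ (χ x) = x := by
    by_contra h
    exact hx.2 ⟨hx.1, h⟩
  simp only [hx']

/-- Integration with respect to a measure given in a parametrization. -/
theorem setIntegral_paramMeasure (ht : IsOpen t) (hψ : ContinuousOn ψ t) (hρ : ContinuousOn ρ t)
    (hρ0 : ∀ y ∈ t, 0 ≤ ρ y) {F : X → ℝ} (hF : AEStronglyMeasurable F (paramMeasure t ρ ψ))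
    {A : Set X} (hA : MeasurableSet A) :
    ∫ p in A, F p ∂paramMeasure t ρ ψ = ∫ y in t ∩ ψ ⁻¹' A, ρ y * F (ψ y) := by
  have hms := measurableSet_param ht hψ hA
  have hr := paramMeasure_restrict (ρ := ρ) ht hψ hA
  have hae' : AEMeasurable ψ
      ((volume.restrict (t ∩ ψ ⁻¹' A)).withDensity fun y => ENNReal.ofReal (ρ y)) :=
    ((hψ.mono inter_subset_left).aemeasurable hms).mono_ac (withDensity_absolutelyContinuous _ _)
  rw [hr, integral_map hae' (hr ▸ hF.restrict), integral_withDensity_eq_integral_toReal_smul₀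
    ((hρ.mono inter_subset_left).aemeasurable hms).ennreal_ofReal (by simp)]
  refine setIntegral_congr_fun hms fun y hy => ?_
  simp only [smul_eq_mul]
  rw [ENNReal.toReal_ofReal (hρ0 y hy.1)]

/-- Integrability with respect to a measure given in a parametrization. -/
theorem integrable_paramMeasure (ht : IsOpen t) (hψ : ContinuousOn ψ t) (hρ : ContinuousOn ρ t)
    (hρ0 : ∀ y ∈ t, 0 ≤ ρ y) {F : X → ℝ} (hF : AEStronglyMeasurable F (paramMeasure t ρ ψ))
    (hi : IntegrableOn (fun y => ρ y * F (ψ y)) t) : Integrable F (paramMeasure t ρ ψ) := by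
  have hm : AEMeasurable (fun y => ENNReal.ofReal (ρ y)) (volume.restrict t) :=
    (hρ.aemeasurable ht.measurableSet).ennreal_ofReal
  rw [paramMeasure, integrable_map_measure hF (aemeasurable_param ht hψ),
    integrable_withDensity_iff_integrable_smul₀' hm (by simp)]
  refine hi.congr_fun (fun y hy => ?_) ht.measurableSet
  simp only [smul_eq_mul, Function.comp_apply]
  rw [ENNReal.toReal_ofReal (hρ0 y hy)]

end Param

end JangEH

namespace JangEH

variable {M : Type*} [TopologicalSpace M] [ChartedSpace (EuclideanHalfSpace 3) M]
  {e e' : OpenPartialHomeomorph M E3}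

/-! ### The Riemannian volume measure -/

theorem det_eq_det_entries {n : ℕ}
    (L : EuclideanSpace ℝ (Fin n) →L[ℝ] EuclideanSpace ℝ (Fin n)) :
    L.det = (Matrix.of fun i j => L (EuclideanSpace.single j 1) i).det := by
  rw [ContinuousLinearMap.det, ← LinearMap.det_toMatrix (EuclideanSpace.basisFun (Fin n) ℝ).toBasis]
  congr 1

theorem det_fderiv_eq_det_jac {τ : E3 → E3} {y : E3} (h : DifferentiableAt ℝ τ y) :
    (fderiv ℝ τ y).det = (jac τ y).det := by
  rw [det_eq_det_entries]
  congr 1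
  ext a i
  exact (pd_coord h i a).symm

theorem sqrt_det_conj {n : ℕ} (J G : Matrix (Fin n) (Fin n) ℝ) :
    Real.sqrt (J.transpose * G * J).det = |J.det| * Real.sqrt G.det := by
  rw [Matrix.det_mul, Matrix.det_mul, Matrix.det_transpose, ← Real.sqrt_sq_eq_abs,
    ← Real.sqrt_mul (sq_nonneg _)]
  congr 1; ring

section Volume

variable [MeasurableSpace M] [BorelSpace M] {T : Tensor2 M}

theorem chartVolume_compl_source (T : Tensor2 M) (e : OpenPartialHomeomorph M E3) :
    chartVolume T e e.sourceᶜ = 0 := by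
  have := paramMeasure_apply (ρ := fun y => Real.sqrt (components T e.toPartialEquiv y).det)
    e.open_target e.continuousOn_symm e.open_source.measurableSet.compl
  refine this.trans ?_
  have h0 : e.target ∩ e.symm ⁻¹' e.sourceᶜ = ∅ := by
    ext y
    simp only [mem_inter_iff, mem_preimage, mem_compl_iff, mem_empty_iff_false, iff_false]
    exact fun h => h.2 (e.map_target h.1)
  rw [h0]; simp

/-- The density (det G)^{1/2} changes by |det J|, precisely the factor in the change of variables.
-/
theorem chartVolume_agree (hT : IsBilin T) (he : IsCoordChart e) (he' : IsCoordChart e') {A : Set M}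
    (hA : MeasurableSet A) (h : A ⊆ e.source) (h' : A ⊆ e'.source) :
    chartVolume T e A = chartVolume T e' A := by
  have hov : ∀ y ∈ e.target ∩ e.symm ⁻¹' A, y ∈ e.target ∩ e.symm ⁻¹' e'.source :=
    fun y hy => ⟨hy.1, h' hy.2⟩
  refine paramMeasure_eq (τ := e' ∘ e.symm) (τ' := e ∘ e'.symm) e.open_target e.continuousOn_symm
    e'.open_target e'.continuousOn_symm hA (fun y hy => ?_) (fun y hy => ?_) (fun y hy => ?_)
    fun y hy => ?_
  · refine ⟨e'.map_source (h' hy.2), e'.left_inv (h' hy.2), ?_⟩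
    simp [e'.left_inv (h' hy.2), e.right_inv hy.1]
  · refine ⟨e.map_source (h hy.2), e.left_inv (h hy.2), ?_⟩
    simp [e.left_inv (h hy.2), e'.right_inv hy.1]
  · exact (he.changeOn he').diffAt (hov y hy)
  · rw [he.components_transition he' hT (hov y hy), sqrt_det_conj,
      det_fderiv_eq_det_jac ((he.changeOn he').diffAt (hov y hy))]

variable [SecondCountableTopology M]

theorem volumeMeasure_glue (hT : IsBilin T) :
    (∀ e, IsCoordChart e → (volumeMeasure T).restrict e.source = chartVolume T e) ∧
      volumeMeasure T (⋃ e : {e : OpenPartialHomeomorph M E3 // IsCoordChart e}, e.1.source)ᶜ =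
        0 := by
  have h := iSup_measure_glue (ι := {e : OpenPartialHomeomorph M E3 // IsCoordChart e})
    (S := fun e => e.1.source) (μ := fun e => chartVolume T e.1) (fun e => e.1.open_source)
    (fun e => chartVolume_compl_source T e.1)
    (fun e e' A hA h h' => chartVolume_agree hT e.2 e'.2 hA h h')
  rw [iSup_subtype (p := IsCoordChart) (f := fun e => chartVolume T e.1)] at h
  exact ⟨fun e he => h.1 ⟨e, he⟩, h.2⟩

theorem IsCoordChart.volumeMeasure_restrict (he : IsCoordChart e) (hT : IsBilin T) :
    (volumeMeasure T).restrict e.source = chartVolume T e := (volumeMeasure_glue hT).1 e he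

/-- The chart sources all lie in the interior, so the values on Σ of functions such as f, φ and the
scalar curvature never enter an integral. -/
theorem volumeMeasure_compl_interior [IsManifold (𝓡∂ 3) ∞ M] (hT : IsBilin T) :
    volumeMeasure T ((𝓡∂ 3).interior M)ᶜ = 0 := by
  have h := (volumeMeasure_glue hT).2
  convert h
  refine subset_antisymm (fun p hp => ?_) (iUnion_subset fun e => e.2.source_subset)
  exact mem_iUnion.2 ⟨⟨ichart p, isCoordChart_ichart p⟩, mem_ichart_source hp⟩

end Volume

/-! ### Slice charts -/

theorem frontier_halfSpace : frontier {x : E3 | x 2 < 0} = {x : E3 | x 2 = 0} := by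
  have ho : IsOpenMap (EuclideanSpace.proj 2 : E3 →L[ℝ] ℝ) :=
    (EuclideanSpace.proj 2 : E3 →L[ℝ] ℝ).isOpenMap fun r => ⟨r • basisVec 2, by simp [basisVec]⟩
  have := ho.preimage_frontier_eq_frontier_preimage
    (EuclideanSpace.proj 2 : E3 →L[ℝ] ℝ).continuous (Iio 0)
  rw [frontier_Iio] at this
  exact this.symm

/-- The projection to the plane `x₂ = 0`. -/
noncomputable def planeProj (x : E3) : EuclideanSpace ℝ (Fin 2) := !₂[x 0, x 1]

theorem planeIncl_two (y : EuclideanSpace ℝ (Fin 2)) : planeIncl y 2 = 0 := rfl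

theorem planeProj_planeIncl (y : EuclideanSpace ℝ (Fin 2)) : planeProj (planeIncl y) = y := by
  ext i; fin_cases i <;> rfl

theorem planeIncl_planeProj {x : E3} (hx : x 2 = 0) : planeIncl (planeProj x) = x := by
  ext i; fin_cases i
  · rfl
  · rfl
  · exact hx.symm

/-- The inclusion of the plane as a continuous linear map. -/
noncomputable def planeInclL : EuclideanSpace ℝ (Fin 2) →L[ℝ] E3 :=
  LinearMap.toContinuousLinearMap
    { toFun := planeIncl
      map_add' := fun a b => by ext i; fin_cases i <;> simp [planeIncl]
      map_smul' := fun r a => by ext i; fin_cases i <;> simp [planeIncl] }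

/-- The projection to the plane as a continuous linear map. -/
noncomputable def planeProjL : E3 →L[ℝ] EuclideanSpace ℝ (Fin 2) :=
  LinearMap.toContinuousLinearMap
    { toFun := planeProj
      map_add' := fun a b => by ext i; fin_cases i <;> simp [planeProj]
      map_smul' := fun r a => by ext i; fin_cases i <;> simp [planeProj] }

theorem continuous_planeIncl : Continuous planeIncl := planeInclL.continuous

namespace IsSliceChart

variable {U : Set M}

theorem mem_frontier_iff (he : IsSliceChart U e) {p : M} (hp : p ∈ e.source) :
    p ∈ frontier U ↔ e p 2 = 0 := by
  have h : e.IsImage U {x : E3 | x 2 < 0} := fun p hp => (he.mem_iff p hp).symm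
  have := h.frontier hp
  rw [frontier_halfSpace] at this
  exact this.symm

theorem transition_two (he : IsSliceChart U e) (he' : IsSliceChart U e') {x : E3}
    (hx : x ∈ e.target ∩ e.symm ⁻¹' e'.source) (h2 : x 2 = 0) : (e' ∘ e.symm) x 2 = 0 := by
  refine (he'.mem_frontier_iff hx.2).1 ((he.mem_frontier_iff (e.map_target hx.1)).2 ?_)
  rwa [e.right_inv hx.1]

theorem transition_two_neg (he : IsSliceChart U e) (he' : IsSliceChart U e') {x : E3}
    (hx : x ∈ e.target ∩ e.symm ⁻¹' e'.source) (h2 : x 2 < 0) : (e' ∘ e.symm) x 2 < 0 := by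
  refine (he'.mem_iff _ hx.2).1 ((he.mem_iff _ (e.map_target hx.1)).2 ?_)
  rwa [e.right_inv hx.1]

theorem hasDerivAt_transition (he : IsSliceChart U e) (he' : IsSliceChart U e') {x : E3}
    (hx : x ∈ e.target ∩ e.symm ⁻¹' e'.source) (a : Fin 3) :
    HasDerivAt (fun s : ℝ => (e' ∘ e.symm) (x + s • basisVec a) 2)
      (jac (e' ∘ e.symm) x 2 a) 0 := by
  have hc := he.isCoordChart.changeOn he'.isCoordChart
  exact ((diffAt_of_contDiffOn hc.isOpen (hc.smooth_coord 2) hx).hasFDerivAt).hasLineDerivAt _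

omit [ChartedSpace (EuclideanHalfSpace 3) M] in
theorem eventually_mem_overlap {x : E3}
    (hx : x ∈ e.target ∩ e.symm ⁻¹' e'.source) (a : Fin 3) :
    ∀ᶠ s : ℝ in 𝓝 0, x + s • basisVec a ∈ e.target ∩ e.symm ⁻¹' e'.source := by
  have hc : ContinuousAt (fun s : ℝ => x + s • basisVec a) 0 := by fun_prop
  refine hc.eventually_mem ?_
  simpa using (e.isOpen_inter_preimage_symm e'.open_source).mem_nhds hx

/-- Transition maps of slice charts preserve the plane x₂ = 0, so their last component vanishes
along tangential directions. -/
theorem jac_two_tangential (he : IsSliceChart U e) (he' : IsSliceChart U e') {x : E3}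
    (hx : x ∈ e.target ∩ e.symm ⁻¹' e'.source) (h2 : x 2 = 0) {a : Fin 3} (ha : a ≠ 2) :
    jac (e' ∘ e.symm) x 2 a = 0 := by
  refine (he.hasDerivAt_transition he' hx a).unique ?_
  refine (hasDerivAt_const (0 : ℝ) (0 : ℝ)).congr_of_eventuallyEq ?_
  filter_upwards [eventually_mem_overlap hx a] with s hs
  refine he.transition_two he' hs ?_
  simp [basisVec, h2, ha.symm]

/-- Both charts have U on the side x₂ < 0, so the difference quotients from that side are positive
and the derivative is nonnegative; it cannot vanish, because the rest of the last row of the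
Jacobian does. -/
theorem jac_two_two_pos (he : IsSliceChart U e) (he' : IsSliceChart U e') {x : E3}
    (hx : x ∈ e.target ∩ e.symm ⁻¹' e'.source) (h2 : x 2 = 0) :
    0 < jac (e' ∘ e.symm) x 2 2 := by
  have hdet := (he.isCoordChart.changeOn he'.isCoordChart).det_ne x hx
  have h0 := he.jac_two_tangential he' hx h2 (a := 0) (by decide)
  have h1 := he.jac_two_tangential he' hx h2 (a := 1) (by decide)
  refine lt_of_le_of_ne ?_ fun h => hdet ?_
  · have hsub : Iio (0 : ℝ) ⊆ {0}ᶜ := fun s hs => ne_of_lt hs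
    have ht := ((hasDerivAt_iff_tendsto_slope.1 (he.hasDerivAt_transition he' hx 2)).mono_left
      (nhdsWithin_mono 0 hsub))
    refine ge_of_tendsto ht ?_
    filter_upwards [nhdsWithin_le_nhds (eventually_mem_overlap hx 2), self_mem_nhdsWithin]
      with s hs hs0
    have hs0' : s < 0 := hs0
    have hneg : (e' ∘ e.symm) (x + s • basisVec 2) 2 < 0 :=
      he.transition_two_neg he' hs (by simpa [basisVec, h2] using hs0')
    have hz : (e' ∘ e.symm) (x + (0 : ℝ) • basisVec 2) 2 = 0 := by
      rw [zero_smul, add_zero]; exact he.transition_two he' hx h2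
    rw [slope_def_field, hz, sub_zero, sub_zero]
    exact (div_pos_of_neg_of_neg hneg hs0').le
  · rw [Matrix.det_fin_three, h0, h1, ← h]; ring

end IsSliceChart

end JangEH

namespace JangEH

variable {M : Type*} [TopologicalSpace M] [ChartedSpace (EuclideanHalfSpace 3) M]
  {e e' : OpenPartialHomeomorph M E3} {U : Set M} {T : Tensor2 M}

/-! ### The area measure -/

/-- The tangential block of a `3 × 3` matrix. -/
def tblock (G : Matrix (Fin 3) (Fin 3) ℝ) : Matrix (Fin 2) (Fin 2) ℝ :=
  G.submatrix (Fin.castSucc : Fin 2 → Fin 3) (Fin.castSucc : Fin 2 → Fin 3)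

/-- When the last row of J has no tangential entries, the normal direction does not enter the
tangential block, which then transforms as a metric on the surface. -/
theorem tblock_conj {J G : Matrix (Fin 3) (Fin 3) ℝ} (h0 : J 2 0 = 0) (h1 : J 2 1 = 0) :
    tblock (J.transpose * G * J) = (tblock J).transpose * tblock G * tblock J := by
  ext a b
  fin_cases a <;> fin_cases b <;>
  simp [tblock, Matrix.mul_apply, Fin.sum_univ_three, h0, h1]

theorem differentiableAt_planar {τ : E3 → E3} {y : EuclideanSpace ℝ (Fin 2)}
    (h : DifferentiableAt ℝ τ (planeIncl y)) :
    DifferentiableAt ℝ (fun w => planeProj (τ (planeIncl w))) y :=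
  (planeProjL.hasFDerivAt.comp y
    ((show HasFDerivAt τ _ (planeInclL y) from h.hasFDerivAt).comp y
      planeInclL.hasFDerivAt)).differentiableAt

theorem det_fderiv_planar {τ : E3 → E3} {y : EuclideanSpace ℝ (Fin 2)}
    (h : DifferentiableAt ℝ τ (planeIncl y)) :
    (fderiv ℝ (fun w => planeProj (τ (planeIncl w))) y).det = (tblock (jac τ (planeIncl y))).det := by
  have h1 : HasFDerivAt (fun w => planeProj (τ (planeIncl w)))
      (planeProjL.comp ((fderiv ℝ τ (planeIncl y)).comp planeInclL)) y :=
    planeProjL.hasFDerivAt.comp y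
      ((show HasFDerivAt τ _ (planeInclL y) from h.hasFDerivAt).comp y planeInclL.hasFDerivAt)
  rw [h1.fderiv, det_eq_det_entries]
  congr 1
  have h2 : ∀ j : Fin 2, planeInclL (EuclideanSpace.single j 1) = basisVec j.castSucc := by
    intro j
    change planeIncl _ = _
    ext i
    fin_cases j <;> fin_cases i <;> simp [planeIncl, basisVec]
  have h3 : ∀ (x : E3) (i : Fin 2), planeProjL x i = x i.castSucc := by
    intro x i
    change planeProj x i = _
    fin_cases i <;> rfl
  ext i j
  simp only [Matrix.of_apply, ContinuousLinearMap.comp_apply, h2, h3]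
  exact (pd_coord h j.castSucc i.castSucc).symm

namespace IsSliceChart

omit [ChartedSpace (EuclideanHalfSpace 3) M] in
theorem slice_continuousOn (e : OpenPartialHomeomorph M E3) :
    ContinuousOn (fun y => e.symm (planeIncl y)) (planeIncl ⁻¹' e.target) :=
  e.continuousOn_symm.comp continuous_planeIncl.continuousOn fun _ hy => hy

omit [ChartedSpace (EuclideanHalfSpace 3) M] in
theorem slice_isOpen (e : OpenPartialHomeomorph M E3) : IsOpen (planeIncl ⁻¹' e.target) :=
  e.open_target.preimage continuous_planeIncl

variable [MeasurableSpace M] [BorelSpace M]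

theorem sliceArea_apply (T : Tensor2 M) (e : OpenPartialHomeomorph M E3) {A : Set M}
    (hA : MeasurableSet A) :
    sliceArea T e A = ∫⁻ y in planeIncl ⁻¹' e.target ∩ (fun y => e.symm (planeIncl y)) ⁻¹' A,
      ENNReal.ofReal (Real.sqrt (tblock (components T e.toPartialEquiv (planeIncl y))).det) :=
  paramMeasure_apply (slice_isOpen e) (slice_continuousOn e) hA

theorem sliceArea_compl_source (T : Tensor2 M) (e : OpenPartialHomeomorph M E3) :
    sliceArea T e e.sourceᶜ = 0 := by
  rw [sliceArea_apply T e e.open_source.measurableSet.compl]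
  have h0 : planeIncl ⁻¹' e.target ∩ (fun y => e.symm (planeIncl y)) ⁻¹' e.sourceᶜ = ∅ := by
    ext y
    simp only [mem_inter_iff, mem_preimage, mem_compl_iff, mem_empty_iff_false, iff_false]
    exact fun h => h.2 (e.map_target h.1)
  rw [h0]; simp

theorem sliceArea_compl_frontier (he : IsSliceChart U e) (T : Tensor2 M) :
    sliceArea T e (frontier U)ᶜ = 0 := by
  rw [sliceArea_apply T e isClosed_frontier.measurableSet.compl]
  have h0 : planeIncl ⁻¹' e.target ∩ (fun y => e.symm (planeIncl y)) ⁻¹' (frontier U)ᶜ = ∅ := by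
    ext y
    simp only [mem_inter_iff, mem_preimage, mem_compl_iff, mem_empty_iff_false, iff_false]
    refine fun h => h.2 ((he.mem_frontier_iff (e.map_target h.1)).2 ?_)
    rw [e.right_inv h.1]; rfl
  rw [h0]; simp

/-- The argument for the volume one dimension lower: the plane is preserved, so the projected
transition map is a change of parameters of the surface with Jacobian the tangential block. -/
theorem sliceArea_agree (hT : IsBilin T) (he : IsSliceChart U e) (he' : IsSliceChart U e')
    {A : Set M} (hA : MeasurableSet A) (h : A ⊆ e.source) (h' : A ⊆ e'.source) :
    sliceArea T e A = sliceArea T e' A := by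
  have hov : ∀ y ∈ planeIncl ⁻¹' e.target ∩ (fun y => e.symm (planeIncl y)) ⁻¹' A,
      planeIncl y ∈ e.target ∩ e.symm ⁻¹' e'.source := fun y hy => ⟨hy.1, h' hy.2⟩
  have hov' : ∀ y ∈ planeIncl ⁻¹' e'.target ∩ (fun y => e'.symm (planeIncl y)) ⁻¹' A,
      planeIncl y ∈ e'.target ∩ e'.symm ⁻¹' e.source := fun y hy => ⟨hy.1, h hy.2⟩
  have hin : ∀ y ∈ planeIncl ⁻¹' e.target ∩ (fun y => e.symm (planeIncl y)) ⁻¹' A,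
      planeIncl (planeProj ((e' ∘ e.symm) (planeIncl y))) = (e' ∘ e.symm) (planeIncl y) :=
    fun y hy => planeIncl_planeProj (he.transition_two he' (hov y hy) (planeIncl_two y))
  have hin' : ∀ y ∈ planeIncl ⁻¹' e'.target ∩ (fun y => e'.symm (planeIncl y)) ⁻¹' A,
      planeIncl (planeProj ((e ∘ e'.symm) (planeIncl y))) = (e ∘ e'.symm) (planeIncl y) :=
    fun y hy => planeIncl_planeProj (he'.transition_two he (hov' y hy) (planeIncl_two y))
  refine paramMeasure_eq (τ := fun w => planeProj ((e' ∘ e.symm) (planeIncl w)))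
    (τ' := fun w => planeProj ((e ∘ e'.symm) (planeIncl w))) (slice_isOpen e) (slice_continuousOn e)
    (slice_isOpen e') (slice_continuousOn e') hA (fun y hy => ?_) (fun y hy => ?_) (fun y hy => ?_)
    fun y hy => ?_
  · have h1 : e'.symm ((e' ∘ e.symm) (planeIncl y)) = e.symm (planeIncl y) :=
      e'.left_inv (h' hy.2)
    refine ⟨?_, ?_, ?_⟩
    · rw [mem_preimage, hin y hy]; exact e'.map_source (h' hy.2)
    · rw [hin y hy]; exact h1
    · rw [hin y hy, Function.comp_apply, h1, e.right_inv hy.1, planeProj_planeIncl]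
  · have h1 : e.symm ((e ∘ e'.symm) (planeIncl y)) = e'.symm (planeIncl y) :=
      e.left_inv (h hy.2)
    refine ⟨?_, ?_, ?_⟩
    · rw [mem_preimage, hin' y hy]; exact e.map_source (h hy.2)
    · rw [hin' y hy]; exact h1
    · rw [hin' y hy, Function.comp_apply, h1, e'.right_inv hy.1, planeProj_planeIncl]
  · exact differentiableAt_planar
      ((he.isCoordChart.changeOn he'.isCoordChart).diffAt (hov y hy))
  · have h0 := he.jac_two_tangential he' (hov y hy) (planeIncl_two y) (a := 0) (by decide)
    have h1 := he.jac_two_tangential he' (hov y hy) (planeIncl_two y) (a := 1) (by decide)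
    rw [det_fderiv_planar ((he.isCoordChart.changeOn he'.isCoordChart).diffAt (hov y hy)), hin y hy]
    rw [← sqrt_det_conj]
    change Real.sqrt (tblock (components T e.toPartialEquiv (planeIncl y))).det = _
    rw [he.isCoordChart.components_transition he'.isCoordChart hT (hov y hy), tblock_conj h0 h1]
    rfl

variable [SecondCountableTopology M]

theorem areaMeasure_restrict (hT : IsBilin T) (he : IsSliceChart U e) :
    (areaMeasure T U).restrict e.source = sliceArea T e := by
  have h := iSup_measure_glue (ι := {e : OpenPartialHomeomorph M E3 // IsSliceChart U e})
    (S := fun e => e.1.source) (μ := fun e => sliceArea T e.1) (fun e => e.1.open_source)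
    (fun e => sliceArea_compl_source T e.1)
    (fun e e' A hA h h' => sliceArea_agree hT e.2 e'.2 hA h h')
  rw [iSup_subtype (p := IsSliceChart U) (f := fun e => sliceArea T e.1)] at h
  exact h.1 ⟨e, he⟩

-- Each slice area lives on the closed set `frontier U`, so it is bounded by the restriction of the
-- supremum to that set; hence the supremum is too.
omit [SecondCountableTopology M] in
theorem areaMeasure_compl_frontier (T : Tensor2 M) (U : Set M) :
    areaMeasure T U (frontier U)ᶜ = 0 := by
  have hm : MeasurableSet (frontier U) := isClosed_frontier.measurableSet
  have h1 : areaMeasure T U ≤ (areaMeasure T U).restrict (frontier U) := by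
    refine iSup₂_le fun e he => ?_
    have h2 : sliceArea T e ≤ areaMeasure T U :=
      le_iSup₂ (f := fun e (_ : IsSliceChart U e) => sliceArea T e) e he
    rw [← Measure.restrict_eq_self_of_ae_mem (μ := sliceArea T e) (s := frontier U)
      (show ∀ᵐ x ∂sliceArea T e, x ∈ frontier U from he.sliceArea_compl_frontier T)]
    exact Measure.restrict_mono subset_rfl h2
  refine le_antisymm ((h1 _).trans ?_) zero_le
  rw [Measure.restrict_apply hm.compl]
  simp

end IsSliceChart

/-! ### The unit normal -/

/-- Column 2 of the inverse metric changes by J and the factor J₂₂, and the square root in the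
denominator by the same positive factor. So the arbitrary choice of chart in `unitNormal` is
harmless, and the outward side is kept. -/
theorem IsSliceChart.sliceNormal_eq (hT : IsBilin T) (he : IsSliceChart U e)
    (he' : IsSliceChart U e') {p : M} (hp : p ∈ e.source) (hp' : p ∈ e'.source)
    (hU : p ∈ frontier U) : sliceNormal T e p = sliceNormal T e' p := by
  have hov : e p ∈ e.target ∩ e.symm ⁻¹' e'.source :=
    ⟨e.map_source hp, by rw [mem_preimage, e.left_inv hp]; exact hp'⟩
  have hc := he.isCoordChart.changeOn he'.isCoordChart
  have h2 := (he.mem_frontier_iff hp).1 hU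
  have hτ : (e' ∘ e.symm) (e p) = e' p := by rw [Function.comp_apply, e.left_inv hp]
  have h0 := he.jac_two_tangential he' hov h2 (a := 0) (by decide)
  have h1 := he.jac_two_tangential he' hov h2 (a := 1) (by decide)
  have h3 := he.jac_two_two_pos he' hov h2
  have hinv := mul_inv_mul_transpose
    (G' := components T e'.toPartialEquiv ((e' ∘ e.symm) (e p))) (hc.isUnit_det hov)
  rw [← he.isCoordChart.components_transition he'.isCoordChart hT hov, hτ] at hinv
  set J := jac (e' ∘ e.symm) (e p)
  set A := (components T e.toPartialEquiv (e p))⁻¹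
  have hcol : ∀ i, (components T e'.toPartialEquiv (e' p))⁻¹ i 2 = J 2 2 * ∑ a, J i a * A a 2 := by
    intro i
    rw [← hinv]
    simp only [Matrix.mul_apply, Matrix.transpose_apply, Fin.sum_univ_three, h0, h1]
    ring
  have h22 : ∑ a, J 2 a * A a 2 = J 2 2 * A 2 2 := by
    rw [Fin.sum_univ_three, h0, h1]; ring
  have hsq : Real.sqrt ((components T e'.toPartialEquiv (e' p))⁻¹ 2 2) =
      J 2 2 * Real.sqrt (A 2 2) := by
    rw [hcol 2, h22, ← mul_assoc, Real.sqrt_mul (by positivity), Real.sqrt_mul_self h3.le]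
  have e1 : (sliceNormal T e p : E3) = ∑ i, (A i 2 / Real.sqrt (A 2 2)) • cvec e (e p) i := rfl
  have e2 : (sliceNormal T e' p : E3) = ∑ i, ((components T e'.toPartialEquiv (e' p))⁻¹ i 2 /
    Real.sqrt ((components T e'.toPartialEquiv (e' p))⁻¹ 2 2)) • cvec e' (e' p) i := rfl
  refine Eq.trans e1 (Eq.trans ?_ e2.symm)
  rw [hsq]
  simp only [hcol, mul_div_mul_left _ _ h3.ne',
    he.isCoordChart.cvec_transition he'.isCoordChart hov, hτ, Finset.smul_sum, smul_smul]
  rw [Finset.sum_comm]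
  refine Finset.sum_congr rfl fun a _ => ?_
  rw [← Finset.sum_smul, Finset.sum_div]
  congr 1
  exact Finset.sum_congr rfl fun i _ => by ring

theorem IsSliceChart.unitNormal_eq (hT : IsBilin T) (he : IsSliceChart U e) {p : M}
    (hp : p ∈ e.source) (hU : p ∈ frontier U) : unitNormal T U p = sliceNormal T e p := by
  have h : ∃ e : OpenPartialHomeomorph M E3, IsSliceChart U e ∧ p ∈ e.source := ⟨e, he, hp⟩
  rw [unitNormal, dif_pos h]
  exact h.choose_spec.1.sliceNormal_eq hT he h.choose_spec.2 hp hU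

end JangEH

namespace JangEH

/-! ### Dependence of curvature and divergence on germs -/

section Congr

variable {G G' : MatField} {U : Set E3} {y : E3}

theorem christoffel_congr_on (hU : IsOpen U) (h : ∀ z ∈ U, G z = G' z) (hy : y ∈ U)
    (m i j : Fin 3) : christoffel G m i j y = christoffel G' m i j y := by
  have h1 : ∀ a b c, pd a (fun z => G z b c) y = pd a (fun z => G' z b c) y := fun a b c =>
    pd_congr_on hU (fun z hz => by rw [h z hz]) hy a
  simp only [christoffel, h y hy, h1]

theorem scalarC_congr_on (hU : IsOpen U) (h : ∀ z ∈ U, G z = G' z) (hy : y ∈ U) :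
    scalarC G y = scalarC G' y := by
  have h1 : ∀ m i j, christoffel G m i j y = christoffel G' m i j y :=
    christoffel_congr_on hU h hy
  have h2 : ∀ a m i j, pd a (christoffel G m i j) y = pd a (christoffel G' m i j) y :=
    fun a m i j => pd_congr_on hU (fun z hz => christoffel_congr_on hU h hz m i j) hy a
  simp only [scalarC, ricci, h1, h2, h y hy]

theorem codivC_congr_on (hU : IsOpen U) (h : ∀ z ∈ U, G z = G' z) {α α' : E3 → Fin 3 → ℝ}
    (hα : ∀ z ∈ U, ∀ j, α z j = α' z j) (hy : y ∈ U) : codivC G α y = codivC G' α' y := by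
  have h1 : ∀ m i j, christoffel G m i j y = christoffel G' m i j y :=
    christoffel_congr_on hU h hy
  have h2 : ∀ a j, pd a (fun z => α z j) y = pd a (fun z => α' z j) y :=
    fun a j => pd_congr_on hU (fun z hz => hα z hz j) hy a
  simp only [codivC, covC, h1, h2, h y hy, hα y hy, Matrix.of_apply]

theorem codivC_sum (G : MatField) {ι : Type*} (s : Finset ι) {α : ι → E3 → Fin 3 → ℝ}
    (hα : ∀ a ∈ s, ∀ j, DifferentiableAt ℝ (fun z => α a z j) y) :
    codivC G (fun z j => ∑ a ∈ s, α a z j) y = ∑ a ∈ s, codivC G (α a) y := by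
  have h : ∀ i j, covC G (fun z j => ∑ a ∈ s, α a z j) y i j = ∑ a ∈ s, covC G (α a) y i j := by
    intro i j
    simp only [covC, Matrix.of_apply, Finset.sum_sub_distrib]
    rw [pd_sum fun a ha => hα a ha j, Finset.sum_comm]
    simp only [Finset.mul_sum]
  simp only [codivC, h, Finset.mul_sum]
  exact (Finset.sum_congr rfl fun i _ => Finset.sum_comm).trans Finset.sum_comm

theorem codivC_zero (G : MatField) (y : E3) : codivC G (fun _ _ => 0) y = 0 := by
  simp [codivC, covC, pd_const]

theorem MetricOn.smooth_codivC (hG : MetricOn G U) (hU : IsOpen U) {α : E3 → Fin 3 → ℝ}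
    (hα : ∀ j, ContDiffOn ℝ ∞ (fun z => α z j) U) : ContDiffOn ℝ ∞ (codivC G α) U := by
  unfold codivC covC
  simp only [Matrix.of_apply]
  exact ContDiffOn.sum fun i _ => ContDiffOn.sum fun j _ => (hG.smooth_inv i j).mul
    ((contDiffOn_pd hU (hα j) i).sub (ContDiffOn.sum fun m _ =>
      (hG.smooth_christoffel hU m i j).mul (hα m)))

theorem MetricOn.smooth_scalarC (hG : MetricOn G U) (hU : IsOpen U) :
    ContDiffOn ℝ ∞ (scalarC G) U := by
  unfold scalarC ricci
  have h1 := fun m i j => hG.smooth_christoffel hU m i j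
  have h2 := fun a m i j => contDiffOn_pd hU (h1 m i j) a
  exact ContDiffOn.sum fun i _ => ContDiffOn.sum fun j _ => (hG.smooth_inv i j).mul
    ((ContDiffOn.sum fun m _ => (h2 _ _ _ _).sub (h2 _ _ _ _)).add
      (ContDiffOn.sum fun m _ => ContDiffOn.sum fun l _ =>
        ((h1 _ _ _).mul (h1 _ _ _)).sub ((h1 _ _ _).mul (h1 _ _ _))))

end Congr

variable {M : Type*} [TopologicalSpace M] [ChartedSpace (EuclideanHalfSpace 3) M]
  {e e' : OpenPartialHomeomorph M E3}

/-! ### The divergence of a covector field on a manifold -/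

/-- The components of a covector field in a chart. -/
noncomputable def acomp (al : M → E3 →ₗ[ℝ] ℝ) (e : OpenPartialHomeomorph M E3) (y : E3)
    (j : Fin 3) : ℝ := al (e.symm y) (cvec e y j)

/-- Smoothness of a covector field on the interior of `M`. -/
def SmoothCovector (al : M → E3 →ₗ[ℝ] ℝ) : Prop :=
  ∀ e, IsCoordChart e → ∀ j, ContDiffOn ℝ ∞ (fun y => acomp al e y j) e.target

/-- A 2-tensor which is a smooth Riemannian metric on the interior of `M`. -/
structure IsMetric (T : Tensor2 M) : Prop where
  bilin : IsBilin T
  metricOn : ∀ e, IsCoordChart e → MetricOn (components T e.toPartialEquiv) e.target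

theorem SmoothCovector.smul {al : M → E3 →ₗ[ℝ] ℝ} (hal : SmoothCovector al) {χ : M → ℝ}
    (hχ : ContMDiffOn (𝓡∂ 3) 𝓘(ℝ, ℝ) ∞ χ ((𝓡∂ 3).interior M)) :
    SmoothCovector fun p => χ p • al p := fun e he j =>
  (he.contDiffOn_comp_symm hχ).mul (hal e he j)

variable [IsManifold (𝓡∂ 3) ∞ M] {T : Tensor2 M} {al : M → E3 →ₗ[ℝ] ℝ}

theorem continuousOn_of_charts {F : M → ℝ}
    (h : ∀ e, IsCoordChart e → ContinuousOn (fun y => F (e.symm y)) e.target) :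
    ContinuousOn F ((𝓡∂ 3).interior M) := fun p hp => by
  have hs := mem_ichart_source hp
  have h1 : ContinuousOn (fun q => F ((ichart p).symm (ichart p q))) (ichart p).source :=
    (h _ (isCoordChart_ichart p)).comp (ichart p).continuousOn fun q hq => (ichart p).map_source hq
  have h2 : ContinuousOn F (ichart p).source :=
    h1.congr fun q hq => congrArg F ((ichart p).left_inv hq).symm
  exact (h2.continuousAt ((ichart p).open_source.mem_nhds hs)).continuousWithinAt

theorem scalarCurvature_eq (hT : IsMetric T) (he : IsCoordChart e) {y : E3} (hy : y ∈ e.target) :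
    scalarCurvature T (e.symm y) = scalarC (components T e.toPartialEquiv) y := by
  have he' := isCoordChart_ichart (e.symm y)
  have hov : y ∈ e.target ∩ e.symm ⁻¹' (ichart (e.symm y)).source :=
    ⟨hy, mem_ichart_source (he.source_subset (e.map_target hy))⟩
  exact ((he.changeOn he').scalarC_eq (hT.metricOn _ he')
    (fun z hz => he.components_transition he' hT.bilin hz) hov).symm

/-- The divergence of a covector field, at interior points. -/
noncomputable def mdiv (T : Tensor2 M) (al : M → E3 →ₗ[ℝ] ℝ) (p : M) : ℝ :=
  codivC (components T (ichart p).toPartialEquiv) (acomp al (ichart p)) (ichart p p)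

/-- The chart in `mdiv` varies with the point; invariance makes it a single smooth expression in any
fixed chart. -/
theorem mdiv_eq (hT : IsMetric T) (hal : SmoothCovector al) (he : IsCoordChart e) {y : E3}
    (hy : y ∈ e.target) :
    mdiv T al (e.symm y) = codivC (components T e.toPartialEquiv) (acomp al e) y := by
  have he' := isCoordChart_ichart (e.symm y)
  have hov : y ∈ e.target ∩ e.symm ⁻¹' (ichart (e.symm y)).source :=
    ⟨hy, mem_ichart_source (he.source_subset (e.map_target hy))⟩
  refine ((he.changeOn he').codivC_eq (hT.metricOn _ he')
    (fun z hz => he.components_transition he' hT.bilin hz) (hal _ he') (fun z hz j => ?_) hov).symm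
  have h1 : (ichart (e.symm y)).symm ((ichart (e.symm y) ∘ e.symm) z) = e.symm z :=
    (ichart (e.symm y)).left_inv hz.2
  rw [acomp, he.cvec_transition he' hz, map_sum]
  simp only [map_smul, smul_eq_mul, acomp, h1]

theorem continuousOn_mdiv (hT : IsMetric T) (hal : SmoothCovector al) :
    ContinuousOn (mdiv T al) ((𝓡∂ 3).interior M) :=
  continuousOn_of_charts fun e he =>
    ((hT.metricOn e he).smooth_codivC e.open_target (hal e he)).continuousOn.congr
      fun _ hy => mdiv_eq hT hal he hy

theorem continuousOn_scalarCurvature (hT : IsMetric T) :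
    ContinuousOn (scalarCurvature T) ((𝓡∂ 3).interior M) :=
  continuousOn_of_charts fun e he =>
    ((hT.metricOn e he).smooth_scalarC e.open_target).continuousOn.congr
      fun _ hy => scalarCurvature_eq hT he hy

/-- The divergence depends only on the germ of the covector field. -/
theorem mdiv_congr {al' : M → E3 →ₗ[ℝ] ℝ} {p : M} (hp : p ∈ (𝓡∂ 3).interior M)
    (h : ∀ᶠ q in 𝓝 p, al q = al' q) : mdiv T al p = mdiv T al' p := by
  obtain ⟨V, hV, hVo, hpV⟩ := eventually_nhds_iff.1 h
  have hs := mem_ichart_source hp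
  refine codivC_congr_on ((ichart p).isOpen_inter_preimage_symm hVo) (fun _ _ => rfl)
    (fun z hz j => ?_) ⟨(ichart p).map_source hs, ?_⟩
  · rw [acomp, acomp, hV _ hz.2]
  · rw [mem_preimage, (ichart p).left_inv hs]; exact hpV

theorem mdiv_zero (p : M) : mdiv T (fun _ => 0) p = 0 := codivC_zero _ _

theorem mdiv_sum {ι : Type*} (s : Finset ι) {al : ι → M → E3 →ₗ[ℝ] ℝ}
    (hal : ∀ a ∈ s, SmoothCovector (al a)) {p : M} (hp : p ∈ (𝓡∂ 3).interior M) :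
    mdiv T (fun q => ∑ a ∈ s, al a q) p = ∑ a ∈ s, mdiv T (al a) p := by
  have h := codivC_sum (components T (ichart p).toPartialEquiv) s
    (α := fun a => acomp (al a) (ichart p)) (y := ichart p p) fun a ha j =>
      diffAt_of_contDiffOn (ichart p).open_target (hal a ha _ (isCoordChart_ichart p) j)
        ((ichart p).map_source (mem_ichart_source hp))
  refine Eq.trans ?_ h
  unfold mdiv
  congr 1
  funext y j
  simp [acomp]

end JangEH

/-! ### Flux densities, local integrability and the divergence theorem in one slice chart. -/

namespace JangEH

/-! ### Extension by zero -/

/-- The half-space divergence theorem needs globally defined fields, whereas the chart expressions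
are only meaningful on the target of the chart. -/
theorem contDiff_indicator {V K : Set E3} (hV : IsOpen V) (hK : IsCompact K) (hKV : K ⊆ V)
    {f : E3 → ℝ} (hf : ContDiffOn ℝ ∞ f V) (h0 : ∀ z ∈ V, z ∉ K → f z = 0) :
    ContDiff ℝ ∞ (V.indicator f) ∧ tsupport (V.indicator f) ⊆ K := by
  have hz : ∀ z, z ∉ K → V.indicator f z = 0 := fun z hz => by
    by_cases h : z ∈ V
    · rw [indicator_of_mem h, h0 z h hz]
    · exact indicator_of_notMem h f
  have hts : tsupport (V.indicator f) ⊆ K :=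
    closure_minimal (fun z h => by by_contra hn; exact h (hz z hn)) hK.isClosed
  refine ⟨contDiff_iff_contDiffAt.2 fun z => ?_, hts⟩
  by_cases h : z ∈ V
  · refine (hf.contDiffAt (hV.mem_nhds h)).congr_of_eventuallyEq ?_
    filter_upwards [hV.mem_nhds h] with w hw
    exact indicator_of_mem hw f
  · refine (contDiffAt_const (c := (0 : ℝ))).congr_of_eventuallyEq ?_
    filter_upwards [hK.isClosed.isOpen_compl.mem_nhds fun hk => h (hKV hk)] with w hw
    exact hz w hw

variable {M : Type*} [TopologicalSpace M] [ChartedSpace (EuclideanHalfSpace 3) M]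
  {e : OpenPartialHomeomorph M E3} [IsManifold (𝓡∂ 3) ∞ M] {T S : Tensor2 M}
  {al : M → E3 →ₗ[ℝ] ℝ} {U : Set M} {B χ : M → ℝ}

/-- `B` is the density, with respect to the area of the frontier of `U` for the metric `S`, of the
flux out of `U` of the vector field which corresponds to `al` under the metric `T`. -/
def IsFluxDensity (T S : Tensor2 M) (al : M → E3 →ₗ[ℝ] ℝ) (U : Set M) (B : M → ℝ) : Prop :=
  ∀ e, IsSliceChart U e → ∀ y, planeIncl y ∈ e.target →
    Real.sqrt (tblock (components S e.toPartialEquiv (planeIncl y))).det *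
        B (e.symm (planeIncl y)) =
      Real.sqrt (components T e.toPartialEquiv (planeIncl y)).det *
        ∑ j, (components T e.toPartialEquiv (planeIncl y))⁻¹ 2 j * acomp al e (planeIncl y) j

theorem tblock_det_pos {G : Matrix (Fin 3) (Fin 3) ℝ} (hG : G.PosDef) : 0 < (tblock G).det :=
  (hG.submatrix (Fin.castSucc_injective 2)).det_pos

omit [IsManifold (𝓡∂ 3) ∞ M] in
theorem continuousOn_tblock (hS : IsMetric S) (he : IsCoordChart e) :
    ContinuousOn (fun y => Real.sqrt (tblock (components S e.toPartialEquiv (planeIncl y))).det)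
      (planeIncl ⁻¹' e.target) := by
  refine Real.continuous_sqrt.comp_continuousOn ?_
  have h1 : ∀ i j, ContinuousOn (fun y => components S e.toPartialEquiv (planeIncl y) i j)
      (planeIncl ⁻¹' e.target) := fun i j =>
    ((hS.metricOn e he).smooth i j).continuousOn.comp continuous_planeIncl.continuousOn
      fun _ hy => hy
  simp only [tblock, Matrix.det_fin_two, Matrix.submatrix_apply]
  exact ((h1 _ _).mul (h1 _ _)).sub ((h1 _ _).mul (h1 _ _))

theorem mdiv_smul_eq_zero {p : M} (hp : p ∈ (𝓡∂ 3).interior M) (h : p ∉ tsupport χ) :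
    mdiv T (fun q => χ q • al q) p = 0 := by
  rw [← mdiv_zero (T := T) p]
  refine mdiv_congr hp ?_
  filter_upwards [notMem_tsupport_iff_eventuallyEq.1 h] with q hq
  rw [hq]; simp

variable [MeasurableSpace M] [BorelSpace M] [SecondCountableTopology M]

/-- The volume measure is finite on compact subsets of the interior. -/
theorem volumeMeasure_lt_top (hT : IsMetric T) {K : Set M} (hK : IsCompact K)
    (hKi : K ⊆ (𝓡∂ 3).interior M) : volumeMeasure T K < ⊤ := by
  refine hK.measure_lt_top_of_nhdsWithin fun p hp => ?_
  have he := isCoordChart_ichart p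
  have hs := mem_ichart_source (hKi hp)
  obtain ⟨r, hr, hball⟩ := Metric.nhds_basis_closedBall.mem_iff.1
    ((ichart p).open_target.mem_nhds ((ichart p).map_source hs))
  have hN : IsOpen ((ichart p).source ∩ ichart p ⁻¹' Metric.ball (ichart p p) r) :=
    (ichart p).isOpen_inter_preimage Metric.isOpen_ball
  refine ⟨_, nhdsWithin_le_nhds (hN.mem_nhds ⟨hs, Metric.mem_ball_self hr⟩), ?_⟩
  have h1 : volumeMeasure T ((ichart p).source ∩ ichart p ⁻¹' Metric.ball (ichart p p) r) =
      chartVolume T (ichart p) ((ichart p).source ∩ ichart p ⁻¹' Metric.ball (ichart p p) r) := by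
    rw [← he.volumeMeasure_restrict hT.bilin, Measure.restrict_apply hN.measurableSet,
      inter_eq_left.2 inter_subset_left]
  have h2 := paramMeasure_apply
    (ρ := fun y => Real.sqrt (components T (ichart p).toPartialEquiv y).det)
    (ichart p).open_target (ichart p).continuousOn_symm hN.measurableSet
  rw [h1]
  refine lt_of_eq_of_lt h2 ?_
  have hc : ContinuousOn (fun y => Real.sqrt (components T (ichart p).toPartialEquiv y).det)
      (Metric.closedBall (ichart p p) r) := (Real.continuous_sqrt.comp_continuousOn
    ((hT.metricOn _ he).smooth.det.continuousOn)).mono hball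
  obtain ⟨C, hC⟩ := (isCompact_closedBall (ichart p p) r).exists_bound_of_continuousOn hc
  have hsub : (ichart p).target ∩ (ichart p).symm ⁻¹'
      ((ichart p).source ∩ ichart p ⁻¹' Metric.ball (ichart p p) r) ⊆
      Metric.closedBall (ichart p p) r := fun y hy => by
    have := hy.2.2
    rw [mem_preimage, (ichart p).right_inv hy.1] at this
    exact Metric.ball_subset_closedBall this
  refine (lintegral_mono_set hsub).trans_lt ?_
  calc ∫⁻ y in Metric.closedBall (ichart p p) r,
        ENNReal.ofReal (Real.sqrt (components T (ichart p).toPartialEquiv y).det)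
      ≤ ∫⁻ y in Metric.closedBall (ichart p p) r, ENNReal.ofReal C :=
        setLIntegral_mono measurable_const fun y hy =>
          ENNReal.ofReal_le_ofReal ((le_abs_self _).trans (hC y hy))
    _ < ⊤ := by
      rw [setLIntegral_const]
      exact ENNReal.mul_lt_top ENNReal.ofReal_lt_top
        (isCompact_closedBall (ichart p p) r).measure_lt_top

theorem integrableOn_of_compact (hT : IsMetric T) {F : M → ℝ}
    (hF : ContinuousOn F ((𝓡∂ 3).interior M)) {K : Set M} (hK : IsCompact K)
    (hKm : MeasurableSet K) (hKi : K ⊆ (𝓡∂ 3).interior M) :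
    IntegrableOn F K (volumeMeasure T) := by
  obtain ⟨C, hC⟩ := hK.exists_bound_of_continuousOn (hF.mono hKi)
  have : IsFiniteMeasure ((volumeMeasure T).restrict K) :=
    ⟨by rw [Measure.restrict_apply_univ]; exact volumeMeasure_lt_top hT hK hKi⟩
  refine Integrable.of_bound ((hF.mono hKi).aestronglyMeasurable hKm) C ?_
  exact (ae_restrict_iff' hKm).2 (Eventually.of_forall hC)

variable [T2Space M]

/-- The divergence theorem for covector fields supported in one slice chart. -/
theorem chart_divergence (hT : IsMetric T) (hS : IsMetric S) (hal : SmoothCovector al)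
    (hU : IsOpen U) (hB : IsFluxDensity T S al U B) (he : IsSliceChart U e)
    (hχ : ContMDiff (𝓡∂ 3) 𝓘(ℝ, ℝ) ∞ χ) (hc : HasCompactSupport χ) (hsub : tsupport χ ⊆ e.source) :
    ∫ p in U, mdiv T (fun q => χ q • al q) p ∂volumeMeasure T =
        ∫ p, χ p * B p ∂areaMeasure S U ∧
      Integrable (fun p => χ p * B p) (areaMeasure S U) := by
  have hec := he.isCoordChart
  have hG := hT.metricOn e hec
  set G := components T e.toPartialEquiv with hGdef
  have hχi : ContMDiffOn (𝓡∂ 3) 𝓘(ℝ, ℝ) ∞ χ ((𝓡∂ 3).interior M) := hχ.contMDiffOn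
  have hal' := hal.smul hχi
  set K : Set E3 := e '' tsupport χ
  have hK : IsCompact K := hc.image_of_continuousOn (e.continuousOn.mono hsub)
  have hKt : K ⊆ e.target := by rintro _ ⟨p, hp, rfl⟩; exact e.map_source (hsub hp)
  have hKχ : ∀ z ∈ e.target, z ∉ K → χ (e.symm z) = 0 := fun z hz hzK => by
    by_contra h
    exact hzK ⟨e.symm z, subset_tsupport χ h, e.right_inv hz⟩
  -- The volume density times the vector field dual to χ α: its Euclidean divergence is the density
  -- times the covariant divergence, by `sqrt_det_mul_codivC`.
  set fl : Fin 3 → E3 → ℝ := fun i z => Real.sqrt (G z).det *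
    ∑ j, (G z)⁻¹ i j * (χ (e.symm z) * acomp al e z j) with hfl
  have hsq : ContDiffOn ℝ ∞ (fun z => Real.sqrt (G z).det) e.target :=
    hG.smooth.det.sqrt fun z hz => (hG.det_pos hz).ne'
  have hfls : ∀ i, ContDiffOn ℝ ∞ (fl i) e.target := fun i =>
    hsq.mul (ContDiffOn.sum fun j _ => (hG.smooth_inv i j).mul (hal' e hec j))
  have hfl0 : ∀ i, ∀ z ∈ e.target, z ∉ K → fl i z = 0 := fun i z hz hzK => by
    simp [hfl, hKχ z hz hzK]
  have hind := fun i => contDiff_indicator e.open_target hK hKt (hfls i) (hfl0 i)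
  have main := integral_divergence_halfSpace (F := fun i => e.target.indicator (fl i))
    (fun i => (hind i).1.of_le (by exact_mod_cast le_top))
    (fun i => HasCompactSupport.of_support_subset_isCompact hK
      (subset_closure.trans (hind i).2))
  have hinv : ∀ y ∈ e.target, e.symm y ∈ e.source ∧ e (e.symm y) = y :=
    fun y hy => ⟨e.map_target hy, e.right_inv hy⟩
  have hUm := hU.measurableSet
  -- the volume integral
  have hdivc := continuousOn_mdiv hT hal'
  have hvol : ∫ p in U, mdiv T (fun q => χ q • al q) p ∂volumeMeasure T =
      ∫ x in {x : E3 | x 2 < 0}, ∑ i, pd i (e.target.indicator (fl i)) x := by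
    -- The divergence vanishes at interior points outside the support of χ, hence outside the chart,
    -- and the rest of the manifold carries no volume.
    have h1 : ∫ p in U, mdiv T (fun q => χ q • al q) p ∂volumeMeasure T =
        ∫ p in U, mdiv T (fun q => χ q • al q) p ∂chartVolume T e := by
      rw [← hec.volumeMeasure_restrict hT.bilin, Measure.restrict_restrict hUm,
        ← integral_indicator hUm, ← integral_indicator (hUm.inter e.open_source.measurableSet)]
      refine integral_congr_ae ?_
      filter_upwards [show ∀ᵐ p ∂volumeMeasure T, p ∈ (𝓡∂ 3).interior M from
        volumeMeasure_compl_interior hT.bilin] with p hp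
      by_cases hpU : p ∈ U
      · by_cases hpe : p ∈ e.source
        · rw [indicator_of_mem hpU, indicator_of_mem (show p ∈ U ∩ e.source from ⟨hpU, hpe⟩)]
        · rw [indicator_of_mem hpU, mdiv_smul_eq_zero hp fun h => hpe (hsub h),
            indicator_of_notMem (show p ∉ U ∩ e.source from fun h => hpe h.2)]
      · rw [indicator_of_notMem hpU, indicator_of_notMem (show p ∉ U ∩ e.source from
          fun h => hpU h.1)]
    have h2 := setIntegral_paramMeasure (ρ := fun y => Real.sqrt (G y).det) (ψ := e.symm)
      e.open_target e.continuousOn_symm hsq.continuousOn (fun y _ => Real.sqrt_nonneg _)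
      (F := mdiv T (fun q => χ q • al q))
      (aestronglyMeasurable_param e.open_target e.continuousOn_symm e.open_source e.continuousOn hinv
        (hdivc.comp e.continuousOn_symm fun y hy => hec.source_subset (e.map_target hy))) hUm
    rw [h1]
    refine h2.trans ?_
    have hset : e.target ∩ e.symm ⁻¹' U = e.target ∩ {x : E3 | x 2 < 0} := by
      ext y
      simp only [mem_inter_iff, mem_preimage, mem_ofPred_eq]
      refine and_congr_right fun hy => ?_
      rw [he.mem_iff _ (e.map_target hy), e.right_inv hy]
    have hmH : MeasurableSet {x : E3 | x 2 < 0} :=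
      (isOpen_lt (EuclideanSpace.proj 2 : E3 →L[ℝ] ℝ).continuous continuous_const).measurableSet
    rw [hset]
    refine (setIntegral_congr_fun (e.open_target.measurableSet.inter hmH) fun y hy => ?_).trans
      (setIntegral_eq_of_subset_of_forall_sdiff_eq_zero hmH inter_subset_right fun x hx => ?_).symm
    · rw [mdiv_eq hT hal' hec hy.1, ← hG.sqrt_det_mul_codivC e.open_target
        (fun j => (hal' e hec j).differentiableOn (by simp)) hy.1]
      exact Finset.sum_congr rfl fun i _ => pd_congr_on e.open_target
        (fun z hz => (indicator_of_mem hz (fl i)).symm) hy.1 i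
    · have hxt : x ∉ e.target := fun h => hx.2 ⟨h, hx.1⟩
      exact Finset.sum_eq_zero fun i _ =>
        pd_eq_zero_of_notMem_tsupport (fun h => hxt (hKt ((hind i).2 h))) i
  -- the area integral
  set t := planeIncl ⁻¹' e.target with ht
  have hto : IsOpen t := IsSliceChart.slice_isOpen e
  have hψ := IsSliceChart.slice_continuousOn e
  set ρ : EuclideanSpace ℝ (Fin 2) → ℝ :=
    fun y => Real.sqrt (tblock (components S e.toPartialEquiv (planeIncl y))).det
  have hρ : ContinuousOn ρ t := continuousOn_tblock hS hec
  have hρpos : ∀ y ∈ t, 0 < ρ y := fun y hy =>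
    Real.sqrt_pos.2 (tblock_det_pos ((hS.metricOn e hec).posDef _ hy))
  have hflc : ContinuousOn (fun y => fl 2 (planeIncl y)) t :=
    (hfls 2).continuousOn.comp continuous_planeIncl.continuousOn fun _ hy => hy
  have hBy : ∀ y ∈ t, ρ y * (χ (e.symm (planeIncl y)) * B (e.symm (planeIncl y))) =
      fl 2 (planeIncl y) := fun y hy => by
    have := hB e he y hy
    simp only [hfl]
    calc _ = χ (e.symm (planeIncl y)) * (ρ y * B (e.symm (planeIncl y))) := by ring
      _ = _ := by rw [this]; simp only [Finset.mul_sum]; exact Finset.sum_congr rfl fun j _ => by ring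
  -- Nothing is assumed about the regularity of B, which involves a chosen chart; dividing the flux
  -- relation by the positive area density shows that χ B is continuous in the parameters.
  have hFc : ContinuousOn (fun y => χ (e.symm (planeIncl y)) * B (e.symm (planeIncl y))) t := by
    refine (hflc.div hρ fun y hy => (hρpos y hy).ne').congr fun y hy => ?_
    simp only [Pi.div_apply]
    rw [← hBy y hy, mul_div_cancel_left₀ _ (hρpos y hy).ne']
  have hmeas : AEStronglyMeasurable (fun p => χ p * B p)
      (paramMeasure t ρ fun y => e.symm (planeIncl y)) :=
    aestronglyMeasurable_param hto hψ e.open_source (χ := fun p => planeProj (e p))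
      (planeProjL.continuous.comp_continuousOn e.continuousOn)
      (fun y hy => ⟨e.map_target hy, by rw [e.right_inv hy, planeProj_planeIncl]⟩) hFc
  have hindt : ∀ y, e.target.indicator (fl 2) (planeIncl y) =
      t.indicator (fun y => fl 2 (planeIncl y)) y := fun y => by
    by_cases hy : y ∈ t
    · rw [indicator_of_mem hy, indicator_of_mem (show planeIncl y ∈ e.target from hy)]
    · rw [indicator_of_notMem hy, indicator_of_notMem (show planeIncl y ∉ e.target from hy)]
  have hint : IntegrableOn (fun y => fl 2 (planeIncl y)) t := by
    rw [← integrable_indicator_iff hto.measurableSet]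
    have hcont : Continuous fun y => e.target.indicator (fl 2) (planeIncl y) :=
      (hind 2).1.continuous.comp continuous_planeIncl
    refine (hcont.integrable_of_hasCompactSupport ?_).congr
      (Eventually.of_forall fun y => hindt y)
    have hcl : Topology.IsClosedEmbedding planeIncl := by
      refine Topology.IsClosedEmbedding.of_continuous_injective_isClosedMap continuous_planeIncl
        (Function.LeftInverse.injective planeProj_planeIncl) ?_
      exact (LinearMap.isClosedEmbedding_of_injective (f := planeInclL.toLinearMap)
        (LinearMap.ker_eq_bot.2 (Function.LeftInverse.injective (g := planeProj)
          planeProj_planeIncl))).isClosedMap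
    exact (HasCompactSupport.of_support_subset_isCompact hK
      (subset_closure.trans (hind 2).2)).comp_isClosedEmbedding hcl
  have hintB : IntegrableOn (fun y => ρ y * (χ (e.symm (planeIncl y)) *
      B (e.symm (planeIncl y)))) t :=
    hint.congr_fun (fun y hy => (hBy y hy).symm) hto.measurableSet
  have hiP := integrable_paramMeasure hto hψ hρ (fun y hy => (hρpos y hy).le) hmeas hintB
  have hiS : IntegrableOn (fun p => χ p * B p) e.source (areaMeasure S U) := by
    rw [IntegrableOn, IsSliceChart.areaMeasure_restrict hS.bilin he]
    exact hiP
  have hzero : ∀ p, p ∉ e.source → χ p * B p = 0 := fun p hp => by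
    rw [image_eq_zero_of_notMem_tsupport fun h => hp (hsub h), zero_mul]
  refine ⟨?_, (integrableOn_iff_integrable_of_support_subset fun p hp => ?_).1 hiS⟩
  · rw [hvol, main]
    simp only [hindt]
    rw [integral_indicator hto.measurableSet,
      ← setIntegral_eq_integral_of_forall_compl_eq_zero (s := e.source) hzero,
      IsSliceChart.areaMeasure_restrict hS.bilin he]
    have h3 := setIntegral_paramMeasure hto hψ hρ (fun y hy => (hρpos y hy).le) hmeas
      MeasurableSet.univ
    rw [Measure.restrict_univ, preimage_univ, inter_univ] at h3
    refine Eq.trans ?_ h3.symm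
    exact setIntegral_congr_fun hto.measurableSet fun y hy => (hBy y hy).symm
  · by_contra h
    exact hp (hzero p h)

end JangEH

namespace JangEH

variable {M : Type*} [TopologicalSpace M] [ChartedSpace (EuclideanHalfSpace 3) M]
  {e : OpenPartialHomeomorph M E3}

/-! ### Construction of charts -/

theorem IsCoordChart.trans (he : IsCoordChart e) {φ : OpenPartialHomeomorph E3 E3}
    (hφ : ContDiffOn ℝ ∞ φ φ.source) (hφ' : ContDiffOn ℝ ∞ φ.symm φ.target) :
    IsCoordChart (e.trans φ) where
  source_subset := fun p hp => he.source_subset (by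
    rw [OpenPartialHomeomorph.trans_source] at hp; exact hp.1)
  smooth := by
    rw [OpenPartialHomeomorph.trans_source]
    exact (contMDiffOn_iff_contDiffOn.2 hφ).comp (he.smooth.mono inter_subset_left) fun p hp => hp.2
  smooth_symm := by
    rw [OpenPartialHomeomorph.trans_target]
    exact he.smooth_symm.comp ((contMDiffOn_iff_contDiffOn.2 hφ').mono inter_subset_left)
      fun p hp => hp.2

theorem IsCoordChart.exists_translate (he : IsCoordChart e) {V : Set E3} (hV : IsOpen V) (c : E3) :
    ∃ e' : OpenPartialHomeomorph M E3, IsCoordChart e' ∧ e'.source = e.source ∩ e ⁻¹' V ∧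
      ∀ p, e' p = e p + c := by
  refine ⟨e.trans ((OpenPartialHomeomorph.ofSet V hV).trans
    (Homeomorph.addRight c).toOpenPartialHomeomorph), he.trans ?_ ?_, ?_, fun p => rfl⟩
  · exact (contDiff_id.add contDiff_const).contDiffOn
  · have : ContDiff ℝ ∞ (fun x : E3 => x + -c) := contDiff_id.add contDiff_const
    exact this.contDiffOn
  · simp

variable [IsManifold (𝓡∂ 3) ∞ M]

/-- A translated and shrunk chart avoiding the plane x₂ = 0. With W = U it is a slice chart around a
point of U, although no part of the frontier is in it. -/
theorem exists_chart_neg {W : Set M} (hW : IsOpen W) {p : M} (hp : p ∈ (𝓡∂ 3).interior M)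
    (hpW : p ∈ W) : ∃ e : OpenPartialHomeomorph M E3, IsCoordChart e ∧ p ∈ e.source ∧
      e.source ⊆ W ∧ ∀ q ∈ e.source, e q 2 < 0 := by
  have hs := mem_ichart_source hp
  have hlt : IsOpen {z : E3 | z 2 < ichart p p 2 + 1} :=
    isOpen_lt (EuclideanSpace.proj 2 : E3 →L[ℝ] ℝ).continuous continuous_const
  obtain ⟨e, he, hsrc, hval⟩ := (isCoordChart_ichart p).exists_translate
    (((ichart p).isOpen_inter_preimage_symm hW).inter hlt) (-(ichart p p 2 + 1) • basisVec 2)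
  refine ⟨e, he, ?_, fun q hq => ?_, fun q hq => ?_⟩
  · rw [hsrc]
    refine ⟨hs, ⟨(ichart p).map_source hs, ?_⟩, ?_⟩
    · rw [mem_preimage, (ichart p).left_inv hs]; exact hpW
    · change ichart p p 2 < ichart p p 2 + 1
      linarith
  · rw [hsrc] at hq
    have := hq.2.1.2
    rwa [mem_preimage, (ichart p).left_inv hq.1] at this
  · rw [hsrc] at hq
    have h2 : ichart p q 2 < ichart p p 2 + 1 := hq.2.2
    rw [hval]
    simp only [basisVec, PiLp.add_apply, PiLp.smul_apply, PiLp.single_apply, smul_eq_mul, if_true]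
    linarith

/-- The counterpart for points outside the closure of U, with W the complement of the closure. -/
theorem exists_chart_pos {W : Set M} (hW : IsOpen W) {p : M} (hp : p ∈ (𝓡∂ 3).interior M)
    (hpW : p ∈ W) : ∃ e : OpenPartialHomeomorph M E3, IsCoordChart e ∧ p ∈ e.source ∧
      e.source ⊆ W ∧ ∀ q ∈ e.source, 0 < e q 2 := by
  have hs := mem_ichart_source hp
  have hlt : IsOpen {z : E3 | ichart p p 2 - 1 < z 2} :=
    isOpen_lt continuous_const (EuclideanSpace.proj 2 : E3 →L[ℝ] ℝ).continuous
  obtain ⟨e, he, hsrc, hval⟩ := (isCoordChart_ichart p).exists_translate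
    (((ichart p).isOpen_inter_preimage_symm hW).inter hlt) (-(ichart p p 2 - 1) • basisVec 2)
  refine ⟨e, he, ?_, fun q hq => ?_, fun q hq => ?_⟩
  · rw [hsrc]
    refine ⟨hs, ⟨(ichart p).map_source hs, ?_⟩, ?_⟩
    · rw [mem_preimage, (ichart p).left_inv hs]; exact hpW
    · change ichart p p 2 - 1 < ichart p p 2
      linarith
  · rw [hsrc] at hq
    have := hq.2.1.2
    rwa [mem_preimage, (ichart p).left_inv hq.1] at this
  · rw [hsrc] at hq
    have h2 : ichart p p 2 - 1 < ichart p q 2 := hq.2.2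
    rw [hval]
    simp only [basisVec, PiLp.add_apply, PiLp.smul_apply, PiLp.single_apply, smul_eq_mul, if_true]
    linarith

/-- Every interior point lies in a slice chart of a smooth domain. -/
theorem IsSmoothDomain.exists_slice_interior {U : Set M} (hU : IsSmoothDomain U) {p : M}
    (hp : p ∈ (𝓡∂ 3).interior M) :
    ∃ e : OpenPartialHomeomorph M E3, IsSliceChart U e ∧ p ∈ e.source := by
  by_cases hf : p ∈ frontier U
  · exact hU.exists_slice p hf
  by_cases hpU : p ∈ U
  · obtain ⟨e, he, hpe, hsub, hneg⟩ := exists_chart_neg hU.isOpen hp hpU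
    exact ⟨e, ⟨he, fun q hq => ⟨fun _ => hneg q hq, fun _ => hsub hq⟩⟩, hpe⟩
  · have hc : p ∉ closure U := fun h => hf (by
      rw [frontier, hU.isOpen.interior_eq]; exact ⟨h, hpU⟩)
    obtain ⟨e, he, hpe, hsub, hpos⟩ := exists_chart_pos isClosed_closure.isOpen_compl hp hc
    exact ⟨e, ⟨he, fun q hq => ⟨fun h => absurd (subset_closure h) (hsub hq),
      fun h => absurd h (hpos q hq).not_gt⟩⟩, hpe⟩

/-! ### The divergence theorem -/

variable [MeasurableSpace M] [BorelSpace M] [SecondCountableTopology M] [T2Space M]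
  {T S : Tensor2 M} {al : M → E3 →ₗ[ℝ] ℝ} {U : Set M} {B χ : M → ℝ}

omit [T2Space M] in
theorem integrable_mdiv_smul (hT : IsMetric T) (hal : SmoothCovector al)
    (hχ : ContMDiff (𝓡∂ 3) 𝓘(ℝ, ℝ) ∞ χ) (hc : HasCompactSupport χ)
    (hi : tsupport χ ⊆ (𝓡∂ 3).interior M) :
    Integrable (mdiv T fun q => χ q • al q) (volumeMeasure T) := by
  have hm : MeasurableSet (tsupport χ) := (isClosed_tsupport χ).measurableSet
  have h1 := integrableOn_of_compact hT (continuousOn_mdiv hT (hal.smul hχ.contMDiffOn)) hc hm hi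
  refine ((integrable_indicator_iff hm).2 h1).congr ?_
  filter_upwards [show ∀ᵐ p ∂volumeMeasure T, p ∈ (𝓡∂ 3).interior M from
        volumeMeasure_compl_interior hT.bilin] with p hp
  by_cases h : p ∈ tsupport χ
  · rw [indicator_of_mem h]
  · rw [indicator_of_notMem h, mdiv_smul_eq_zero hp h]

/-- The divergence theorem on a smooth domain, for covector fields compactly supported in the
interior of the manifold. -/
theorem IsSmoothDomain.divergence (hU : IsSmoothDomain U) (hT : IsMetric T) (hS : IsMetric S)
    (hal : SmoothCovector al) (hB : IsFluxDensity T S al U B)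
    (hχ : ContMDiff (𝓡∂ 3) 𝓘(ℝ, ℝ) ∞ χ) (hc : HasCompactSupport χ)
    (hi : tsupport χ ⊆ (𝓡∂ 3).interior M) :
    ∫ p in U, mdiv T (fun q => χ q • al q) p ∂volumeMeasure T =
      ∫ p, χ p * B p ∂areaMeasure S U := by
  have : LocallyCompactSpace M := Manifold.locallyCompact_of_finiteDimensional (𝓡∂ 3)
  have hex : ∀ p : tsupport χ, ∃ e : OpenPartialHomeomorph M E3, IsSliceChart U e ∧ p.1 ∈ e.source :=
    fun p => hU.exists_slice_interior (hi p.2)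
  choose ec hec hpec using hex
  -- The support of χ is covered by slice charts, including those which miss the frontier;
  -- compactness leaves finitely many members of the partition, each covered by `chart_divergence`.
  obtain ⟨f, hf⟩ := SmoothPartitionOfUnity.exists_isSubordinate (𝓡∂ 3) (isClosed_tsupport χ)
    (fun p => (ec p).source) (fun p => (ec p).open_source)
    (fun p hp => mem_iUnion.2 ⟨⟨p, hp⟩, hpec ⟨p, hp⟩⟩)
  have hfin := f.locallyFinite.finite_nonempty_inter_compact hc
  set s := hfin.toFinset
  have hsum : ∀ p ∈ tsupport χ, ∑ i ∈ s, f i p = 1 := fun p hp => by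
    rw [← f.sum_eq_one hp]
    refine (finsum_eq_sum_of_support_subset _ fun i hi' => ?_).symm
    exact (Finite.mem_toFinset hfin).2 ⟨p, hi', hp⟩
  have hdec : ∀ p, χ p = ∑ i ∈ s, f i p * χ p := fun p => by
    by_cases hp : p ∈ tsupport χ
    · rw [← Finset.sum_mul, hsum p hp, one_mul]
    · simp [image_eq_zero_of_notMem_tsupport hp]
  have hsm : ∀ i, ContMDiff (𝓡∂ 3) 𝓘(ℝ, ℝ) ∞ (fun p => f i p * χ p) := fun i =>
    (f i).contMDiff.mul hχ
  have hcs : ∀ i, HasCompactSupport (fun p => f i p * χ p) := fun i => hc.mul_left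
  have hsub : ∀ i, tsupport (fun p => f i p * χ p) ⊆ (ec i).source := fun i =>
    (tsupport_mul_subset_left).trans (hf i)
  have hint : ∀ i, tsupport (fun p => f i p * χ p) ⊆ (𝓡∂ 3).interior M := fun i =>
    (tsupport_mul_subset_right).trans hi
  have hch := fun i => chart_divergence hT hS hal hU.isOpen hB (hec i) (hsm i) (hcs i) (hsub i)
  have h1 : ∫ p, χ p * B p ∂areaMeasure S U = ∑ i ∈ s, ∫ p, f i p * χ p * B p ∂areaMeasure S U := by
    rw [← integral_finsetSum s fun i _ => (hch i).2]
    refine integral_congr_ae (Eventually.of_forall fun p => ?_)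
    simp only
    conv_lhs => rw [hdec p, Finset.sum_mul]
  have h2 : ∫ p in U, mdiv T (fun q => χ q • al q) p ∂volumeMeasure T =
      ∑ i ∈ s, ∫ p in U, mdiv T (fun q => (f i q * χ q) • al q) p ∂volumeMeasure T := by
    rw [← integral_finsetSum s fun i _ =>
      (integrable_mdiv_smul hT hal (hsm i) (hcs i) (hint i)).integrableOn]
    refine integral_congr_ae (ae_restrict_of_ae ?_)
    filter_upwards [show ∀ᵐ p ∂volumeMeasure T, p ∈ (𝓡∂ 3).interior M from
        volumeMeasure_compl_interior hT.bilin] with p hp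
    have h3 : (fun q => χ q • al q) = fun q => ∑ i ∈ s, (f i q * χ q) • al q := by
      funext q
      rw [← Finset.sum_smul, ← hdec q]
    rw [h3]
    exact mdiv_sum s (fun i _ => hal.smul (hsm i).contMDiffOn) hp
  rw [h1, h2]
  exact Finset.sum_congr rfl fun i _ => (hch i).1

end JangEH

namespace JangEH

/-! ### Algebra of the flux densities -/

/-- Cramer's rule: the tangential determinant is the cofactor of the last diagonal entry. -/
theorem det_tblock (G : Matrix (Fin 3) (Fin 3) ℝ) (h : G.det ≠ 0) :
    (tblock G).det = G⁻¹ 2 2 * G.det := by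
  have : G⁻¹ 2 2 = G.det⁻¹ * G.adjugate 2 2 := by simp [Matrix.inv_def]
  rw [this, mul_comm, mul_inv_cancel_left₀ h, Matrix.adjugate_fin_three]
  simp [tblock, Matrix.det_fin_two]

theorem inv_two_two_pos {G : Matrix (Fin 3) (Fin 3) ℝ} (hG : G.PosDef) : 0 < G⁻¹ 2 2 := by
  have h := det_tblock G hG.det_pos.ne'
  have h1 := tblock_det_pos hG
  rw [h] at h1
  exact (pos_iff_pos_of_mul_pos h1).2 hG.det_pos

/-- The area density is the volume density times (G²²)^{1/2}, which cancels the normalization of the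
unit normal. -/
theorem sqrt_det_tblock_mul {G : Matrix (Fin 3) (Fin 3) ℝ} (hG : G.PosDef) (x : ℝ) :
    Real.sqrt (tblock G).det * (x / Real.sqrt (G⁻¹ 2 2)) = Real.sqrt G.det * x := by
  have h0 := Real.sqrt_pos.2 (inv_two_two_pos hG)
  rw [det_tblock G hG.det_pos.ne', Real.sqrt_mul (inv_two_two_pos hG).le]
  field_simp

/-- The determinant of a rank-one perturbation: det (g + w wᵀ) = (1 + |w|²) det g with w = φ df. -/
theorem MetricOn.det_gbarC {G : MatField} {F Φ : E3 → ℝ} {U : Set E3} (hG : MetricOn G U) {y : E3}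
    (hy : y ∈ U) : (gbarC G F Φ y).det = lapC G F Φ y ^ 2 * (G y).det := by
  have h0 := (hG.det_pos hy).ne'
  have hA : ∀ i j, (G y)⁻¹ i j = (G y).det⁻¹ * (G y).adjugate i j := fun i j => by
    simp [Matrix.inv_def]
  have hd : dnC G F y * (G y).det = ∑ i, (∑ j, (G y).adjugate i j * pd j F y) * pd i F y := by
    simp only [dnC, hA, Fin.sum_univ_three]
    field_simp
  rw [hG.lapC_sq hy, add_mul, one_mul, mul_assoc, hd, Matrix.adjugate_fin_three]
  simp [gbarC, Matrix.det_fin_three, Fin.sum_univ_three]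
  ring

/-- Identifies the denominator (1 - |v|²)^{1/2} of the inner flux with the reciprocal of the lapse,
hence with the ratio of the volume densities of g and ḡ. -/
theorem MetricOn.one_sub_normSq_vC {G : MatField} {F Φ : E3 → ℝ} {U : Set E3} (hG : MetricOn G U)
    {y : E3} (hy : y ∈ U) :
    1 - ∑ i, ∑ j, vC G F Φ y i * vC G F Φ y j * G y i j = (lapC G F Φ y ^ 2)⁻¹ := by
  have hl := hG.lapC_pos (F := F) (Φ := Φ) hy
  have h1 : ∀ i, ∑ j, vC G F Φ y j * G y i j = Φ y / lapC G F Φ y * pd i F y := by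
    intro i
    have e1 : ∀ k, ∑ j, G y i j * (G y)⁻¹ j k = if i = k then 1 else 0 := fun k => by
      rw [← Matrix.mul_apply, hG.mul_inv hy, Matrix.one_apply]
    have e2 : ∑ j, vC G F Φ y j * G y i j =
        Φ y / lapC G F Φ y * ∑ k, (∑ j, G y i j * (G y)⁻¹ j k) * pd k F y := by
      simp only [vC, Fin.sum_univ_three]; ring
    rw [e2]; simp [e1]
  have h2 : ∑ i, ∑ j, vC G F Φ y i * vC G F Φ y j * G y i j =
      Φ y ^ 2 * dnC G F y / lapC G F Φ y ^ 2 := by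
    have : ∀ i, ∑ j, vC G F Φ y i * vC G F Φ y j * G y i j =
        vC G F Φ y i * (Φ y / lapC G F Φ y * pd i F y) := fun i => by
      rw [← h1 i, Finset.mul_sum]
      exact Finset.sum_congr rfl fun j _ => by ring
    simp only [this]
    simp only [vC, dnC, Fin.sum_univ_three]
    field_simp
  rw [h2]
  have := hG.lapC_sq (F := F) (Φ := Φ) hy
  field_simp
  linarith

variable {M : Type*} [TopologicalSpace M] [ChartedSpace (EuclideanHalfSpace 3) M]
  {e : OpenPartialHomeomorph M E3} [IsManifold (𝓡∂ 3) ∞ M] (D : CauchyData M) (f φ : M → ℝ)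

/-! ### The flux covector field -/

/-- The covector field `φ (h - k)(v, ·)`. -/
noncomputable def fluxForm (p : M) : E3 →ₗ[ℝ] ℝ :=
  φ p • (isBilin_hMinusK D f φ p).choose (vField D f φ p : E3)

theorem fluxForm_apply (p : M) (w : E3) :
    fluxForm D f φ p w = φ p * tval (hMinusK D f φ) p (vField D f φ p : E3) w :=
  (congrArg (fun r => φ p * r)
    ((isBilin_hMinusK D f φ p).choose_spec (vField D f φ p : E3) w)).symm

variable {D f φ}
variable (hf : ContMDiffOn (𝓡∂ 3) 𝓘(ℝ, ℝ) ∞ f ((𝓡∂ 3).interior M))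
  (hφ : ContMDiffOn (𝓡∂ 3) 𝓘(ℝ, ℝ) ∞ φ ((𝓡∂ 3).interior M))

include hf hφ

theorem acomp_fluxForm (he : IsCoordChart e) {y : E3} (hy : y ∈ e.target) (j : Fin 3) :
    acomp (fluxForm D f φ) e y j = fluxC (components D.gT e.toPartialEquiv)
      (components D.kT e.toPartialEquiv) (f ∘ e.symm) (φ ∘ e.symm) y j := by
  rw [acomp, fluxForm_apply, fluxC, ← he.components_hMinusK hf hφ hy]
  obtain ⟨Bl, hBl⟩ := isBilin_hMinusK D f φ (e.symm y)
  simp only [components_apply, hBl]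
  have h := he.vField_eq (D := D) (φ := φ) hf hy
  rw [h, hBl, map_sum, LinearMap.sum_apply]
  simp only [map_smul, LinearMap.smul_apply, smul_eq_mul]
  rfl

theorem smoothCovector_fluxForm : SmoothCovector (fluxForm D f φ) := fun e he j =>
  ((he.metricOn_gT D).smooth_fluxC e.open_target (he.contDiffOn_comp_symm hf)
    (he.contDiffOn_comp_symm hφ) (he.smooth_kT D) j).congr fun _ hy => acomp_fluxForm hf hφ he hy j

theorem isMetric_gBar : IsMetric (gBar D f φ) :=
  ⟨isBilin_gBar D f φ, fun _ he => he.metricOn_gBar hf hφ⟩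

omit hf hφ in
theorem isMetric_gT : IsMetric D.gT := ⟨D.isBilin_gT, fun _ he => he.metricOn_gT D⟩

/-- The Schoen–Yau identity in integrated form: the scalar curvature of `ḡ` dominates a
divergence. -/
theorem scalarCurvature_add_mdiv_nonneg (hφ_pos : ∀ p ∈ (𝓡∂ 3).interior M, 0 < φ p)
    (h_energy : ∀ p ∈ (𝓡∂ 3).interior M, momentumNorm D p ≤ energyDensity D p)
    (h_jang : ∀ p ∈ (𝓡∂ 3).interior M, trace (gBar D f φ) (hMinusK D f φ) p = 0)
    {p : M} (hp : p ∈ (𝓡∂ 3).interior M) :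
    0 ≤ scalarCurvature (gBar D f φ) p * φ p + 2 * mdiv (gBar D f φ) (fluxForm D f φ) p := by
  have he := isCoordChart_ichart p
  have hs := mem_ichart_source hp
  have hy : ichart p p ∈ (ichart p).target := (ichart p).map_source hs
  -- The Jang equation is given at each point in that point's own chart; since it will be
  -- differentiated, it is first transported to a whole neighbourhood in the chart at p.
  have htr : ∀ z ∈ (ichart p).target,
      traceC (gbarC (components D.gT (ichart p).toPartialEquiv) (f ∘ (ichart p).symm)
        (φ ∘ (ichart p).symm)) (fun w => hC (components D.gT (ichart p).toPartialEquiv)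
        (f ∘ (ichart p).symm) (φ ∘ (ichart p).symm) w -
          components D.kT (ichart p).toPartialEquiv w) z = 0 := by
    intro z hz
    have hq := he.source_subset ((ichart p).map_target hz)
    have he' := isCoordChart_ichart ((ichart p).symm z)
    have hov : z ∈ (ichart p).target ∩ (ichart p).symm ⁻¹'
      (ichart ((ichart p).symm z)).source := ⟨hz, mem_ichart_source hq⟩
    have h1 := (he.changeOn he').traceC_eq hov
      (he.components_transition he' (isBilin_gBar D f φ) hov)
      (he.components_transition he' (isBilin_hMinusK D f φ) hov)
    have h2 := h1.trans (h_jang _ hq)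
    rw [← h2]
    simp only [traceC, he.components_gBar hf hz, he.components_hMinusK hf hφ hz]
  have key := scalarC_add_codivC_nonneg (he.metricOn_gT D) (ichart p).open_target
    (he.contDiffOn_comp_symm hf) (he.contDiffOn_comp_symm hφ)
    (fun z hz => hφ_pos _ (he.source_subset ((ichart p).map_target hz))) (he.smooth_kT D)
    (fun z _ i j => components_kT_symm D (ichart p) z i j) htr hy (h_energy p hp)
  have h1 : scalarCurvature (gBar D f φ) p = scalarC (gbarC (components D.gT
      (ichart p).toPartialEquiv) (f ∘ (ichart p).symm) (φ ∘ (ichart p).symm)) (ichart p p) :=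
    scalarC_congr_on (ichart p).open_target (fun z hz => he.components_gBar hf hz) hy
  have h2 : mdiv (gBar D f φ) (fluxForm D f φ) p = codivC (gbarC (components D.gT
      (ichart p).toPartialEquiv) (f ∘ (ichart p).symm) (φ ∘ (ichart p).symm))
      (fluxC (components D.gT (ichart p).toPartialEquiv) (components D.kT (ichart p).toPartialEquiv)
        (f ∘ (ichart p).symm) (φ ∘ (ichart p).symm)) (ichart p p) :=
    codivC_congr_on (ichart p).open_target (fun z hz => he.components_gBar hf hz)
      (fun z hz j => acomp_fluxForm hf hφ he hz j) hy
  have h3 : (φ ∘ (ichart p).symm) (ichart p p) = φ p := congrArg φ ((ichart p).left_inv hs)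
  rw [h3] at key
  rw [h1, h2, mul_comm]
  exact key

/-! ### The flux densities -/

omit hf hφ in
omit [IsManifold (𝓡∂ 3) ∞ M] in
theorem IsSliceChart.unitNormal_eq_sum {T : Tensor2 M} (hT : IsBilin T) {U : Set M}
    (he : IsSliceChart U e) {y : EuclideanSpace ℝ (Fin 2)} (hy : planeIncl y ∈ e.target) :
    (unitNormal T U (e.symm (planeIncl y)) : E3) =
      ∑ i, ((components T e.toPartialEquiv (planeIncl y))⁻¹ i 2 /
        Real.sqrt ((components T e.toPartialEquiv (planeIncl y))⁻¹ 2 2)) •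
          cvec e (planeIncl y) i := by
  have hs := e.map_target hy
  have hfr : e.symm (planeIncl y) ∈ frontier U := (he.mem_frontier_iff hs).2 (by
    rw [e.right_inv hy]; rfl)
  have h : sliceNormal T e (e.symm (planeIncl y)) = (∑ i,
      ((components T e.toPartialEquiv (e (e.symm (planeIncl y))))⁻¹ i 2 /
        Real.sqrt ((components T e.toPartialEquiv (e (e.symm (planeIncl y))))⁻¹ 2 2)) •
          cvec e (e (e.symm (planeIncl y))) i : E3) := rfl
  rw [e.right_inv hy] at h
  exact (he.unitNormal_eq hT hs hfr).trans h

/-- Metric, area and normal all belong to ḡ here: pairing α with the unit normal and multiplying by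
the area density gives the coordinate flux. -/
theorem isFluxDensity_infinity (U : Set M) :
    IsFluxDensity (gBar D f φ) (gBar D f φ) (fluxForm D f φ) U fun p =>
      φ p * hMinusK D f φ p (vField D f φ p) (unitNormal (gBar D f φ) U p) := by
  intro e he y hy
  have hG := (isMetric_gBar (D := D) hf hφ).metricOn e he.isCoordChart
  have h1 : φ (e.symm (planeIncl y)) * hMinusK D f φ (e.symm (planeIncl y))
      (vField D f φ (e.symm (planeIncl y))) (unitNormal (gBar D f φ) U (e.symm (planeIncl y))) =
      fluxForm D f φ (e.symm (planeIncl y))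
        (unitNormal (gBar D f φ) U (e.symm (planeIncl y)) : E3) :=
    (fluxForm_apply D f φ _ _).symm
  have h2 : fluxForm D f φ (e.symm (planeIncl y))
        (unitNormal (gBar D f φ) U (e.symm (planeIncl y)) : E3) =
      (∑ i, (components (gBar D f φ) e.toPartialEquiv (planeIncl y))⁻¹ i 2 *
        acomp (fluxForm D f φ) e (planeIncl y) i) /
        Real.sqrt ((components (gBar D f φ) e.toPartialEquiv (planeIncl y))⁻¹ 2 2) := by
    rw [he.unitNormal_eq_sum (isBilin_gBar D f φ) hy, map_sum, Finset.sum_div]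
    refine Finset.sum_congr rfl fun i _ => ?_
    rw [map_smul, smul_eq_mul, acomp]
    ring
  simp only
  rw [h1, h2, sqrt_det_tblock_mul (hG.posDef _ hy)]
  congr 1
  exact Finset.sum_congr rfl fun i _ => by rw [hG.inv_symm hy]

-- Area and normal are now those of g, while the divergence is that of ḡ. Since ḡ⁻¹ = g⁻¹ - v ⊗ v,
-- the g-unit conormal is raised by ḡ to ν - ⟨ν, v⟩ v, and passing from the volume density of ḡ to
-- that of g costs the lapse (1 - |v|²)^{-1/2}; hence the integrand at Σ_ε.
omit hφ in
theorem isFluxDensity_boundary (U : Set M) :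
    IsFluxDensity (gBar D f φ) D.gT (fluxForm D f φ) U fun p =>
      φ p * hMinusK D f φ p (vField D f φ p)
      (unitNormal D.gT U p - D.gT p (unitNormal D.gT U p) (vField D f φ p) • vField D f φ p) /
      Real.sqrt (1 - D.gT p (vField D f φ p) (vField D f φ p)) := by
  intro e he y hy
  have hec := he.isCoordChart
  have hG := hec.metricOn_gT D
  set p := e.symm (planeIncl y) with hpdef
  set G := components D.gT e.toPartialEquiv with hGdef
  set F := f ∘ e.symm
  set Φ := φ ∘ e.symm
  have hν := he.unitNormal_eq_sum D.isBilin_gT hy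
  have hv := hec.vField_eq (D := D) (φ := φ) hf hy
  set ν : E3 := unitNormal D.gT U p
  set v : E3 := vField D f φ p
  have hl := hG.lapC_pos (F := F) (Φ := Φ) hy
  have hvv : tval D.gT p v v = ∑ i, ∑ j, vC G F Φ (planeIncl y) i * vC G F Φ (planeIncl y) j *
      G (planeIncl y) i j := by
    rw [hv, D.isBilin_gT.apply_sum]; rfl
  have hνv : tval D.gT p ν v =
      vC G F Φ (planeIncl y) 2 / Real.sqrt ((G (planeIncl y))⁻¹ 2 2) := by
    rw [hν, hv, D.isBilin_gT.apply_sum, Finset.sum_comm]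
    have e1 : ∀ j, ∑ i, (G (planeIncl y))⁻¹ 2 i * G (planeIncl y) i j = if 2 = j then 1 else 0 :=
      fun j => by rw [← Matrix.mul_apply, hG.inv_mul hy, Matrix.one_apply]
    have e2 : ∀ j, ∑ i, (G (planeIncl y))⁻¹ i 2 / Real.sqrt ((G (planeIncl y))⁻¹ 2 2) *
        vC G F Φ (planeIncl y) j * tval D.gT (e.symm (planeIncl y)) (cvec e (planeIncl y) i)
          (cvec e (planeIncl y) j) = (if 2 = j then 1 else 0) * vC G F Φ (planeIncl y) j /
          Real.sqrt ((G (planeIncl y))⁻¹ 2 2) := fun j => by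
      rw [← e1 j, Finset.sum_mul, Finset.sum_div]
      refine Finset.sum_congr rfl fun i _ => ?_
      rw [hG.inv_symm hy i 2]
      have : tval D.gT (e.symm (planeIncl y)) (cvec e (planeIncl y) i) (cvec e (planeIncl y) j) =
        G (planeIncl y) i j := rfl
      rw [this]; ring
    refine (Finset.sum_congr rfl fun j _ => e2 j).trans ?_
    rw [Fin.sum_univ_three]
    simp
  have h1 : φ p * hMinusK D f φ p (vField D f φ p)
      (unitNormal D.gT U p - D.gT p (unitNormal D.gT U p) (vField D f φ p) • vField D f φ p) =
      fluxForm D f φ p (ν - tval D.gT p ν v • v) := (fluxForm_apply D f φ _ _).symm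
  have h2 : D.gT p (vField D f φ p) (vField D f φ p) = tval D.gT p v v := rfl
  simp only
  rw [h1, h2, hvv, hG.one_sub_normSq_vC hy, hνv]
  rw [hec.components_gBar hf hy, hG.det_gbarC hy, hG.gbarC_inv hy, Real.sqrt_inv,
    Real.sqrt_sq hl.le, div_inv_eq_mul, Real.sqrt_mul (sq_nonneg _), Real.sqrt_sq hl.le]
  have h3 : fluxForm D f φ p (ν - (vC G F Φ (planeIncl y) 2 /
      Real.sqrt ((G (planeIncl y))⁻¹ 2 2)) • v) = (∑ i, ((G (planeIncl y))⁻¹ 2 i -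
        vC G F Φ (planeIncl y) 2 * vC G F Φ (planeIncl y) i) *
        acomp (fluxForm D f φ) e (planeIncl y) i) / Real.sqrt ((G (planeIncl y))⁻¹ 2 2) := by
    rw [map_sub, map_smul, hν, hv, map_sum, map_sum, smul_eq_mul, Finset.mul_sum,
      ← Finset.sum_sub_distrib, Finset.sum_div]
    refine Finset.sum_congr rfl fun i _ => ?_
    rw [map_smul, map_smul, smul_eq_mul, smul_eq_mul, hG.inv_symm hy i 2, acomp]
    ring
  rw [h3, ← mul_assoc, sqrt_det_tblock_mul (hG.posDef _ hy)]
  simp only [Matrix.of_apply]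
  ring

end JangEH

namespace JangEH

/-! ### Slice charts of spheres -/

/-- The local defining map of the sphere of radius `r`: two of the coordinates, and
`|x|² - r²`. -/
noncomputable def sphereMap (m : Fin 3) (r : ℝ) (x : E3) : E3 :=
  !₂[x (m.succAbove 0), x (m.succAbove 1), ‖x‖ ^ 2 - r ^ 2]

theorem contDiff_sphereMap (m : Fin 3) (r : ℝ) : ContDiff ℝ ∞ (sphereMap m r) := by
  rw [contDiff_euclidean]
  intro i
  fin_cases i
  · exact (EuclideanSpace.proj (𝕜 := ℝ) (m.succAbove 0) : E3 →L[ℝ] ℝ).contDiff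
  · exact (EuclideanSpace.proj (𝕜 := ℝ) (m.succAbove 1) : E3 →L[ℝ] ℝ).contDiff
  · exact (contDiff_norm_sq ℝ).sub contDiff_const

/-- A vector in the kernel is orthogonal to x and has only its m-th component possibly nonzero; as x
has a nonzero m-th component, the vector is zero. -/
theorem fderiv_sphereMap_injective {m : Fin 3} {r : ℝ} {x : E3} (hx : x m ≠ 0) :
    Function.Injective (fderiv ℝ (sphereMap m r) x) := by
  rw [injective_iff_map_eq_zero]
  intro v hv
  have hd : HasFDerivAt (sphereMap m r) (fderiv ℝ (sphereMap m r) x) x :=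
    ((contDiff_sphereMap m r).differentiable (by simp) x).hasFDerivAt
  have hd' (i : Fin 3) : HasFDerivAt (fun z => sphereMap m r z i)
      ((EuclideanSpace.proj i : E3 →L[ℝ] ℝ).comp (fderiv ℝ (sphereMap m r) x)) x :=
    (EuclideanSpace.proj i : E3 →L[ℝ] ℝ).hasFDerivAt.comp x hd
  have h0 : v (m.succAbove 0) = 0 := by
    have h1 : HasFDerivAt (fun z : E3 => sphereMap m r z 0)
      (EuclideanSpace.proj (m.succAbove 0) : E3 →L[ℝ] ℝ) x :=
      (EuclideanSpace.proj (m.succAbove 0) : E3 →L[ℝ] ℝ).hasFDerivAt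
    have h2 := congrArg (fun L : E3 →L[ℝ] ℝ => L v) (h1.unique (hd' 0))
    simpa [hv] using h2
  have h1 : v (m.succAbove 1) = 0 := by
    have h1 : HasFDerivAt (fun z : E3 => sphereMap m r z 1)
      (EuclideanSpace.proj (m.succAbove 1) : E3 →L[ℝ] ℝ) x :=
      (EuclideanSpace.proj (m.succAbove 1) : E3 →L[ℝ] ℝ).hasFDerivAt
    have h2 := congrArg (fun L : E3 →L[ℝ] ℝ => L v) (h1.unique (hd' 1))
    simpa [hv] using h2
  have h2 : inner ℝ x v = 0 := by
    have h1 : HasFDerivAt (fun z : E3 => sphereMap m r z 2) _ x :=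
      ((hasFDerivAt_id x).norm_sq).sub_const (r ^ 2)
    have h2 := congrArg (fun L : E3 →L[ℝ] ℝ => L v) (h1.unique (hd' 2))
    simpa [hv] using h2
  rw [PiLp.inner_apply, Fin.sum_univ_succAbove _ m, Fin.sum_univ_two, h0, h1] at h2
  have h3 : v m = 0 := by simpa [hx] using h2
  ext i
  rcases Fin.eq_self_or_eq_succAbove m i with rfl | ⟨j, rfl⟩
  · exact h3
  · fin_cases j
    · exact h0
    · exact h1

/-- Around each point `x ≠ 0` there are coordinates the last of which is `|x|² - r²`. -/
theorem exists_sphere_chart (r : ℝ) {x : E3} (hx : x ≠ 0) :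
    ∃ φ : OpenPartialHomeomorph E3 E3, ContDiffOn ℝ ∞ φ φ.source ∧
      ContDiffOn ℝ ∞ φ.symm φ.target ∧ x ∈ φ.source ∧
      ∀ z ∈ φ.source, φ z 2 = ‖z‖ ^ 2 - r ^ 2 := by
  obtain ⟨m, hm⟩ : ∃ m, x m ≠ 0 := by
    by_contra h
    push Not at h
    exact hx (by ext i; exact h i)
  have hequiv : ∀ z : E3, z m ≠ 0 → ∃ L : E3 ≃L[ℝ] E3,
      HasFDerivAt (sphereMap m r) (L : E3 →L[ℝ] E3) z := fun z hz => by
    have hinj := fderiv_sphereMap_injective (r := r) hz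
    have hsurj : Function.Surjective (fderiv ℝ (sphereMap m r) z).toLinearMap :=
      LinearMap.injective_iff_surjective.1 hinj
    refine ⟨ContinuousLinearEquiv.ofBijective (fderiv ℝ (sphereMap m r) z)
      (LinearMap.ker_eq_bot.2 hinj) (LinearMap.range_eq_top.2 hsurj), ?_⟩
    rw [ContinuousLinearEquiv.coe_ofBijective]
    exact ((contDiff_sphereMap m r).differentiable (by simp) z).hasFDerivAt
  obtain ⟨L, hL⟩ := hequiv x hm
  have hop : IsOpen {z : E3 | z m ≠ 0} :=
    isOpen_ne_fun (EuclideanSpace.proj m : E3 →L[ℝ] ℝ).continuous continuous_const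
  set φ0 := (contDiff_sphereMap m r).contDiffAt.toOpenPartialHomeomorph (sphereMap m r) hL (by simp)
  have hφ0 : x ∈ φ0.source :=
    (contDiff_sphereMap m r).contDiffAt.mem_toOpenPartialHomeomorph_source hL (by simp)
  -- The inverse function theorem provides only a local homeomorphism; restricting to points with
  -- nonzero m-th coordinate keeps the derivative invertible, so the inverse is smooth on the whole
  -- target.
  have hsrc : (φ0.restrOpen {z : E3 | z m ≠ 0} hop).source = φ0.source ∩ {z : E3 | z m ≠ 0} :=
    φ0.restrOpen_source _ hop
  refine ⟨φ0.restrOpen {z : E3 | z m ≠ 0} hop, (contDiff_sphereMap m r).contDiffOn, fun w hw => ?_,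
    ?_, fun z _ => rfl⟩
  · have hz := (φ0.restrOpen {z : E3 | z m ≠ 0} hop).map_target hw
    rw [hsrc] at hz
    obtain ⟨L', hL'⟩ := hequiv _ hz.2
    exact ((φ0.restrOpen {z : E3 | z m ≠ 0} hop).contDiffAt_symm hw hL'
      (contDiff_sphereMap m r).contDiffAt).contDiffWithinAt
  · rw [hsrc]
    exact ⟨hφ0, hm⟩

/-! ### The regions inside the coordinate spheres -/

variable {M : Type*} [TopologicalSpace M] [ChartedSpace (EuclideanHalfSpace 3) M]

namespace Ends

variable {N : ℕ} (E : Ends M N)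

theorem mem_inside {r : ℝ} {p : M} :
    p ∈ E.inside r ↔ ∀ i, p ∈ (E.chart i).source → ‖E.chart i p‖ < r := by
  simp only [inside, mem_compl_iff, mem_iUnion, mem_ofPred_eq, not_exists, not_and, not_le]

theorem inside_mono {r s : ℝ} (h : r ≤ s) : E.inside r ⊆ E.inside s := fun _ hp =>
  E.mem_inside.2 fun i hi => (E.mem_inside.1 hp i hi).trans_le h

theorem exists_radius_lt : ∃ r, ∀ i, E.radius i < r := by
  obtain ⟨r, hr⟩ := (Set.finite_range E.radius).bddAbove
  exact ⟨r + 1, fun i => (hr ⟨i, rfl⟩).trans_lt (lt_add_one r)⟩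

theorem isOpen_inside {r : ℝ} (hr : ∀ i, E.radius i < r) : IsOpen (E.inside r) :=
  (isClosed_iUnion_of_finite fun i => E.isClosed_outer i r (hr i)).isOpen_compl

/-- The part of `M` on and inside the coordinate spheres of radius `r`. -/
def core (r : ℝ) : Set M := (⋃ i, {p | p ∈ (E.chart i).source ∧ r < ‖E.chart i p‖})ᶜ

theorem isOpen_outer (i : Fin N) (r : ℝ) :
    IsOpen {p | p ∈ (E.chart i).source ∧ r < ‖E.chart i p‖} :=
  (E.chart i).isOpen_inter_preimage (isOpen_lt continuous_const continuous_norm)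

theorem isClosed_core (r : ℝ) : IsClosed (E.core r) :=
  (isOpen_iUnion fun i => E.isOpen_outer i r).isClosed_compl

theorem inside_subset_core (r : ℝ) : E.inside r ⊆ E.core r :=
  compl_subset_compl.2 (iUnion_mono fun _ _ hp => ⟨hp.1, hp.2.le⟩)

theorem closure_inside_subset (r : ℝ) : closure (E.inside r) ⊆ E.core r :=
  closure_minimal (E.inside_subset_core r) (E.isClosed_core r)

theorem boundary_subset_inside (r : ℝ) : (𝓡∂ 3).boundary M ⊆ E.inside r := fun p hp =>
  E.mem_inside.2 fun i hi => by
    have h1 := (E.isCoordChart i).source_subset hi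
    rw [← ModelWithCorners.compl_interior] at hp
    exact absurd h1 hp

/-- The regions inside large coordinate spheres are smooth domains. -/
theorem isSmoothDomain_inside {r : ℝ} (hr0 : 0 < r) (hr : ∀ i, E.radius i < r) :
    IsSmoothDomain (E.inside r) where
  isOpen := E.isOpen_inside hr
  exists_slice := fun p hp => by
    have hpi : p ∉ E.inside r := by
      rw [frontier, (E.isOpen_inside hr).interior_eq] at hp; exact hp.2
    have hpc : p ∈ E.core r := E.closure_inside_subset r (frontier_subset_closure hp)
    rw [E.mem_inside] at hpi
    push Not at hpi
    obtain ⟨i, hi, hri⟩ := hpi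
    -- A frontier point is not strictly inside, by openness, and not strictly outside, since the
    -- closure stays in the core.
    have hn : ‖E.chart i p‖ = r := by
      refine le_antisymm (not_lt.1 fun h => hpc ?_) hri
      exact mem_iUnion.2 ⟨i, hi, h⟩
    obtain ⟨φ, hφ, hφ', hmem, hval⟩ := exists_sphere_chart r (x := E.chart i p) (by
      intro h; rw [h, norm_zero] at hn; exact hr0.ne hn)
    refine ⟨(E.chart i).trans φ, ⟨(E.isCoordChart i).trans hφ hφ', fun q hq => ?_⟩, ?_⟩
    · rw [OpenPartialHomeomorph.trans_source] at hq
      have h1 : ((E.chart i).trans φ) q 2 = ‖E.chart i q‖ ^ 2 - r ^ 2 := hval _ hq.2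
      rw [h1, E.mem_inside, sub_neg, sq_lt_sq₀ (norm_nonneg _) hr0.le]
      refine ⟨fun h => h i hq.1, fun h j hj => ?_⟩
      -- The ends are disjoint, so near a sphere of one end the others impose no condition.
      by_cases hij : i = j
      · subst hij; exact h
      · exact absurd hj (disjoint_left.1 (E.disjoint hij) hq.1)
    · rw [OpenPartialHomeomorph.trans_source]
      exact ⟨hi, hmem⟩

/-- A compact set lies inside all large coordinate spheres. -/
theorem eventually_subset_inside {K : Set M} (hK : IsCompact K) : ∀ᶠ r in atTop, K ⊆ E.inside r := by
  obtain ⟨r0, hr0⟩ := E.exists_radius_lt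
  obtain ⟨n, hn⟩ := hK.elim_directed_cover (fun n : ℕ => E.inside (r0 + n))
    (fun n => E.isOpen_inside fun i => (hr0 i).trans_le (by simp))
    (fun p _ => by
      obtain ⟨C, hC⟩ := (Set.finite_range fun i => ‖E.chart i p‖).bddAbove
      obtain ⟨n, hn⟩ := exists_nat_gt (C - r0)
      refine mem_iUnion.2 ⟨n, E.mem_inside.2 fun i _ => ?_⟩
      have : ‖E.chart i p‖ ≤ C := hC ⟨i, rfl⟩
      linarith)
    (Monotone.directed_le fun a b hab => E.inside_mono (by
      have : (a : ℝ) ≤ b := by exact_mod_cast hab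
      linarith))
  filter_upwards [eventually_ge_atTop (r0 + n)] with r hr
  exact hn.trans (E.inside_mono hr)

end Ends

end JangEH

/-! ### The region between two smooth domains, and the exhaustion of the interior. -/

namespace JangEH

variable {M : Type*} [TopologicalSpace M] [ChartedSpace (EuclideanHalfSpace 3) M]
  [IsManifold (𝓡∂ 3) ∞ M] [MeasurableSpace M] [BorelSpace M] [SecondCountableTopology M] [T2Space M]

/-- The divergence theorem on the region between two smooth domains. -/
theorem IsSmoothDomain.setIntegral_mdiv_sdiff {T S S' : Tensor2 M} {al : M → E3 →ₗ[ℝ] ℝ}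
    {V W : Set M} {B B' : M → ℝ} (hW : IsSmoothDomain W) (hV : IsSmoothDomain V) (hVW : V ⊆ W)
    (hT : IsMetric T) (hS : IsMetric S) (hS' : IsMetric S') (hal : SmoothCovector al)
    (hB : IsFluxDensity T S al W B) (hB' : IsFluxDensity T S' al V B')
    (hK : IsCompact (closure W \ V)) (hKi : closure W \ V ⊆ (𝓡∂ 3).interior M) :
    ∫ p in W \ V, mdiv T al p ∂volumeMeasure T =
      ∫ p, B p ∂areaMeasure S W - ∫ p, B' p ∂areaMeasure S' V := by
  have : LocallyCompactSpace M := Manifold.locallyCompact_of_finiteDimensional (𝓡∂ 3)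
  obtain ⟨L, hL, hKL, hLi⟩ := exists_compact_between hK isOpen_interior_manifold hKi
  have hKc : IsClosed (closure W \ V) := isClosed_closure.sdiff hV.isOpen
  -- The covector field is uncontrolled near the boundary of the manifold and at infinity. A cutoff
  -- equal to 1 near the region allows the divergence theorem on W and on V separately; the
  -- contributions over V cancel in the difference.
  obtain ⟨ψ, hψ1, hψ0, -⟩ :=
    exists_contMDiffMap_one_nhds_of_subset_interior (n := ⊤) (𝓡∂ 3) hKc hKL
  have hc : HasCompactSupport ψ := HasCompactSupport.intro hL fun x hx => hψ0 x hx
  have hi : tsupport ψ ⊆ (𝓡∂ 3).interior M :=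
    (closure_minimal (fun x (hx : ψ x ≠ 0) => by_contra fun h => hx (hψ0 x h)) hL.isClosed).trans hLi
  have hone : ∀ p ∈ closure W \ V, ψ p = 1 := fun p hp => hψ1.self_of_nhdsSet p hp
  have hfl : ∀ {S : Tensor2 M} {X : Set M} {B : M → ℝ}, frontier X ⊆ closure W \ V →
      ∫ p, ψ p * B p ∂areaMeasure S X = ∫ p, B p ∂areaMeasure S X := by
    intro S X B hX
    refine integral_congr_ae ?_
    filter_upwards [show ∀ᵐ p ∂areaMeasure S X, p ∈ frontier X from
      IsSliceChart.areaMeasure_compl_frontier S X] with p hp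
    rw [hone p (hX hp), one_mul]
  have h1 := hW.divergence hT hS hal hB ψ.contMDiff hc hi
  have h2 := hV.divergence hT hS' hal hB' ψ.contMDiff hc hi
  rw [hfl fun p hp => ⟨frontier_subset_closure hp, fun h => by
    rw [hW.isOpen.frontier_eq] at hp; exact hp.2 (hVW h)⟩] at h1
  rw [hfl fun p hp => ⟨closure_mono hVW (frontier_subset_closure hp), fun h => by
    rw [hV.isOpen.frontier_eq] at hp; exact hp.2 h⟩] at h2
  rw [← h1, ← h2, ← setIntegral_sdiff hV.isOpen.measurableSet
    (integrable_mdiv_smul hT hal ψ.contMDiff hc hi).integrableOn hVW]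
  refine setIntegral_congr_fun (hW.isOpen.measurableSet.diff hV.isOpen.measurableSet) fun p hp => ?_
  have hpK : p ∈ closure W \ V := ⟨subset_closure hp.1, hp.2⟩
  refine mdiv_congr (hKi hpK) ?_
  filter_upwards [(eventually_nhdsSet_iff_forall.1 hψ1) p hpK] with q hq
  rw [hq, one_smul]

variable {N : ℕ} (E : Ends M N) {U : ℝ → Set M}

omit [IsManifold (𝓡∂ 3) ∞ M] [MeasurableSpace M] [BorelSpace M] [SecondCountableTopology M] in
/-- A compact subset of the interior is eventually contained in the exhausting regions. -/
theorem Ends.eventually_subset_region (hU : IsCollarFamily U) {K : Set M} (hK : IsCompact K)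
    (hKi : K ⊆ (𝓡∂ 3).interior M) :
    ∀ᶠ x : ℝ × ℝ in 𝓝[>] 0 ×ˢ atTop, K ⊆ E.inside x.2 \ U x.1 := by
  have h1 := hU.shrinks Kᶜ hK.isClosed.isOpen_compl (by
    rw [← ModelWithCorners.compl_interior]; exact compl_subset_compl.2 hKi)
  filter_upwards [h1.prod_mk (E.eventually_subset_inside hK)] with x hx p hp
  exact ⟨hx.2 hp, fun h => hx.1 h hp⟩

/-- The measures of the exhausting regions converge to the measure of the interior. -/
theorem Ends.tendsto_measure_region (hU : IsCollarFamily U) {ν : Measure M}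
    (hν : ν ((𝓡∂ 3).interior M)ᶜ = 0) :
    Tendsto (fun x : ℝ × ℝ => ν (E.inside x.2 \ U x.1)) (𝓝[>] 0 ×ˢ atTop) (𝓝 (ν univ)) := by
  have : LocallyCompactSpace M := Manifold.locallyCompact_of_finiteDimensional (𝓡∂ 3)
  have hio : IsOpen ((𝓡∂ 3).interior M) := isOpen_interior_manifold
  have : LocallyCompactSpace ((𝓡∂ 3).interior M) := hio.locallyCompactSpace
  obtain ⟨K, hK, hKU⟩ : IsSigmaCompact ((𝓡∂ 3).interior M) :=
    isSigmaCompact_iff_sigmaCompactSpace.2 inferInstance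
  have huniv : ν univ = ν (⋃ n, K n) := by
    rw [hKU, ← measure_add_measure_compl hio.measurableSet, hν, add_zero]
  refine tendsto_order.2 ⟨fun c hc => ?_, fun c hc => Eventually.of_forall fun x =>
    (measure_mono (subset_univ _)).trans_lt hc⟩
  rw [huniv] at hc
  -- The regions need not be nested in ε, so monotone convergence is applied to a compact exhaustion
  -- of the interior, each member of which is eventually swallowed by the regions.
  obtain ⟨n, hn⟩ := ((tendsto_measure_iUnion_accumulate (μ := ν) (f := K)).eventually
    (lt_mem_nhds hc)).exists
  have hsub : accumulate K n ⊆ (𝓡∂ 3).interior M := by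
    rw [← hKU]; exact accumulate_subset_iUnion n
  have hcpt : IsCompact (accumulate K n) := by
    rw [accumulate_def]; exact (finite_le_nat n).isCompact_biUnion fun i _ => hK i
  filter_upwards [E.eventually_subset_region hU hcpt hsub] with x hx
  exact hn.trans_le (measure_mono hx)

omit [IsManifold (𝓡∂ 3) ∞ M] [MeasurableSpace M] [BorelSpace M] [SecondCountableTopology M]
  [T2Space M] in
/-- The exhausting regions are eventually relatively compact in the interior. -/
theorem Ends.eventually_isCompact_region (hU : IsCollarFamily U) :
    ∀ᶠ x : ℝ × ℝ in 𝓝[>] 0 ×ˢ atTop, IsSmoothDomain (E.inside x.2) ∧ IsSmoothDomain (U x.1) ∧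
      U x.1 ⊆ E.inside x.2 ∧ IsCompact (closure (E.inside x.2) \ U x.1) ∧
      closure (E.inside x.2) \ U x.1 ⊆ (𝓡∂ 3).interior M := by
  obtain ⟨r, hr⟩ := E.exists_radius_lt
  have h1 := hU.shrinks _ (E.isOpen_inside hr) (E.boundary_subset_inside r)
  filter_upwards [(h1.and self_mem_nhdsWithin).prod_mk
    ((eventually_ge_atTop r).and (eventually_gt_atTop 0))] with x ⟨⟨hx1, hx2⟩, hx3, hx4⟩
  have hV := hU.isSmoothDomain x.1 hx2
  refine ⟨E.isSmoothDomain_inside hx4 fun i => (hr i).trans_le hx3, hV,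
    hx1.trans (E.inside_mono hx3), ?_, fun p hp => ?_⟩
  · exact ((E.isCompact_core x.2).of_isClosed_subset isClosed_closure
      (E.closure_inside_subset x.2)).diff hV.isOpen
  · by_contra h
    refine hp.2 (hU.boundary_subset x.1 hx2 ?_)
    rw [← ModelWithCorners.compl_interior]
    exact h

variable {D : CauchyData M} {f φ : M → ℝ}
  (hf : ContMDiffOn (𝓡∂ 3) 𝓘(ℝ, ℝ) ∞ f ((𝓡∂ 3).interior M))
  (hφ : ContMDiffOn (𝓡∂ 3) 𝓘(ℝ, ℝ) ∞ φ ((𝓡∂ 3).interior M))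

include hf hφ

/-- The integral of the divergence of the flux form over the exhausting regions. -/
theorem eventually_integral_mdiv (hU : IsCollarFamily U) :
    ∀ᶠ x : ℝ × ℝ in 𝓝[>] 0 ×ˢ atTop,
      IntegrableOn (fun p => scalarCurvature (gBar D f φ) p * φ p) (E.inside x.2 \ U x.1)
        (volumeMeasure (gBar D f φ)) ∧
      IntegrableOn (mdiv (gBar D f φ) (fluxForm D f φ)) (E.inside x.2 \ U x.1)
        (volumeMeasure (gBar D f φ)) ∧
      MeasurableSet (E.inside x.2 \ U x.1) ∧
      ∫ p in E.inside x.2 \ U x.1, mdiv (gBar D f φ) (fluxForm D f φ) p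
        ∂volumeMeasure (gBar D f φ) = fluxAtInfinity D f φ E x.2 - fluxAtBoundary D f φ (U x.1) := by
  filter_upwards [E.eventually_isCompact_region hU] with x ⟨hW, hV, hVW, hK, hKi⟩
  have hT := isMetric_gBar (D := D) hf hφ
  have hal := smoothCovector_fluxForm (D := D) hf hφ
  have hsub : E.inside x.2 \ U x.1 ⊆ closure (E.inside x.2) \ U x.1 :=
    sdiff_subset_sdiff_left subset_closure
  exact ⟨(integrableOn_of_compact hT ((continuousOn_scalarCurvature hT).mul hφ.continuousOn) hK
      hK.isClosed.measurableSet hKi).mono_set hsub,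
    (integrableOn_of_compact hT (continuousOn_mdiv hT hal) hK
      hK.isClosed.measurableSet hKi).mono_set hsub,
    hW.isOpen.measurableSet.diff hV.isOpen.measurableSet,
    hW.setIntegral_mdiv_sdiff hV hVW hT hT isMetric_gT hal
      (isFluxDensity_infinity hf hφ _) (isFluxDensity_boundary hf _) hK hKi⟩

end JangEH

/-! ### Limits of integrals over an exhaustion. -/

namespace JangEH

section Exhaustion

variable {α ι : Type*} [MeasurableSpace α] {μ : Measure α} {l : Filter ι} {A : ι → Set α}
  {F Q : α → ℝ} {δ : ι → ℝ}

/-- Integrals over an exhaustion of a function which differs from a nonnegative one by a term whose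
integral tends to zero converge in the extended reals. -/
theorem tendsto_setIntegral_of_nonneg_add
    (hA : ∀ᶠ x in l, IntegrableOn F (A x) μ ∧ IntegrableOn Q (A x) μ ∧ MeasurableSet (A x) ∧
      ∫ p in A x, Q p ∂μ = δ x)
    (hδ : Tendsto δ l (𝓝 0)) (hP : ∀ᵐ p ∂μ, 0 ≤ F p + 2 * Q p)
    (hlim : ∀ G : α → ENNReal, Tendsto (fun x => ∫⁻ p in A x, G p ∂μ) l (𝓝 (∫⁻ p, G p ∂μ))) :
    Tendsto (fun x => ((∫ p in A x, F p ∂μ : ℝ) : EReal)) l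
      (𝓝 ((∫⁻ p, ENNReal.ofReal (F p + 2 * Q p) ∂μ : ENNReal) : EReal)) := by
  have h1 : Tendsto (fun x => ((∫⁻ p in A x, ENNReal.ofReal (F p + 2 * Q p) ∂μ : ENNReal) : EReal))
      l (𝓝 ((∫⁻ p, ENNReal.ofReal (F p + 2 * Q p) ∂μ : ENNReal) : EReal)) :=
    (continuous_coe_ennreal_ereal.tendsto _).comp (hlim _)
  have h2 : Tendsto (fun x => ((-(2 * δ x) : ℝ) : EReal)) l (𝓝 ((0 : ℝ) : EReal)) := by
    refine (continuous_coe_real_ereal.tendsto _).comp ?_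
    simpa using (hδ.const_mul 2).neg
  -- Addition of extended reals is continuous here because the second limit is finite, even if the
  -- first is infinite.
  have h3 := (EReal.continuousAt_add (p := (((∫⁻ p, ENNReal.ofReal (F p + 2 * Q p) ∂μ : ENNReal) :
    EReal), ((0 : ℝ) : EReal))) (by simp) (by simp)).tendsto.comp (h1.prodMk_nhds h2)
  simp only [EReal.coe_zero, add_zero] at h3
  refine h3.congr' ?_
  filter_upwards [hA] with x ⟨hF, hQ, _, hQδ⟩
  have h4 : ∫ p in A x, (F p + 2 * Q p) ∂μ = ∫ p in A x, F p ∂μ + 2 * δ x := by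
    rw [integral_add hF (hQ.const_mul 2), integral_const_mul, hQδ]
  have hint : IntegrableOn (fun p => F p + 2 * Q p) (A x) μ := hF.add (hQ.const_mul 2)
  have h5 : ENNReal.ofReal (∫ p in A x, (F p + 2 * Q p) ∂μ) =
      ∫⁻ p in A x, ENNReal.ofReal (F p + 2 * Q p) ∂μ :=
    ofReal_integral_eq_lintegral_ofReal hint (ae_restrict_of_ae hP)
  have h6 : 0 ≤ ∫ p in A x, (F p + 2 * Q p) ∂μ :=
    integral_nonneg_of_ae (ae_restrict_of_ae hP)
  change ((∫⁻ p in A x, ENNReal.ofReal (F p + 2 * Q p) ∂μ : ENNReal) : EReal) +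
    ((-(2 * δ x) : ℝ) : EReal) = _
  rw [← h5, EReal.coe_ennreal_ofReal, max_eq_left h6, h4, ← EReal.coe_add]
  ring_nf

/-- Under the same hypotheses the negative part is dominated by the positive part. -/
theorem lintegral_neg_le_lintegral_of_nonneg_add [l.NeBot]
    (hA : ∀ᶠ x in l, IntegrableOn F (A x) μ ∧ IntegrableOn Q (A x) μ ∧ MeasurableSet (A x) ∧
      ∫ p in A x, Q p ∂μ = δ x)
    (hδ : Tendsto δ l (𝓝 0)) (hP : ∀ᵐ p ∂μ, 0 ≤ F p + 2 * Q p)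
    (hlim : ∀ G : α → ENNReal, Tendsto (fun x => ∫⁻ p in A x, G p ∂μ) l (𝓝 (∫⁻ p, G p ∂μ))) :
    ∫⁻ p, ENNReal.ofReal (-F p) ∂μ ≤ ∫⁻ p, ENNReal.ofReal (F p) ∂μ := by
  have h1 : Tendsto (fun x => ∫⁻ p, ENNReal.ofReal (F p) ∂μ + ENNReal.ofReal (2 * δ x)) l
      (𝓝 (∫⁻ p, ENNReal.ofReal (F p) ∂μ)) := by
    have h2 : Tendsto (fun x => ENNReal.ofReal (2 * δ x)) l (𝓝 0) := by
      have := (ENNReal.continuous_ofReal.tendsto (2 * 0)).comp (hδ.const_mul 2)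
      simpa only [mul_zero, ENNReal.ofReal_zero, Function.comp_def] using this
    simpa using tendsto_const_nhds.add h2
  refine le_of_tendsto_of_tendsto (hlim _) h1 ?_
  filter_upwards [hA] with x ⟨hF, hQ, _, hQδ⟩
  -- On one region the negative part exceeds the positive part by at most 2 δ. Enlarging the
  -- positive part to the whole space before taking the limit avoids any integrability of F there.
  refine le_trans ?_ (add_le_add_left (setLIntegral_le_lintegral (A x) _) _)
  have h4 : 0 ≤ ∫ p in A x, F p ∂μ + 2 * δ x := by
    rw [← hQδ, ← integral_const_mul, ← integral_add hF (hQ.const_mul 2)]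
    exact integral_nonneg_of_ae (ae_restrict_of_ae hP)
  have hp : ∫⁻ p in A x, ENNReal.ofReal (F p) ∂μ ≠ ⊤ := hF.lintegral_lt_top.ne
  have hn : ∫⁻ p in A x, ENNReal.ofReal (-F p) ∂μ ≠ ⊤ := hF.neg.lintegral_lt_top.ne
  rw [integral_eq_lintegral_pos_part_sub_lintegral_neg_part hF] at h4
  rw [← ENNReal.ofReal_toReal hn, ← ENNReal.ofReal_toReal hp]
  refine (ENNReal.ofReal_le_ofReal (by linarith)).trans ENNReal.ofReal_add_le

end Exhaustion

theorem integral_nonneg_of_lintegral_neg_le {α : Type*} [MeasurableSpace α] {μ : Measure α}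
    {F : α → ℝ}
    (h : ∫⁻ p, ENNReal.ofReal (-F p) ∂μ ≤ ∫⁻ p, ENNReal.ofReal (F p) ∂μ) : 0 ≤ ∫ p, F p ∂μ := by
  by_cases hF : Integrable F μ
  · rw [integral_eq_lintegral_pos_part_sub_lintegral_neg_part hF, sub_nonneg]
    exact ENNReal.toReal_mono hF.lintegral_lt_top.ne h
  -- The integral of a nonintegrable function is zero by convention.
  · rw [integral_undef hF]

end JangEH

theorem theorem6 {M : Type*} [TopologicalSpace M] [T2Space M] [SecondCountableTopology M]
    [ChartedSpace (EuclideanHalfSpace 3) M] [IsManifold (𝓡∂ 3) ∞ M]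
    [MeasurableSpace M] [BorelSpace M]
    (D : JangEH.CauchyData M) {N : ℕ} (E : JangEH.Ends M N)
    (f φ : M → ℝ)
    (hf : ContMDiffOn (𝓡∂ 3) 𝓘(ℝ, ℝ) ∞ f ((𝓡∂ 3).interior M))
    (hφ : ContMDiffOn (𝓡∂ 3) 𝓘(ℝ, ℝ) ∞ φ ((𝓡∂ 3).interior M))
    (hφ_pos : ∀ p ∈ (𝓡∂ 3).interior M, 0 < φ p)
    (h_energy : ∀ p ∈ (𝓡∂ 3).interior M, JangEH.momentumNorm D p ≤ JangEH.energyDensity D p)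
    (h_jang : ∀ p ∈ (𝓡∂ 3).interior M,
      JangEH.trace (JangEH.gBar D f φ) (JangEH.hMinusK D f φ) p = 0)
    (h_infinity : Tendsto (fun r => JangEH.fluxAtInfinity D f φ E r) atTop (𝓝 0))
    (U : ℝ → Set M) (hU : JangEH.IsCollarFamily U)
    (h_boundary : Tendsto (fun ε => JangEH.fluxAtBoundary D f φ (U ε)) (𝓝[>] 0) (𝓝 0)) :
    -- the integrals over the exhausting regions exist and converge to a limit in `[0, ∞]`
    (∀ᶠ x : ℝ × ℝ in 𝓝[>] 0 ×ˢ atTop,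
      IntegrableOn (fun p => JangEH.scalarCurvature (JangEH.gBar D f φ) p * φ p)
        (E.inside x.2 \ U x.1) (JangEH.volumeMeasure (JangEH.gBar D f φ))) ∧
    (∃ L : EReal, 0 ≤ L ∧
      Tendsto (fun x : ℝ × ℝ =>
        ((∫ p in E.inside x.2 \ U x.1, JangEH.scalarCurvature (JangEH.gBar D f φ) p * φ p
          ∂(JangEH.volumeMeasure (JangEH.gBar D f φ)) : ℝ) : EReal))
        (𝓝[>] 0 ×ˢ atTop) (𝓝 L)) ∧
    -- the negative part of the integrand never outweighs the positive part
    (∫⁻ p, ENNReal.ofReal (-(JangEH.scalarCurvature (JangEH.gBar D f φ) p * φ p))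
        ∂(JangEH.volumeMeasure (JangEH.gBar D f φ)) ≤
      ∫⁻ p, ENNReal.ofReal (JangEH.scalarCurvature (JangEH.gBar D f φ) p * φ p)
        ∂(JangEH.volumeMeasure (JangEH.gBar D f φ))) ∧
    -- the Lebesgue integral is nonnegative
    0 ≤ ∫ p, JangEH.scalarCurvature (JangEH.gBar D f φ) p * φ p
      ∂(JangEH.volumeMeasure (JangEH.gBar D f φ)) := by
  have hT := JangEH.isMetric_gBar (D := D) hf hφ
  have hint : ∀ᵐ p ∂JangEH.volumeMeasure (JangEH.gBar D f φ), p ∈ (𝓡∂ 3).interior M :=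
    JangEH.volumeMeasure_compl_interior hT.bilin
  have hP : ∀ᵐ p ∂JangEH.volumeMeasure (JangEH.gBar D f φ),
      0 ≤ JangEH.scalarCurvature (JangEH.gBar D f φ) p * φ p +
        2 * JangEH.mdiv (JangEH.gBar D f φ) (JangEH.fluxForm D f φ) p := by
    filter_upwards [hint] with p hp
    exact JangEH.scalarCurvature_add_mdiv_nonneg hf hφ hφ_pos h_energy h_jang hp
  have hA := JangEH.eventually_integral_mdiv (D := D) E hf hφ hU
  have hδ : Tendsto (fun x : ℝ × ℝ => JangEH.fluxAtInfinity D f φ E x.2 -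
      JangEH.fluxAtBoundary D f φ (U x.1)) (𝓝[>] 0 ×ˢ atTop) (𝓝 0) := by
    simpa using (h_infinity.comp tendsto_snd).sub (h_boundary.comp tendsto_fst)
  -- Convergence of measures of the regions, applied to the measure with density G, which inherits
  -- from the volume that the boundary is null.
  have hlim (G : M → ENNReal) : Tendsto (fun x : ℝ × ℝ => ∫⁻ p in E.inside x.2 \ U x.1, G p
      ∂JangEH.volumeMeasure (JangEH.gBar D f φ)) (𝓝[>] 0 ×ˢ atTop)
      (𝓝 (∫⁻ p, G p ∂JangEH.volumeMeasure (JangEH.gBar D f φ))) := by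
    have h := E.tendsto_measure_region hU
      (withDensity_absolutelyContinuous (JangEH.volumeMeasure (JangEH.gBar D f φ)) G hint)
    rw [withDensity_apply _ MeasurableSet.univ, Measure.restrict_univ] at h
    refine h.congr' ?_
    filter_upwards [hA] with x hx
    exact withDensity_apply _ hx.2.2.1
  have hneg := JangEH.lintegral_neg_le_lintegral_of_nonneg_add hA hδ hP hlim
  exact ⟨hA.mono fun _ hx => hx.1, ⟨_, EReal.coe_ennreal_nonneg _,
    JangEH.tendsto_setIntegral_of_nonneg_add hA hδ hP hlim⟩, hneg,
    JangEH.integral_nonneg_of_lintegral_neg_le hneg⟩
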